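/- Let $n\in\mathbb Z$. Let $T_{2n}\subset S^3$ be a knot with Conway's notation $C(2n,3)$, that is, a knot ambient isotopic to the one with the standard diagram consisting of $2n$ right-handed horizontal crossings and $3$ left-handed vertical crossings (for $n<0$: $2|n|$ left-handed horizontal crossings), in which the two right ends of the horizontal twist region are joined to the two left ends of the vertical one, the upper left end of the horizontal region is joined over the top to the upper right end of the vertical one, and the lower left end is joined around the bottom to the lower right end. Let $X_{2n}$ be the exterior of $T_{2n}$, meaning either the complement $S^3\setminus T_{2n}$ or $S^3$ minus an open tubular neighbourhood of $T_{2n}$. Then, for every base point, $$\pi_1(X_{2n})\cong\left\langle s,t \mid s w t^{-1} w^{-1}=1\right\rangle,\qquad w=(ts^{-1}tst^{-1}s)^n .$$ Moreover, for $n\neq 0$ let $\alpha=|6n+1|$ and $r=\frac{4n+1}{6n+1}$, and let $$u=t^{\varepsilon_1}s^{\varepsilon_2}t^{\varepsilon_3}\cdots s^{\varepsilon_{\alpha-1}},\qquad \varepsilon_i=(-1)^{\lfloor i r\rfloor},$$ be the word read along an underpass of Schubert's normal form of slope $r$, whose two overbridges have meridians $s$ and $t$; the relation read from this normal form is $s=utu^{-1}$.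 If $n>0$, then the reduced form of the word $swt^{-1}w^{-1}$ is $s\,u\,t^{-1}u^{-1}$, so the relation above is the one read from Schubert's normal form. If $n<0$, then the reduced form of $swt^{-1}w^{-1}$ is $u\,t^{-1}u^{-1}s$, so the reduced relation is $s^{-1}=ut^{-1}u^{-1}$, obtained from the one read from Schubert's normal form by taking the inverse of both sides. -/

import Mathlib

namespace TwoBridge

/-! ### Knots in the three-sphere -/

/-- The three-sphere, as Euclidean three-space with coordinates `(x, y, z)` together with one point
at infinity. -/
abbrev S3 : Type := OnePoint (ℝ × ℝ × ℝ)

/-- Two subsets of a space are ambient isotopic: there is a continuous family of self-homeomorphisms,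
starting at the identity, whose final member carries the first set onto the second. -/
def AmbientIsotopic {X : Type*} [TopologicalSpace X] (A B : Set X) : Prop :=
  ∃ H : unitInterval → (X ≃ₜ X),
    Continuous (fun p : unitInterval × X => H p.1 p.2) ∧
      H 0 = Homeomorph.refl X ∧ H 1 '' A = B

/-- A tubular neighbourhood of `K`: an open embedding `φ` of `S¹ × ℂ` whose core `S¹ × {0}`
is mapped onto `K`. The closed tube is the image of `S¹ ×` (closed unit disc). -/
def IsTubularNeighbourhood {X : Type*} [TopologicalSpace X] (φ : Circle × ℂ → X) (K : Set X) :
    Prop :=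
  Topology.IsOpenEmbedding φ ∧ φ '' {p | p.2 = 0} = K

/-- The exterior determined by a tubular neighbourhood: what is left of the ambient space once the
open tube `S¹ ×` (open unit disc) is removed. -/
def exterior {X : Type*} (φ : Circle × ℂ → X) : Set X :=
  (φ '' {p | ‖p.2‖ < 1})ᶜ

/-! ### The Conway diagram `C(a, b)`

The projection is `(x, y, z) ↦ (x, y)`, and larger `z` is in front. -/

/-- `a` right-handed horizontal crossings (left-handed if `a < 0`): two strands winding around the
segment from `(-3, 0, 0)` to `(-1, 0, 0)`, making `a` half turns. The four ends are
`(-3, ±1, 0)` and `(-1, ±1, 0)`. -/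
def horizontalTwists (a : ℤ) : Set (ℝ × ℝ × ℝ) :=
  {p | ∃ u ∈ Set.Icc (0 : ℝ) 1, ∃ σ : ℝ, (σ = 1 ∨ σ = -1) ∧
    p = (-3 + 2 * u, σ * Real.cos (a * Real.pi * u), σ * Real.sin (a * Real.pi * u))}

/-- `b` left-handed vertical crossings (right-handed if `b < 0`): two strands winding around the
segment from `(2, -1, 0)` to `(2, 1, 0)`, making `b` half turns. The four ends are
`(1, ±1, 0)` and `(3, ±1, 0)`. -/
def verticalTwists (b : ℤ) : Set (ℝ × ℝ × ℝ) :=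
  {p | ∃ v ∈ Set.Icc (0 : ℝ) 1, ∃ σ : ℝ, (σ = 1 ∨ σ = -1) ∧
    p = (2 + σ * Real.cos (b * Real.pi * v), -1 + 2 * v, σ * Real.sin (b * Real.pi * v))}

/-- The crossingless arcs joining the two twist regions. The upper and the lower right ends of the
horizontal region are joined by straight segments to the left ends of the vertical region; the upper
left end of the horizontal region is joined over the top to the upper right end of the vertical
region, and the lower ones are joined symmetrically around the bottom. -/
def connectingArcs : Set (ℝ × ℝ × ℝ) :=
  {p | p.2.2 = 0 ∧
    (((p.2.1 = 1 ∨ p.2.1 = -1) ∧ p.1 ∈ Set.Icc (-1 : ℝ) 1) ∨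
      ((p.2.1 = 2 ∨ p.2.1 = -2) ∧ p.1 ∈ Set.Icc (-3 : ℝ) 3) ∨
      ((p.1 = 3 ∨ p.1 = -3) ∧ |p.2.1| ∈ Set.Icc (1 : ℝ) 2))}

/-- The standard picture of Conway's `C(a, b)`: `a` horizontal and `b` vertical crossings, with the
handedness for which the diagram is alternating when `a` and `b` have the same sign. -/
def conwayModel (a b : ℤ) : Set S3 :=
  (fun p : ℝ × ℝ × ℝ => (p : S3)) '' (horizontalTwists a ∪ verticalTwists b ∪ connectingArcs)

/-- `K` is the knot (or link) in `S³` with Conway's notation `C(a, b)`. -/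
def HasConwayNotation (a b : ℤ) (K : Set S3) : Prop :=
  AmbientIsotopic (conwayModel a b) K

/-! ### The presentation -/

/-- The two generators. -/
inductive Gen
  | s
  | t
  deriving DecidableEq

/-- The generator `s` of the free group on `s, t`. -/
def s : FreeGroup Gen := FreeGroup.of Gen.s

/-- The generator `t` of the free group on `s, t`. -/
def t : FreeGroup Gen := FreeGroup.of Gen.t

/-- `w = (t s⁻¹ t s t⁻¹ s)ⁿ`. -/
def w (n : ℤ) : FreeGroup Gen := (t * s⁻¹ * t * s * t⁻¹ * s) ^ n

/-- The relator `s w t⁻¹ w⁻¹`. -/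
def relator (n : ℤ) : FreeGroup Gen := s * w n * t⁻¹ * (w n)⁻¹

/-- The group `⟨s, t | s w t⁻¹ w⁻¹ = 1⟩`. -/
abbrev knotGroup (n : ℤ) : Type := PresentedGroup {relator n}

/-! ### Schubert's normal form

The normal form of slope `r = β / α` (in lowest terms, `α` and `β` odd) is drawn on the sphere
`ℝ² / Γ`, where `Γ` is generated by the half-turns about the points of `ℤ²`. Its two straight
overbridges are the images of the vertical segments `{0} × [0, 1]` and `{1} × [0, 1]`, both oriented
upwards, with meridians `s` and `t` respectively. One of the two underpasses is the image of the
straight segment from `(0, 0)` to `(α, β)`; it runs from the first bridge to the second one. -/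

/-- The vertical line `{i} × ℝ` covers the bridge of `s` if `i` is even, that of `t` if `i`
is odd. -/
def bridge (i : ℕ) : Gen := if Even i then Gen.s else Gen.t

/-- The lift `{i} × [j, j + 1]` of a bridge is a translate of the oriented bridge by an element
of `2ℤ²`, hence oriented upwards, if `j` is even; if `j` is odd it is obtained by a half-turn and is
oriented downwards. -/
def pointsUp (j : ℤ) : Bool := decide (Even j)

/-- The word read along the underpass in the normal form of slope `r`. The interior of the segment
from `(0, 0)` to `(α, β)` meets the lifted bridges at the points `(i, i r)`, `0 < i < α`, in this
order. Each crossing contributes the generator of the bridge, with exponent `1` (`true`) or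
`-1` (`false`) according to the direction in which the bridge crosses. -/
def schubertWord (r : ℚ) : List (Gen × Bool) :=
  (List.range (r.den - 1)).map fun k => (bridge (k + 1), pointsUp ⌊((k + 1 : ℕ) : ℚ) * r⌋)

end TwoBridge

/-!
Van Kampen's theorem is used in cocycle form: for an open cover of `X` by simply connected pieces
that all meet one of them, with no connectedness of the overlaps, homomorphisms from `π₁(X)` to `H`
correspond to `H`-valued locally constant Čech cocycles up to change of frame. A cocycle from which
all others are induced, and whose holonomies generate `G`, therefore identifies `π₁(X)` with `G`.

The complement of the model of `C(2n, 3)` is covered by what is visible from above the plane of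
projection, what is visible from below, a neighbourhood of infinity, and one box around each twist
region. The parts visible from above and from below meet in the four faces of the diagram, so a
cocycle amounts to a label on each face, equal to `1` on the outer one. A twist region is
straightened by a rotation that turns with the axis; comparing the frames before and after its half
twists gives one relation between the labels of the four faces around the box. The two
relations say that the labels are determined by two elements `s` and `t` with `s w = w t`.

The reduced words come from `r` being close to `2 / 3`: `⌊i r⌋` is `⌊2i / 3⌋` for `n > 0` and
`⌊(2i - 1) / 3⌋` for `n < 0`, so the letters of `u` have period six, the period of `w`, and they
alternate between `s` and `t`, which makes the words reduced.
-/

namespace TwoBridge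

open Topology Filter Set

/-! ### The fundamental group from a cocycle on an open cover -/

section Paths

variable {X ι : Type*} [TopologicalSpace X]

theorem pathClass_trans_symm {x y z : X} (p : Path.Homotopic.Quotient x y)
    (q : Path.Homotopic.Quotient y z) : (p.trans q).symm = q.symm.trans p.symm := by
  induction p with | mk p => ?_
  induction q with | mk q => ?_
  simp only [← Path.Homotopic.Quotient.mk_trans, ← Path.Homotopic.Quotient.mk_symm,
    Path.trans_symm]

theorem pathClass_trans_symm_trans {x y z : X} (p : Path.Homotopic.Quotient x y)
    (q : Path.Homotopic.Quotient x z) : p.trans (p.symm.trans q) = q := by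
  grind

theorem pathClass_symm_trans_trans {x y z : X} (p : Path.Homotopic.Quotient x y)
    (q : Path.Homotopic.Quotient y z) : p.symm.trans (p.trans q) = q := by
  grind

theorem subpath_mem_of_Icc_subset {x y : X} {γ : Path x y} {r₀ r₁ : unitInterval} (h : r₀ ≤ r₁)
    {V : Set X} (hV : Icc r₀ r₁ ⊆ γ ⁻¹' V) (τ : unitInterval) : γ.subpath r₀ r₁ τ ∈ V := by
  have hτ := mem_range_self (f := γ.subpath r₀ r₁) τ
  rw [Path.range_subpath_of_le _ _ _ h] at hτ
  exact image_subset_iff.2 hV hτ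

theorem pathClass_induction {U : ι → Set X} (hU : ∀ i, IsOpen (U i)) (hcov : ∀ x, ∃ i, x ∈ U i)
    {P : ∀ {x y : X}, Path.Homotopic.Quotient x y → Prop}
    (short : ∀ i {x y : X} (γ : Path x y), (∀ τ, γ τ ∈ U i) → P (.mk γ))
    (trans : ∀ {x y z : X} (p : Path.Homotopic.Quotient x y) (q : Path.Homotopic.Quotient y z),
      P p → P q → P (p.trans q))
    {x y : X} (p : Path.Homotopic.Quotient x y) : P p := by
  induction p with | mk γ =>
  have P_cast : ∀ {x y x' y' : X} (p : Path.Homotopic.Quotient x y) (hx : x' = x) (hy : y' = y),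
      P p → P (p.cast hx hy) := by
    rintro x y _ _ p rfl rfl h
    simpa using h
  obtain ⟨r, r_zero, r_mono, ⟨N, hN⟩, hr⟩ := exists_monotone_Icc_subset_open_cover_unitInterval
    (c := fun i => γ ⁻¹' U i) (fun i => (hU i).preimage γ.continuous)
    (fun τ _ => by simpa using hcov (γ τ))
  have initial : ∀ m, P (.mk (γ.subpath 0 (r m))) := by
    intro m
    induction m with
    | zero =>
      obtain ⟨i, hi⟩ := hcov (γ 0)
      rw [r_zero]
      exact short i _ fun τ => by simpa using hi
    | succ m ih =>
      obtain ⟨i, hi⟩ := hr m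
      have step : P (.mk (γ.subpath (r m) (r (m + 1)))) :=
        short i _ (subpath_mem_of_Icc_subset (r_mono m.le_succ) hi)
      have concat := trans _ _ ih step
      rwa [← Path.Homotopic.Quotient.mk_trans,
        Path.Homotopic.Quotient.eq.2 ⟨Path.Homotopy.subpathTransSubpath γ 0 (r m) (r (m + 1))⟩]
        at concat
  have full := initial N
  rw [hN N le_rfl, Path.subpath_zero_one] at full
  simpa using P_cast _ γ.source.symm γ.target.symm full

end Paths

section Cocycle

variable {X ι G : Type*} [Group G]

/-- The Čech cocycle condition for group-valued functions on the overlaps of a cover. The functions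
are total; only their values on the overlaps `U i ∩ U j` matter. -/
def IsCocycle (U : ι → Set X) (c : ι → ι → X → G) : Prop :=
  ∀ i j k, ∀ x, x ∈ U i → x ∈ U j → x ∈ U k → c i j x * c j k x = c i k x

theorem IsCocycle.self {U : ι → Set X} {c : ι → ι → X → G} (hc : IsCocycle U c) {i : ι} {x : X}
    (hx : x ∈ U i) : c i i x = 1 := by
  simpa using hc i i i x hx hx hx

theorem IsCocycle.inv {U : ι → Set X} {c : ι → ι → X → G} (hc : IsCocycle U c) {i j : ι} {x : X}
    (hi : x ∈ U i) (hj : x ∈ U j) : (c i j x)⁻¹ = c j i x := by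
  rw [inv_eq_iff_mul_eq_one, hc i j i x hi hj hi, hc.self hi]

variable [TopologicalSpace X]

/-- A Čech cocycle on a cover which is constant along paths in the overlaps. -/
structure IsFlatCocycle (U : ι → Set X) (c : ι → ι → X → G) : Prop where
  isCocycle : IsCocycle U c
  eq_of_joinedIn : ∀ i j x y, JoinedIn (U i ∩ U j) x y → c i j x = c i j y

/-- The functions with values in `G` on the overlaps of an open cover form a locally constant
Čech cocycle. -/
structure IsLocalSystem (U : ι → Set X) (c : ι → ι → X → G) : Prop where
  isOpen : ∀ i, IsOpen (U i)
  isCocycle : IsCocycle U c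
  eventually_eq : ∀ i j, ∀ x ∈ U i ∩ U j, ∀ᶠ y in 𝓝 x, c i j y = c i j x

/-- The holonomies of the cocycle `c` around the loops which leave `U i₀` at `x`, return to it at
`y`, and run inside another member of the cover between these points. -/
def holonomies (U : ι → Set X) (c : ι → ι → X → G) (i₀ : ι) : Set G :=
  {g | ∃ j, ∃ x ∈ U i₀ ∩ U j, ∃ y ∈ U i₀ ∩ U j, g = c i₀ j y * (c i₀ j x)⁻¹}

/-- The cocycle `d` is obtained from the cocycle `c` by a homomorphism between the groups of values
and a constant change of frame over each member of the cover. -/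
def IsInducedFrom {H : Type*} [Group H] (U : ι → Set X) (d : ι → ι → X → H) (c : ι → ι → X → G) :
    Prop :=
  ∃ (f : G →* H) (h : ι → H), ∀ i j, ∀ x ∈ U i ∩ U j, d i j x = h i * f (c i j x) * (h j)⁻¹

end Cocycle

section Monodromy

variable {X ι G : Type*} [TopologicalSpace X] [Group G] [TopologicalSpace G] [DiscreteTopology G]
  {U : ι → Set X} {c : ι → ι → X → G}

/-- The principal `G`-bundle with transition functions `c`. -/
noncomputable def IsLocalSystem.bundle (hc : IsLocalSystem U c) (hcov : ∀ x, ∃ i, x ∈ U i) :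
    FiberBundleCore ι X G where
  baseSet := U
  isOpen_baseSet := hc.isOpen
  indexAt x := (hcov x).choose
  mem_baseSet_at x := (hcov x).choose_spec
  coordChange i j x v := c j i x * v
  coordChange_self i x hx v := by rw [hc.isCocycle.self hx, one_mul]
  continuousOn_coordChange i j := by
    rintro ⟨x, v⟩ ⟨hx, -⟩
    have hcont : ContinuousAt (c j i) x :=
      continuousAt_const.congr ((hc.eventually_eq j i x hx.symm).mono fun _ hy => hy.symm)
    exact ((hcont.comp (f := Prod.fst) (x := (x, v)) continuousAt_fst).mul
      continuousAt_snd).continuousWithinAt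
  coordChange_comp i j k x hx v := by
    rw [← mul_assoc, hc.isCocycle k j i x hx.2 hx.1.2 hx.1.1]

variable (hc : IsLocalSystem U c) (hcov : ∀ x, ∃ i, x ∈ U i)

theorem IsLocalSystem.isCoveringMap : IsCoveringMap (hc.bundle hcov).proj :=
  FiberBundle.isCoveringMap

/-- The point of the fibre over `x` with coordinate `v` in the frame over `U i`. -/
noncomputable def IsLocalSystem.point (i : ι) (x : X) (v : G) : (hc.bundle hcov).proj ⁻¹' {x} :=
  ⟨⟨x, c ((hc.bundle hcov).indexAt x) i x * v⟩, rfl⟩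

theorem IsLocalSystem.point_injective (i : ι) (x : X) :
    Function.Injective (hc.point hcov i x) := by
  intro v v' h
  have hval := (Bundle.TotalSpace.mk.injEq _ _ _ _ ▸ congrArg Subtype.val h : x = x ∧ HEq _ _).2
  exact mul_left_cancel (eq_of_heq hval)

theorem IsLocalSystem.point_change {i j : ι} {x : X} (hi : x ∈ U i) (hj : x ∈ U j) (v : G) :
    hc.point hcov i x v = hc.point hcov j x (c j i x * v) := by
  apply Subtype.ext
  change (⟨x, _⟩ : (hc.bundle hcov).TotalSpace) = ⟨x, _⟩
  congr 1
  rw [← mul_assoc, hc.isCocycle _ _ _ x ((hc.bundle hcov).mem_baseSet_at x) hj hi]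

theorem IsLocalSystem.monodromy_point_of_mem {i : ι} {x y : X} {γ : Path x y}
    (hγ : ∀ τ, γ τ ∈ U i) (v : G) :
    (hc.isCoveringMap hcov).monodromy (.mk γ) (hc.point hcov i x v) = hc.point hcov i y v := by
  let lift : Path (hc.point hcov i x v).1 (hc.point hcov i y v).1 :=
    { toFun := fun τ => (hc.point hcov i (γ τ) v).1
      continuous_toFun := ((hc.bundle hcov).localTriv i).continuousOn_invFun.comp_continuous
        (f := fun τ => (γ τ, v)) (by fun_prop) fun τ => ⟨hγ τ, trivial⟩
      source' := by rw [γ.source]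
      target' := by rw [γ.target] }
  refine (hc.isCoveringMap hcov).monodromy_eq_of_map_eq (.mk lift) ?_
  exact congrArg Path.Homotopic.Quotient.mk (Path.ext (funext fun _ => rfl))

/-- In the frames over `U i` and `U j`, the transport along `p` is the left multiplication
by `g`. -/
def IsLocalSystem.IsTransport {x y : X} (p : Path.Homotopic.Quotient x y) (i j : ι) (g : G) :
    Prop :=
  ∀ v, (hc.isCoveringMap hcov).monodromy p (hc.point hcov i x v) = hc.point hcov j y (g * v)

namespace IsLocalSystem.IsTransport

variable {hc hcov} {x y z : X} {i j k : ι} {g g' : G}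

theorem unique {p : Path.Homotopic.Quotient x y} (h : hc.IsTransport hcov p i j g)
    (h' : hc.IsTransport hcov p i j g') : g = g' := by
  simpa using hc.point_injective hcov j y ((h 1).symm.trans (h' 1))

theorem refl : hc.IsTransport hcov (.refl x) i i 1 := fun v => by
  rw [IsCoveringMap.monodromy_refl, id, one_mul]

theorem trans {p : Path.Homotopic.Quotient x y} {q : Path.Homotopic.Quotient y z}
    (hp : hc.IsTransport hcov p i j g) (hq : hc.IsTransport hcov q j k g') :
    hc.IsTransport hcov (p.trans q) i k (g' * g) := fun v => by
  rw [IsCoveringMap.monodromy_trans_apply, hp, hq, mul_assoc]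

theorem of_mem {γ : Path x y} (hγ : ∀ τ, γ τ ∈ U k) (hi : x ∈ U i) (hj : y ∈ U j) :
    hc.IsTransport hcov (.mk γ) i j (c j k y * c k i x) := fun v => by
  have hx : x ∈ U k := by simpa using hγ 0
  have hy : y ∈ U k := by simpa using hγ 1
  rw [hc.point_change hcov hi hx, hc.monodromy_point_of_mem hcov hγ, hc.point_change hcov hy hj,
    mul_assoc]

theorem of_mem_self {γ : Path x y} (hγ : ∀ τ, γ τ ∈ U i) :
    hc.IsTransport hcov (.mk γ) i i 1 := fun v => by
  rw [hc.monodromy_point_of_mem hcov hγ, one_mul]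

end IsLocalSystem.IsTransport

theorem IsLocalSystem.exists_isTransport {x y : X} (p : Path.Homotopic.Quotient x y) :
    ∀ {i j : ι}, x ∈ U i → y ∈ U j → ∃ g, hc.IsTransport hcov p i j g := by
  induction p using pathClass_induction hc.isOpen hcov with
  | short k γ hγ => exact fun hi hj => ⟨_, .of_mem hγ hi hj⟩
  | @trans _ y _ p q ihp ihq =>
    intro i j hi hj
    obtain ⟨k, hk⟩ := hcov y
    obtain ⟨g, hg⟩ := ihp hi hk
    obtain ⟨g', hg'⟩ := ihq hk hj
    exact ⟨_, hg.trans hg'⟩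

/-- The monodromy of the bundle at a point `x₀` of `U i₀`. -/
noncomputable def IsLocalSystem.monodromyHom {i₀ : ι} {x₀ : X} (hx₀ : x₀ ∈ U i₀) :
    FundamentalGroup X x₀ →* G where
  toFun p := (hc.exists_isTransport hcov p hx₀ hx₀).choose
  map_one' := (hc.exists_isTransport hcov _ hx₀ hx₀).choose_spec.unique .refl
  map_mul' p q := (hc.exists_isTransport hcov _ hx₀ hx₀).choose_spec.unique
    ((hc.exists_isTransport hcov q hx₀ hx₀).choose_spec.trans
      (hc.exists_isTransport hcov p hx₀ hx₀).choose_spec)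

theorem IsLocalSystem.isTransport_monodromyHom {i₀ : ι} {x₀ : X} (hx₀ : x₀ ∈ U i₀)
    (p : FundamentalGroup X x₀) : hc.IsTransport hcov p i₀ i₀ (hc.monodromyHom hcov hx₀ p) :=
  (hc.exists_isTransport hcov p hx₀ hx₀).choose_spec

theorem IsLocalSystem.monodromyHom_surjective (hpath : ∀ i, IsPathConnected (U i)) {i₀ : ι}
    {x₀ : X} (hx₀ : x₀ ∈ U i₀) (hgen : Subgroup.closure (holonomies U c i₀) = ⊤) :
    Function.Surjective (hc.monodromyHom hcov hx₀) := by
  rw [← MonoidHom.range_eq_top, ← top_le_iff, ← hgen, Subgroup.closure_le]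
  rintro _ ⟨j, x, hx, y, hy, rfl⟩
  obtain ⟨γ₁, hγ₁⟩ := (hpath i₀).joinedIn x₀ hx₀ x hx.1
  obtain ⟨γ₂, hγ₂⟩ := (hpath j).joinedIn x hx.2 y hy.2
  obtain ⟨γ₃, hγ₃⟩ := (hpath i₀).joinedIn y hy.1 x₀ hx₀
  have hloop := ((IsTransport.of_mem_self (hc := hc) (hcov := hcov) hγ₁).trans
    (.of_mem hγ₂ hx.1 hy.1)).trans (.of_mem_self hγ₃)
  refine ⟨_, (hc.isTransport_monodromyHom hcov hx₀ _).unique hloop |>.trans ?_⟩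
  rw [one_mul, mul_one, hc.isCocycle.inv hx.1 hx.2]

end Monodromy

section Tether

variable {X ι : Type*} [TopologicalSpace X] {U : ι → Set X} {x₀ : X}

/-- For each member of the cover, path classes from the base point to all points, compatible with
the paths inside that member. -/
def IsTether (U : ι → Set X) (q : ι → ∀ x, Path.Homotopic.Quotient x₀ x) : Prop :=
  ∀ i x y (γ : Path x y), (∀ τ, γ τ ∈ U i) → (q i x).trans (.mk γ) = q i y

theorem exists_isTether [PathConnectedSpace X] (hsc : ∀ i, IsSimplyConnected (U i)) (x₀ : X) :
    ∃ q : ι → ∀ x, Path.Homotopic.Quotient x₀ x, IsTether U q := by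
  classical
  have := fun i => (hsc i).simplyConnectedSpace
  choose b hb using fun i => (hsc i).nonempty
  let somePathIn (i : ι) (x : U i) : Path (⟨b i, hb i⟩ : U i) x := PathConnectedSpace.somePath _ _
  refine ⟨fun i x => if h : x ∈ U i then .trans (.mk (PathConnectedSpace.somePath x₀ (b i)))
      (.mk ((somePathIn i ⟨x, h⟩).map continuous_subtype_val))
    else .mk (PathConnectedSpace.somePath x₀ x), fun i x y γ hγ => ?_⟩
  have hx : x ∈ U i := by simpa using hγ 0
  have hy : y ∈ U i := by simpa using hγ 1
  let γ' : Path (⟨x, hx⟩ : U i) ⟨y, hy⟩ :=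
    { toFun := fun τ => ⟨γ τ, hγ τ⟩, source' := by simp, target' := by simp }
  have hγ' : γ = γ'.map continuous_subtype_val := by ext; rfl
  have homotopic := Path.Homotopic.Quotient.eq.2 ((SimplyConnectedSpace.paths_homotopic
    ((somePathIn i ⟨x, hx⟩).trans γ') (somePathIn i ⟨y, hy⟩)).map ⟨_, continuous_subtype_val⟩)
  simp only [dif_pos hx, dif_pos hy]
  rw [← homotopic, hγ']
  simp only [ContinuousMap.coe_mk, Path.map_trans, Path.Homotopic.Quotient.mk_trans]
  grind

/-- The cocycle with values in the fundamental group which compares the tethers of the members of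
the cover. Products in the fundamental group are concatenations in the opposite order. -/
noncomputable def tetherCocycle (q : ι → ∀ x, Path.Homotopic.Quotient x₀ x) (i j : ι) (x : X) :
    FundamentalGroup X x₀ :=
  (q j x).trans (q i x).symm

variable {q : ι → ∀ x, Path.Homotopic.Quotient x₀ x}

theorem IsTether.isFlatCocycle (hq : IsTether U q) : IsFlatCocycle U (tetherCocycle q) where
  isCocycle i j k x _ _ _ := by
    change ((q k x).trans (q j x).symm).trans ((q j x).trans (q i x).symm) =
      (q k x).trans (q i x).symm
    simp only [Path.Homotopic.Quotient.trans_assoc, pathClass_symm_trans_trans]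
  eq_of_joinedIn := by
    rintro i j x y ⟨γ, hγ⟩
    change (q j x).trans (q i x).symm = (q j y).trans (q i y).symm
    rw [← hq i x y γ fun τ => (hγ τ).1, ← hq j x y γ fun τ => (hγ τ).2]
    simp only [Path.Homotopic.Quotient.trans_assoc, pathClass_trans_symm,
      pathClass_trans_symm_trans]

/-- The loop which follows `p` and is closed up by tethers. -/
noncomputable def tetherLoop (q : ι → ∀ x, Path.Homotopic.Quotient x₀ x) (i j : ι) {x y : X}
    (p : Path.Homotopic.Quotient x y) : FundamentalGroup X x₀ :=
  (q i x).trans (p.trans (q j y).symm)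

theorem tetherLoop_trans (i j k : ι) {x y z : X} (p : Path.Homotopic.Quotient x y)
    (p' : Path.Homotopic.Quotient y z) :
    tetherLoop q i k (p.trans p') = tetherLoop q j k p' * tetherLoop q i j p := by
  change _ = ((q i x).trans (p.trans (q j y).symm)).trans ((q j y).trans (p'.trans (q k z).symm))
  simp only [tetherLoop, Path.Homotopic.Quotient.trans_assoc, pathClass_symm_trans_trans]

theorem IsTether.tetherLoop_of_mem (hq : IsTether U q) (i j : ι) {k : ι} {x y : X} {γ : Path x y}
    (hγ : ∀ τ, γ τ ∈ U k) :
    tetherLoop q i j (.mk γ) = tetherCocycle q j k y * tetherCocycle q k i x := by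
  change _ = ((q i x).trans (q k x).symm).trans ((q k y).trans (q j y).symm)
  rw [← hq k x y γ hγ]
  simp only [tetherLoop, Path.Homotopic.Quotient.trans_assoc, pathClass_symm_trans_trans]

theorem eq_one_of_tetherLoop_eq_one {i : ι} {p : FundamentalGroup X x₀}
    (hp : tetherLoop q i i p = 1) : p = 1 := by
  have hconj : p = (q i x₀).symm.trans ((tetherLoop q i i p).trans (q i x₀)) := by
    simp only [tetherLoop, Path.Homotopic.Quotient.trans_assoc, pathClass_symm_trans_trans,
      Path.Homotopic.Quotient.symm_trans, Path.Homotopic.Quotient.trans_refl]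
  rw [hconj, hp, FundamentalGroup.one_def, Path.Homotopic.Quotient.refl_trans,
    Path.Homotopic.Quotient.symm_trans]

variable {G : Type*} [Group G] [TopologicalSpace G] [DiscreteTopology G] {c : ι → ι → X → G}

theorem IsTether.tetherLoop_eq_of_isTransport (hq : IsTether U q) (hc : IsLocalSystem U c)
    (hcov : ∀ x, ∃ i, x ∈ U i) {f : G →* FundamentalGroup X x₀} {h : ι → FundamentalGroup X x₀}
    (hf : ∀ i j, ∀ x ∈ U i ∩ U j, tetherCocycle q i j x = h i * f (c i j x) * (h j)⁻¹)
    {x y : X} (p : Path.Homotopic.Quotient x y) : ∀ {i j : ι} {g : G}, x ∈ U i → y ∈ U j →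
      hc.IsTransport hcov p i j g → tetherLoop q i j p = h j * f g * (h i)⁻¹ := by
  induction p using pathClass_induction hc.isOpen hcov with
  | @short k x y γ hγ =>
    intro i j g hi hj hg
    have hx : x ∈ U k := by simpa using hγ 0
    have hy : y ∈ U k := by simpa using hγ 1
    rw [hg.unique (.of_mem hγ hi hj), hq.tetherLoop_of_mem i j hγ, hf j k y ⟨hj, hy⟩,
      hf k i x ⟨hx, hi⟩, map_mul]
    group
  | @trans _ y _ p p' ihp ihp' =>
    intro i j g hi hj hg
    obtain ⟨k, hk⟩ := hcov y
    obtain ⟨g₁, hg₁⟩ := hc.exists_isTransport hcov p hi hk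
    obtain ⟨g₂, hg₂⟩ := hc.exists_isTransport hcov p' hk hj
    rw [hg.unique (hg₁.trans hg₂), tetherLoop_trans i k j, ihp hi hk hg₁, ihp' hk hj hg₂, map_mul]
    group

theorem IsTether.monodromyHom_injective (hq : IsTether U q) (hc : IsLocalSystem U c)
    (hcov : ∀ x, ∃ i, x ∈ U i) {i₀ : ι} (hx₀ : x₀ ∈ U i₀)
    (hind : IsInducedFrom U (tetherCocycle q) c) :
    Function.Injective (hc.monodromyHom hcov hx₀) := by
  obtain ⟨f, h, hf⟩ := hind
  refine (injective_iff_map_eq_one _).2 fun p hp =>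
    eq_one_of_tetherLoop_eq_one (q := q) (i := i₀) ?_
  rw [hq.tetherLoop_eq_of_isTransport hc hcov hf p hx₀ hx₀
    (hc.isTransport_monodromyHom hcov hx₀ p), hp, map_one, mul_one, mul_inv_cancel]

end Tether

section VanKampen

universe u

theorem nonempty_fundamentalGroup_mulEquiv {X : Type u} {ι G : Type*} [TopologicalSpace X]
    [PathConnectedSpace X] [Group G] {U : ι → Set X} {c : ι → ι → X → G}
    (hc : IsLocalSystem U c) (hcov : ∀ x, ∃ i, x ∈ U i) (hsc : ∀ i, IsSimplyConnected (U i))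
    {i₀ : ι} {x₀ : X} (hx₀ : x₀ ∈ U i₀) (hgen : Subgroup.closure (holonomies U c i₀) = ⊤)
    (huniv : ∀ (H : Type u) [Group H] (d : ι → ι → X → H), IsFlatCocycle U d →
      IsInducedFrom U d c) :
    Nonempty (FundamentalGroup X x₀ ≃* G) := by
  let _ : TopologicalSpace G := ⊥
  have : DiscreteTopology G := ⟨rfl⟩
  obtain ⟨q, hq⟩ := exists_isTether hsc x₀
  exact ⟨MulEquiv.ofBijective (hc.monodromyHom hcov hx₀)
    ⟨hq.monodromyHom_injective hc hcov hx₀ (huniv _ _ hq.isFlatCocycle),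
      hc.monodromyHom_surjective hcov (fun i => (hsc i).isPathConnected) hx₀ hgen⟩⟩

theorem joinedIn_subtype {Y : Type*} [TopologicalSpace Y] {S V : Set Y} {x y : Y}
    (h : JoinedIn V x y) (hV : V ⊆ S) :
    JoinedIn ((↑) ⁻¹' V : Set S) ⟨x, hV h.source_mem⟩ ⟨y, hV h.target_mem⟩ := by
  obtain ⟨γ, hγ⟩ := h
  exact ⟨{ toFun := fun τ => ⟨γ τ, hV (hγ τ)⟩, source' := by simp, target' := by simp }, hγ⟩

variable {Y ι G : Type*} [TopologicalSpace Y] [Group G] {U : ι → Set Y} {c : ι → ι → Y → G}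

theorem isPathConnected_iUnion_of_inter_nonempty (hU : ∀ i, IsPathConnected (U i)) {i₀ : ι}
    (hne : ∀ j, (U i₀ ∩ U j).Nonempty) : IsPathConnected (⋃ i, U i) := by
  obtain ⟨x₀, hx₀, -⟩ := hne i₀
  refine ⟨x₀, mem_iUnion_of_mem i₀ hx₀, fun {y} hy => ?_⟩
  obtain ⟨j, hj⟩ := mem_iUnion.1 hy
  obtain ⟨z, hz, hz'⟩ := hne j
  exact (((hU i₀).joinedIn x₀ hx₀ z hz).mono (subset_iUnion U i₀)).trans
    (((hU j).joinedIn z hz' y hj).mono (subset_iUnion U j))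

theorem IsLocalSystem.restrict (hc : IsLocalSystem U c) (S : Set Y) :
    IsLocalSystem (fun i => ((↑) ⁻¹' U i : Set S)) fun i j y => c i j y where
  isOpen i := (hc.isOpen i).preimage continuous_subtype_val
  isCocycle i j k y := hc.isCocycle i j k y
  eventually_eq i j y hy :=
    continuous_subtype_val.continuousAt.eventually (hc.eventually_eq i j y hy)

open Classical in
theorem IsFlatCocycle.extend {S : Set Y} (hS : ∀ i, U i ⊆ S) {H : Type*} [Group H]
    {d : ι → ι → S → H} (hd : IsFlatCocycle (fun i => ((↑) ⁻¹' U i : Set S)) d) :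
    IsFlatCocycle U fun i j y => if hy : y ∈ S then d i j ⟨y, hy⟩ else 1 where
  isCocycle i j k y hi hj hk := by
    simp only [dif_pos (hS i hi)]
    exact hd.isCocycle i j k ⟨y, hS i hi⟩ hi hj hk
  eq_of_joinedIn i j y z hyz := by
    simp only [dif_pos (hS i hyz.source_mem.1), dif_pos (hS i hyz.target_mem.1)]
    exact hd.eq_of_joinedIn i j _ _ (joinedIn_subtype hyz fun w hw => hS i hw.1)

theorem nonempty_fundamentalGroup_iUnion_mulEquiv {Y : Type u} {ι G : Type*} [TopologicalSpace Y]
    [Group G] {U : ι → Set Y} {c : ι → ι → Y → G} (hc : IsLocalSystem U c)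
    (hsc : ∀ i, IsSimplyConnected (U i)) {i₀ : ι} (hne : ∀ j, (U i₀ ∩ U j).Nonempty)
    (hgen : Subgroup.closure (holonomies U c i₀) = ⊤)
    (huniv : ∀ (H : Type u) [Group H] (d : ι → ι → Y → H), IsFlatCocycle U d →
      IsInducedFrom U d c)
    (x : ↥(⋃ i, U i)) : Nonempty (FundamentalGroup ↥(⋃ i, U i) x ≃* G) := by
  classical
  have hUS : ∀ i, U i ⊆ ⋃ i, U i := subset_iUnion U
  obtain ⟨x₀, hx₀, -⟩ := hne i₀
  have : PathConnectedSpace ↥(⋃ i, U i) := isPathConnected_iff_pathConnectedSpace.1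
    (isPathConnected_iUnion_of_inter_nonempty (fun i => (hsc i).isPathConnected) hne)
  have base : Nonempty (FundamentalGroup ↥(⋃ i, U i) ⟨x₀, hUS i₀ hx₀⟩ ≃* G) := by
    refine nonempty_fundamentalGroup_mulEquiv (hc.restrict _) (fun y => (mem_iUnion (s := U)).1 y.2)
      (fun i => ?_) hx₀ ?_ ?_
    · rw [← IsEmbedding.subtypeVal.isSimplyConnected_image, Subtype.image_preimage_coe,
        inter_eq_right.2 (hUS i)]
      exact hsc i
    · refine top_le_iff.1 (hgen.ge.trans (Subgroup.closure_mono ?_))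
      rintro _ ⟨j, y, hy, z, hz, rfl⟩
      exact ⟨j, ⟨y, hUS i₀ hy.1⟩, hy, ⟨z, hUS i₀ hz.1⟩, hz, rfl⟩
    · intro H _ d hd
      obtain ⟨f, h, hf⟩ := huniv H _ (hd.extend hUS)
      exact ⟨f, h, fun i j y hy => by simpa only [dif_pos y.2] using hf i j y hy⟩
  exact base.map (FundamentalGroup.fundamentalGroupMulEquivOfPathConnected x _).trans

end VanKampen

/-! ### Contractible pieces of the three-sphere -/

section Segments

variable {E : Type*} [AddCommGroup E] [Module ℝ E] [TopologicalSpace E] [ContinuousAdd E]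
  [ContinuousSMul ℝ E]

theorem homotopic_of_segment_subset {Z : Type*} [TopologicalSpace Z] {S : Set E}
    {f g : C(Z, E)} (h : ∀ z, segment ℝ (f z) (g z) ⊆ S) :
    ContinuousMap.Homotopic
      (⟨fun z => ⟨f z, h z (left_mem_segment ℝ _ _)⟩, by fun_prop⟩ : C(Z, S))
      (⟨fun z => ⟨g z, h z (right_mem_segment ℝ _ _)⟩, by fun_prop⟩ : C(Z, S)) := by
  refine ⟨⟨⟨fun q => ⟨(1 - (q.1 : ℝ)) • f q.2 + (q.1 : ℝ) • g q.2, h q.2 ?_⟩, ?_⟩, ?_, ?_⟩⟩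
  · exact ⟨1 - (q.1 : ℝ), q.1, by linarith [q.1.2.2], q.1.2.1, by ring, rfl⟩
  · fun_prop
  · intro z; simp
  · intro z; simp

theorem isSimplyConnected_of_segments {S : Set E} {r : E → E} (hr : Continuous r) {c : E}
    (hc : c ∈ S) (h₁ : ∀ p ∈ S, segment ℝ p (r p) ⊆ S) (h₂ : ∀ p ∈ S, segment ℝ (r p) c ⊆ S) :
    IsSimplyConnected S := by
  have : ContractibleSpace S := by
    rw [contractible_iff_id_nullhomotopic]
    refine ⟨⟨c, hc⟩, ?_⟩
    exact (homotopic_of_segment_subset (f := ⟨Subtype.val, by fun_prop⟩)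
        (g := ⟨fun p => r p, by fun_prop⟩) fun p => h₁ p p.2).trans
      (homotopic_of_segment_subset (f := ⟨fun p : S => r p, by fun_prop⟩)
        (g := ⟨fun _ => c, by fun_prop⟩) fun p => h₂ p p.2)
  exact SimplyConnectedSpace.ofContractible S

end Segments

section Infinity

variable {E : Type*} [NormedAddCommGroup E]

/-- The part of the one-point compactification outside the closed ball of radius `R`. -/
def outside (E : Type*) [NormedAddCommGroup E] (R : ℝ) : Set (OnePoint E) :=
  ((↑) '' {v : E | ‖v‖ ≤ R})ᶜ

@[simp] theorem coe_mem_outside {R : ℝ} {v : E} : (v : OnePoint E) ∈ outside E R ↔ R < ‖v‖ := by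
  simp [outside]

@[simp] theorem infty_mem_outside {R : ℝ} : (OnePoint.infty : OnePoint E) ∈ outside E R := by
  simp [outside]

theorem ne_zero_of_mem_outside {R : ℝ} (hR : 0 ≤ R) {x : OnePoint E} (hx : x ∈ outside E R) :
    x ≠ ((0 : E) : OnePoint E) := by
  rintro rfl
  rw [coe_mem_outside, norm_zero] at hx
  exact hx.not_ge hR

/-- The inverse of the norm, extended by `0` to the point at infinity. Away from the origin, where
it has the junk value `0`, it is continuous and vanishes at infinity only. -/
noncomputable def invNorm (x : OnePoint E) : ℝ := x.elim 0 fun v => ‖v‖⁻¹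

@[simp] theorem invNorm_infty : invNorm (OnePoint.infty : OnePoint E) = 0 := rfl

@[simp] theorem invNorm_coe (v : E) : invNorm (v : OnePoint E) = ‖v‖⁻¹ := rfl

section Proper

variable [ProperSpace E]

theorem mem_nhds_infty_iff_exists_norm {s : Set (OnePoint E)} :
    s ∈ 𝓝 (OnePoint.infty : OnePoint E) ↔
      OnePoint.infty ∈ s ∧ ∃ M : ℝ, ∀ v : E, M < ‖v‖ → (v : OnePoint E) ∈ s := by
  rw [OnePoint.nhds_infty_eq, mem_sup, mem_map, coclosedCompact_eq_cocompact,
    ← Metric.cobounded_eq_cocompact, and_comm, mem_pure, ← comap_norm_atTop, mem_comap]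
  refine and_congr Iff.rfl ⟨?_, ?_⟩
  · rintro ⟨t, ht, hts⟩
    obtain ⟨M, hM⟩ := mem_atTop_sets.1 ht
    exact ⟨M, fun v hv => hts (hM _ hv.le)⟩
  · rintro ⟨M, hM⟩
    exact ⟨Ioi M, Ioi_mem_atTop M, fun v hv => hM v hv⟩

theorem isOpen_outside (R : ℝ) : IsOpen (outside E R) := by
  have hball : IsCompact {v : E | ‖v‖ ≤ R} := by
    simpa [Metric.closedBall, dist_zero_right] using isCompact_closedBall (0 : E) R
  rw [outside, OnePoint.isOpen_compl_image_coe]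
  exact ⟨hball.isClosed, hball⟩

theorem tendsto_nhds_infty_of_invNorm {α : Type*} {l : Filter α} {f : α → OnePoint E}
    (hf : ∀ᶠ a in l, f a ≠ ((0 : E) : OnePoint E))
    (h : Tendsto (fun a => invNorm (f a)) l (𝓝 0)) : Tendsto f l (𝓝 OnePoint.infty) := by
  intro s hs
  obtain ⟨hinfty, M, hM⟩ := mem_nhds_infty_iff_exists_norm.1 hs
  rw [mem_map]
  filter_upwards [hf, h.eventually_lt_const (show (0 : ℝ) < (max M 1)⁻¹ by positivity)]
    with a hne hlt
  rw [mem_preimage]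
  generalize f a = x at hne hlt
  induction x using OnePoint.rec with
  | infty => exact hinfty
  | coe v =>
    have hv : 0 < ‖v‖ := norm_pos_iff.2 fun hv => hne (by rw [hv])
    rw [invNorm_coe, inv_lt_inv₀ hv (by positivity)] at hlt
    exact hM v ((le_max_left M 1).trans_lt hlt)

theorem continuousAt_invNorm {x : OnePoint E} (hx : x ≠ ((0 : E) : OnePoint E)) :
    ContinuousAt invNorm x := by
  induction x using OnePoint.rec with
  | infty =>
    refine OnePoint.continuousAt_infty'.2 ?_
    rw [coclosedCompact_eq_cocompact, ← Metric.cobounded_eq_cocompact]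
    exact tendsto_inv_atTop_zero.comp tendsto_norm_cobounded_atTop
  | coe v =>
    refine OnePoint.continuousAt_coe.2 ?_
    exact continuous_norm.continuousAt.inv₀ (norm_ne_zero_iff.2 fun hv => hx (by rw [hv]))

end Proper

variable [NormedSpace ℝ E]

open Classical in
/-- The radial contraction of the one-point compactification to the point at infinity: at time `τ`
a vector is divided by `1 - τ`. It is well behaved away from the origin. -/
noncomputable def pushOut (τ : ℝ) (x : OnePoint E) : OnePoint E :=
  if τ = 1 then OnePoint.infty else x.map ((1 - τ)⁻¹ • ·)

theorem pushOut_zero (x : OnePoint E) : pushOut 0 x = x := by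
  induction x using OnePoint.rec <;> simp [pushOut]

theorem pushOut_one (x : OnePoint E) : pushOut 1 x = OnePoint.infty := if_pos rfl

theorem pushOut_infty (τ : ℝ) : pushOut τ (OnePoint.infty : OnePoint E) = OnePoint.infty := by
  simp [pushOut]

theorem pushOut_coe {τ : ℝ} (hτ : τ ≠ 1) (v : E) :
    pushOut τ (v : OnePoint E) = (((1 - τ)⁻¹ • v : E) : OnePoint E) := by
  simp [pushOut, hτ]

theorem invNorm_pushOut {τ : ℝ} (hτ : τ ≤ 1) (x : OnePoint E) :
    invNorm (pushOut τ x) = (1 - τ) * invNorm x := by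
  rcases eq_or_ne τ 1 with rfl | hne
  · simp [pushOut_one]
  induction x using OnePoint.rec with
  | infty => simp [pushOut_infty]
  | coe v =>
    rw [pushOut_coe hne, invNorm_coe, invNorm_coe, norm_smul, norm_inv, mul_inv, inv_inv,
      Real.norm_of_nonneg (sub_nonneg.2 hτ)]

theorem pushOut_mem_outside {R τ : ℝ} (hτ : τ ∈ Icc (0 : ℝ) 1) {x : OnePoint E}
    (hx : x ∈ outside E R) : pushOut τ x ∈ outside E R := by
  rcases eq_or_ne τ 1 with rfl | hne
  · simp [pushOut_one]
  induction x using OnePoint.rec with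
  | infty => simp [pushOut_infty]
  | coe v =>
    have hpos : 0 < 1 - τ := sub_pos.2 (hτ.2.lt_of_ne hne)
    have hone : 1 ≤ (1 - τ)⁻¹ := (one_le_inv₀ hpos).2 (by linarith [hτ.1])
    rw [coe_mem_outside] at hx
    rw [pushOut_coe hne, coe_mem_outside, norm_smul, Real.norm_of_nonneg (by positivity)]
    exact hx.trans_le (le_mul_of_one_le_left (norm_nonneg v) hone)

theorem continuousAt_pushOut_coe {τ : ℝ} (hτ : τ ≠ 1) (v : E) :
    ContinuousAt (fun q : ℝ × OnePoint E => pushOut q.1 q.2) (τ, v) := by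
  have hemb : IsOpenEmbedding (Prod.map id (↑) : ℝ × E → ℝ × OnePoint E) :=
    IsOpenEmbedding.id.prodMap OnePoint.isOpenEmbedding_coe
  rw [← show Prod.map id (↑) (τ, v) = (τ, (v : OnePoint E)) from rfl, ← hemb.continuousAt_iff]
  have hcoe : ContinuousAt (fun q : ℝ × E => (((1 - q.1)⁻¹ • q.2 : E) : OnePoint E)) (τ, v) :=
    OnePoint.continuous_coe.continuousAt.comp
      (((continuousAt_const.sub continuousAt_fst).inv₀ (sub_ne_zero.2 hτ.symm)).smul
        continuousAt_snd)
  refine hcoe.congr ?_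
  filter_upwards [(continuousAt_fst (p := (τ, v))).eventually_ne hτ] with q hq
  exact (pushOut_coe hq q.2).symm

variable [ProperSpace E]

theorem continuousOn_pushOut {R : ℝ} (hR : 0 ≤ R) :
    ContinuousOn (fun q : ℝ × OnePoint E => pushOut q.1 q.2) (Icc 0 1 ×ˢ outside E R) := by
  rintro ⟨τ, x⟩ ⟨hτ, hx⟩
  by_cases h : pushOut τ x = OnePoint.infty
  · have hinv : Tendsto (fun q : ℝ × OnePoint E => (1 - q.1) * invNorm q.2) (𝓝 (τ, x)) (𝓝 0) := by
      rw [← invNorm_infty (E := E), ← h, invNorm_pushOut hτ.2]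
      exact (continuousAt_const.sub continuousAt_fst).mul
        ((continuousAt_invNorm (ne_zero_of_mem_outside hR hx)).comp continuousAt_snd)
    rw [ContinuousWithinAt, h]
    refine tendsto_nhds_infty_of_invNorm ?_ ?_
    · filter_upwards [self_mem_nhdsWithin] with q hq
      exact ne_zero_of_mem_outside hR (pushOut_mem_outside hq.1 hq.2)
    · refine (hinv.mono_left nhdsWithin_le_nhds).congr' ?_
      filter_upwards [self_mem_nhdsWithin] with q hq
      exact (invNorm_pushOut hq.1.2 q.2).symm
  · induction x using OnePoint.rec with
    | infty => exact absurd (pushOut_infty τ) h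
    | coe v =>
      have hne : τ ≠ 1 := by rintro rfl; exact h (pushOut_one _)
      exact (continuousAt_pushOut_coe hne v).continuousWithinAt

theorem isSimplyConnected_outside {R : ℝ} (hR : 0 ≤ R) : IsSimplyConnected (outside E R) := by
  have hcont : Continuous fun q : unitInterval × outside E R =>
      pushOut (q.1 : ℝ) (q.2 : OnePoint E) :=
    (continuousOn_pushOut hR).comp_continuous
      (f := fun q : unitInterval × outside E R => ((q.1 : ℝ), (q.2 : OnePoint E)))
      (by fun_prop) fun q => ⟨q.1.2, q.2.2⟩
  have : ContractibleSpace (outside E R) := by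
    rw [contractible_iff_id_nullhomotopic]
    refine ⟨⟨OnePoint.infty, infty_mem_outside⟩, ⟨⟨⟨fun q => ⟨pushOut (q.1 : ℝ) (q.2 : OnePoint E),
      pushOut_mem_outside q.1.2 q.2.2⟩, hcont.subtype_mk _⟩, ?_, ?_⟩⟩⟩
    · exact fun x => Subtype.ext (pushOut_zero _)
    · exact fun x => Subtype.ext (pushOut_one _)
  exact SimplyConnectedSpace.ofContractible _

end Infinity

/-! ### Exteriors and ambient isotopies -/

open scoped ContinuousMap

theorem nonempty_fundamentalGroup_mulEquiv_of_homotopyEquiv {X Y : Type*} {G : Type*}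
    [TopologicalSpace X] [TopologicalSpace Y] [Group G] (e : X ≃ₕ Y)
    (h : ∀ y : Y, Nonempty (FundamentalGroup Y y ≃* G)) (x : X) :
    Nonempty (FundamentalGroup X x ≃* G) := by
  let F := FundamentalGroupoidFunctor.equivOfHomotopyEquiv e
  let x' : FundamentalGroupoid X := ⟨x⟩
  have onEnd : FundamentalGroup X x ≃* CategoryTheory.End (F.functor.obj x') :=
    F.fullyFaithfulFunctor.mulEquivEnd x'
  exact (h (F.functor.obj x').as).map onEnd.trans

theorem AmbientIsotopic.nonempty_homeomorph_compl {X : Type*} [TopologicalSpace X] {A B : Set X}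
    (h : AmbientIsotopic A B) : Nonempty (↥(Bᶜ) ≃ₜ ↥(Aᶜ)) := by
  obtain ⟨H, -, -, hAB⟩ := h
  have himage : H 1 '' Aᶜ = Bᶜ := by rw [image_compl_eq (H 1).bijective, hAB]
  exact ⟨(Homeomorph.setCongr himage.symm).trans ((H 1).image Aᶜ).symm⟩

section RadialFactor

/-- The factor by which `v` is stretched, linearly in the time `τ`, so that at time `1` a nonzero
vector of norm at most one has reached the unit circle; longer vectors stay put. -/
noncomputable def radialFactor (τ : ℝ) (v : ℂ) : ℝ := 1 - τ + τ * max 1 ‖v‖⁻¹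

theorem radialFactor_zero (v : ℂ) : radialFactor 0 v = 1 := by simp [radialFactor]

theorem radialFactor_of_one_le_norm (τ : ℝ) {v : ℂ} (hv : 1 ≤ ‖v‖) : radialFactor τ v = 1 := by
  simp [radialFactor, max_eq_left (inv_le_one_of_one_le₀ hv)]

theorem one_le_radialFactor {τ : ℝ} (hτ : 0 ≤ τ) (v : ℂ) : 1 ≤ radialFactor τ v := by
  have := mul_le_mul_of_nonneg_left (le_max_left 1 ‖v‖⁻¹) hτ
  rw [radialFactor]
  linarith

theorem one_le_norm_radialFactor_one_smul {v : ℂ} (hv : v ≠ 0) : 1 ≤ ‖radialFactor 1 v • v‖ := by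
  have hinv : ‖v‖⁻¹ ≤ radialFactor 1 v := by simp [radialFactor]
  rw [norm_smul, Real.norm_of_nonneg (zero_le_one.trans (one_le_radialFactor zero_le_one v))]
  exact (inv_mul_cancel₀ (norm_ne_zero_iff.2 hv)).ge.trans (by gcongr)

theorem continuousAt_radialFactor {q : ℝ × ℂ} (hq : q.2 ≠ 0) :
    ContinuousAt (fun q : ℝ × ℂ => radialFactor q.1 q.2) q := by
  have hinv : ContinuousAt (fun q : ℝ × ℂ => ‖q.2‖⁻¹) q :=
    continuousAt_snd.norm.inv₀ (norm_ne_zero_iff.2 hq)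
  unfold radialFactor
  fun_prop

end RadialFactor

section Exterior

variable {X : Type*} {φ : Circle × ℂ → X} {K : Set X}

/-- The radial deformation of the complement of the core of a tube into its exterior: in the tube
`v` moves to `radialFactor τ v • v`, and all points outside the tube stay put. -/
noncomputable def radialPush (φ : Circle × ℂ → X) (τ : ℝ) : X → X :=
  Function.extend φ (fun p => φ (p.1, radialFactor τ p.2 • p.2)) id

theorem apply_mem_exterior_iff (hφ : Function.Injective φ) {p : Circle × ℂ} :
    φ p ∈ exterior φ ↔ 1 ≤ ‖p.2‖ := by
  rw [exterior, mem_compl_iff, hφ.mem_set_image, mem_ofPred_eq, not_lt]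

theorem radialPush_apply (hφ : Function.Injective φ) (τ : ℝ) (p : Circle × ℂ) :
    radialPush φ τ (φ p) = φ (p.1, radialFactor τ p.2 • p.2) :=
  hφ.extend_apply _ _ _

theorem radialPush_of_notMem_range (τ : ℝ) {x : X} (hx : x ∉ range φ) : radialPush φ τ x = x :=
  Function.extend_apply' _ _ _ hx

theorem radialPush_of_mem_exterior (hφ : Function.Injective φ) (τ : ℝ) {x : X}
    (hx : x ∈ exterior φ) : radialPush φ τ x = x := by
  by_cases hr : x ∈ range φ
  · obtain ⟨p, rfl⟩ := hr
    rw [radialPush_apply hφ,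
      radialFactor_of_one_le_norm τ ((apply_mem_exterior_iff hφ).1 hx), one_smul]
  · exact radialPush_of_notMem_range τ hr

theorem radialPush_zero (hφ : Function.Injective φ) (x : X) : radialPush φ 0 x = x := by
  by_cases hr : x ∈ range φ
  · obtain ⟨p, rfl⟩ := hr
    rw [radialPush_apply hφ, radialFactor_zero, one_smul]
  · exact radialPush_of_notMem_range 0 hr

namespace IsTubularNeighbourhood

variable [TopologicalSpace X]

theorem apply_mem_iff (hφ : IsTubularNeighbourhood φ K) {p : Circle × ℂ} :
    φ p ∈ K ↔ p.2 = 0 := by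
  rw [← hφ.2]
  exact hφ.1.injective.mem_set_image

theorem exterior_subset_compl (hφ : IsTubularNeighbourhood φ K) : exterior φ ⊆ Kᶜ := by
  intro x hx hxK
  rw [← hφ.2] at hxK
  obtain ⟨p, hp : p.2 = 0, rfl⟩ := hxK
  rw [apply_mem_exterior_iff hφ.1.injective, hp, norm_zero] at hx
  exact hx.not_gt one_pos

theorem radialPush_mem_compl (hφ : IsTubularNeighbourhood φ K) {τ : ℝ} (hτ : 0 ≤ τ) {x : X}
    (hx : x ∈ Kᶜ) : radialPush φ τ x ∈ Kᶜ := by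
  by_cases hr : x ∈ range φ
  · obtain ⟨p, rfl⟩ := hr
    rw [mem_compl_iff, hφ.apply_mem_iff] at hx
    rw [radialPush_apply hφ.1.injective, mem_compl_iff, hφ.apply_mem_iff]
    exact smul_ne_zero (zero_lt_one.trans_le (one_le_radialFactor hτ _)).ne' hx
  · rwa [radialPush_of_notMem_range τ hr]

theorem radialPush_one_mem_exterior (hφ : IsTubularNeighbourhood φ K) {x : X} (hx : x ∈ Kᶜ) :
    radialPush φ 1 x ∈ exterior φ := by
  by_cases hr : x ∈ range φ
  · obtain ⟨p, rfl⟩ := hr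
    rw [mem_compl_iff, hφ.apply_mem_iff] at hx
    rw [radialPush_apply hφ.1.injective, apply_mem_exterior_iff hφ.1.injective]
    exact one_le_norm_radialFactor_one_smul hx
  · rw [radialPush_of_notMem_range 1 hr]
    rintro ⟨p, -, rfl⟩
    exact hr (mem_range_self p)

theorem isClosed_closedTube [T2Space X] (hφ : IsTubularNeighbourhood φ K) :
    IsClosed (φ '' {p | ‖p.2‖ ≤ 1}) := by
  have hprod : {p : Circle × ℂ | ‖p.2‖ ≤ 1} = univ ×ˢ Metric.closedBall 0 1 := by
    ext p; simp
  rw [hprod]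
  exact ((isCompact_univ.prod (isCompact_closedBall _ _)).image hφ.1.continuous).isClosed

theorem continuousAt_radialPush [T2Space X] (hφ : IsTubularNeighbourhood φ K) {q : ℝ × X}
    (hq : q.2 ∈ Kᶜ) : ContinuousAt (fun q : ℝ × X => radialPush φ q.1 q.2) q := by
  obtain ⟨τ, x⟩ := q
  by_cases hr : x ∈ range φ
  · obtain ⟨p, rfl⟩ := hr
    have hp : p.2 ≠ 0 := fun h0 => hq (hφ.apply_mem_iff.2 h0)
    rw [← show Prod.map id φ (τ, p) = (τ, φ p) from rfl,
      ← (IsOpenEmbedding.id.prodMap hφ.1).continuousAt_iff]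
    have hfactor : ContinuousAt (fun q : ℝ × Circle × ℂ => radialFactor q.1 q.2.2) (τ, p) :=
      ContinuousAt.comp (g := fun q : ℝ × ℂ => radialFactor q.1 q.2)
        (f := fun q : ℝ × Circle × ℂ => (q.1, q.2.2)) (continuousAt_radialFactor hp) (by fun_prop)
    have hmove : ContinuousAt
        (fun q : ℝ × Circle × ℂ => φ (q.2.1, radialFactor q.1 q.2.2 • q.2.2)) (τ, p) :=
      hφ.1.continuous.continuousAt.comp (by fun_prop)
    exact hmove.congr (Eventually.of_forall fun q => (radialPush_apply hφ.1.injective _ _).symm)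
  · have hfar : ∀ᶠ q : ℝ × X in 𝓝 (τ, x), q.2 ∉ φ '' {p | ‖p.2‖ ≤ 1} :=
      continuousAt_snd.eventually (hφ.isClosed_closedTube.isOpen_compl.mem_nhds
        fun ⟨p, _, hp⟩ => hr ⟨p, hp⟩)
    refine continuousAt_snd.congr (hfar.mono fun q hq => ?_)
    refine (radialPush_of_mem_exterior hφ.1.injective _ fun hx => hq ?_).symm
    obtain ⟨p, hp, hpq⟩ := hx
    exact ⟨p, le_of_lt (show ‖p.2‖ < 1 from hp), hpq⟩

theorem nonempty_homotopyEquiv [T2Space X] (hφ : IsTubularNeighbourhood φ K) :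
    Nonempty (↥(exterior φ) ≃ₕ ↥(Kᶜ)) := by
  have hcont : Continuous fun q : unitInterval × ↥(Kᶜ) => radialPush φ q.1 q.2 :=
    continuous_iff_continuousAt.2 fun q =>
      ContinuousAt.comp (g := fun q : ℝ × X => radialPush φ q.1 q.2)
        (f := fun q : unitInterval × ↥(Kᶜ) => ((q.1 : ℝ), (q.2 : X)))
        (hφ.continuousAt_radialPush q.2.2) (by fun_prop)
  let incl : C(↥(exterior φ), ↥(Kᶜ)) := ⟨fun x => ⟨x, hφ.exterior_subset_compl x.2⟩, by fun_prop⟩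
  let retr : C(↥(Kᶜ), ↥(exterior φ)) :=
    ⟨fun x => ⟨radialPush φ 1 x, hφ.radialPush_one_mem_exterior x.2⟩,
      (hcont.comp (Continuous.prodMk_right 1)).subtype_mk _⟩
  have hretr : retr.comp incl = ContinuousMap.id _ := by
    ext x
    exact radialPush_of_mem_exterior hφ.1.injective 1 x.2
  refine ⟨⟨incl, retr, hretr ▸ .refl _, ContinuousMap.Homotopic.symm ⟨⟨⟨fun q =>
    ⟨radialPush φ q.1 q.2, hφ.radialPush_mem_compl q.1.2.1 q.2.2⟩, hcont.subtype_mk _⟩, ?_, ?_⟩⟩⟩⟩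
  · exact fun x => Subtype.ext (radialPush_zero hφ.1.injective _)
  · exact fun x => rfl

end IsTubularNeighbourhood

end Exterior

theorem nonempty_fundamentalGroup_mulEquiv_of_ambientIsotopic {X : Type*} {G : Type*}
    [TopologicalSpace X] [T2Space X] [Group G] {K₀ K : Set X} (hK : AmbientIsotopic K₀ K)
    (h : ∀ x : ↥(K₀ᶜ), Nonempty (FundamentalGroup ↥(K₀ᶜ) x ≃* G)) :
    (∀ x : ↥(Kᶜ), Nonempty (FundamentalGroup ↥(Kᶜ) x ≃* G)) ∧
      ∀ φ : Circle × ℂ → X, IsTubularNeighbourhood φ K →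
        ∀ x : ↥(exterior φ), Nonempty (FundamentalGroup ↥(exterior φ) x ≃* G) := by
  obtain ⟨e⟩ := hK.nonempty_homeomorph_compl
  have hcompl : ∀ x : ↥(Kᶜ), Nonempty (FundamentalGroup ↥(Kᶜ) x ≃* G) :=
    nonempty_fundamentalGroup_mulEquiv_of_homotopyEquiv e.toHomotopyEquiv h
  refine ⟨hcompl, fun φ hφ => ?_⟩
  obtain ⟨e'⟩ := hφ.nonempty_homotopyEquiv
  exact nonempty_fundamentalGroup_mulEquiv_of_homotopyEquiv e' hcompl

/-! ### Locally constant functions glued across a hypersurface -/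

theorem eq_of_isPreconnected {E α : Type*} [TopologicalSpace E] {S : Set E}
    (hS : IsPreconnected S) {f : E → α} (hf : ∀ p ∈ S, ∀ᶠ q in 𝓝 p, f q = f p) {p q : E}
    (hp : p ∈ S) (hq : q ∈ S) : f p = f q := by
  let _ : TopologicalSpace α := ⊥
  have : DiscreteTopology α := ⟨rfl⟩
  refine hS.constant (f := f) (fun x hx => ContinuousAt.continuousWithinAt ?_) hp hq
  exact (continuousAt_const (y := f x)).congr ((hf x hx).mono fun y hy => hy.symm)

section Glue

variable {E G : Type*} [Group G] {z : E → ℝ} {κ F g : E → G}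

open Classical in
/-- The function `κ` continued from `0 < z` across the hypersurface `z = 0`, where it takes the
values `g`, by undoing the jump `F`. -/
noncomputable def glue (z : E → ℝ) (κ F g : E → G) (p : E) : G :=
  if 0 < z p then κ p else if z p < 0 then κ p * (F p)⁻¹ else g p

theorem glue_of_pos {p : E} (hp : 0 < z p) : glue z κ F g p = κ p := if_pos hp

theorem glue_of_neg {p : E} (hp : z p < 0) : glue z κ F g p = κ p * (F p)⁻¹ := by
  rw [glue, if_neg hp.not_gt, if_pos hp]

theorem glue_of_eq_zero {p : E} (hp : z p = 0) : glue z κ F g p = g p := by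
  simp [glue, hp]

end Glue

section Gluing

variable {E G H : Type*} [TopologicalSpace E] [Group G] [Group H] {z : E → ℝ} {V S Ap Am : Set E}
  {κ F g : E → G}

/-- The situation in which functions are glued across the hypersurface `z = 0`: the part of `V`
covered by the open sets `Ap` and `Am` lies in `Ap` where `0 ≤ z` and in `Am` where `z ≤ 0`. -/
structure IsCut (z : E → ℝ) (V Ap Am : Set E) : Prop where
  isOpen_base : IsOpen V
  isOpen_up : IsOpen Ap
  isOpen_down : IsOpen Am
  continuous : Continuous z
  frequently_pos : ∀ p, z p = 0 → ∃ᶠ q in 𝓝 p, 0 < z q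
  frequently_neg : ∀ p, z p = 0 → ∃ᶠ q in 𝓝 p, z q < 0
  mem_up : ∀ p ∈ V ∩ Am, 0 ≤ z p → p ∈ Ap
  mem_down : ∀ p ∈ V ∩ Ap, z p ≤ 0 → p ∈ Am

/-- Two functions, locally constant on `V ∩ Ap` and on `V ∩ Am`, which differ by the right factor
`F` on the overlap. -/
structure IsCochain (V Ap Am : Set E) (F cp cm : E → G) : Prop where
  eventually_up : ∀ p ∈ V ∩ Ap, ∀ᶠ q in 𝓝 p, cp q = cp p
  eventually_down : ∀ p ∈ V ∩ Am, ∀ᶠ q in 𝓝 p, cm q = cm p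
  mul_eq : ∀ p ∈ V ∩ (Ap ∩ Am), cp p * F p = cm p

/-- A cochain with prescribed values `κ` on the two sides of the hypersurface `z = 0`. -/
structure IsGluing (z : E → ℝ) (V Ap Am : Set E) (κ F cp cm : E → G) : Prop
    extends IsCochain V Ap Am F cp cm where
  up_eq : ∀ p ∈ V ∩ Ap, 0 < z p → cp p = κ p
  down_eq : ∀ p ∈ V ∩ Am, z p < 0 → cm p = κ p

namespace IsCut

theorem eventually_glue_eq_of_eq_zero (hcut : IsCut z V Ap Am)
    (hF : ∀ p ∈ Ap ∩ Am, ∀ᶠ q in 𝓝 p, F q = F p)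
    (hg : ∀ p ∈ V ∩ (Ap ∩ Am), z p = 0 →
      ∀ᶠ q in 𝓝 p, (0 < z q → κ q = g p) ∧ (z q < 0 → κ q = g p * F p))
    {p : E} (hp : p ∈ V ∩ (Ap ∩ Am)) (hz : z p = 0) :
    ∀ᶠ q in 𝓝 p, glue z κ F g q = glue z κ F g p := by
  rw [glue_of_eq_zero hz]
  have hopen : V ∩ (Ap ∩ Am) ∈ 𝓝 p :=
    (hcut.isOpen_base.inter (hcut.isOpen_up.inter hcut.isOpen_down)).mem_nhds hp
  filter_upwards [(hg p hp hz).eventually_nhds, hF p hp.2, hopen] with q hq hFq hqV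
  rcases lt_trichotomy (z q) 0 with hneg | hzero | hpos
  · rw [glue_of_neg hneg, hq.self_of_nhds.2 hneg, hFq, mul_inv_cancel_right]
  · -- at a second point of the hypersurface, both values are read off at a common nearby point
    obtain ⟨y, hy, hyp, hyq⟩ :=
      ((hcut.frequently_pos q hzero).and_eventually (hq.and (hg q hqV hzero))).exists
    rw [glue_of_eq_zero hzero, ← hyq.1 hy, hyp.1 hy]
  · rw [glue_of_pos hpos, hq.self_of_nhds.1 hpos]

theorem isGluing_glue (hcut : IsCut z V Ap Am)
    (hκ : ∀ p ∈ V ∩ (Ap ∪ Am), z p ≠ 0 → ∀ᶠ q in 𝓝 p, κ q = κ p)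
    (hF : ∀ p ∈ Ap ∩ Am, ∀ᶠ q in 𝓝 p, F q = F p)
    (hg : ∀ p ∈ V ∩ (Ap ∩ Am), z p = 0 →
      ∀ᶠ q in 𝓝 p, (0 < z q → κ q = g p) ∧ (z q < 0 → κ q = g p * F p)) :
    IsGluing z V Ap Am κ F (glue z κ F g) fun p => glue z κ F g p * F p := by
  refine ⟨⟨fun p hp => ?_, fun p hp => ?_, fun p _ => rfl⟩, fun p _ => glue_of_pos,
    fun p _ hneg => by simp only [glue_of_neg hneg, inv_mul_cancel_right]⟩
  · rcases lt_trichotomy (z p) 0 with hneg | hzero | hpos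
    · filter_upwards [hκ p ⟨hp.1, Or.inl hp.2⟩ hneg.ne, hF p ⟨hp.2, hcut.mem_down p hp hneg.le⟩,
        hcut.continuous.continuousAt.eventually_lt_const hneg] with q hκq hFq hq
      rw [glue_of_neg hneg, glue_of_neg hq, hκq, hFq]
    · exact hcut.eventually_glue_eq_of_eq_zero hF hg
        ⟨hp.1, hp.2, hcut.mem_down p hp hzero.le⟩ hzero
    · filter_upwards [hκ p ⟨hp.1, Or.inl hp.2⟩ hpos.ne',
        hcut.continuous.continuousAt.eventually_const_lt hpos] with q hκq hq
      rw [glue_of_pos hpos, glue_of_pos hq, hκq]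
  · rcases lt_trichotomy (z p) 0 with hneg | hzero | hpos
    · filter_upwards [hκ p ⟨hp.1, Or.inr hp.2⟩ hneg.ne,
        hcut.continuous.continuousAt.eventually_lt_const hneg] with q hκq hq
      simp only [glue_of_neg hneg, glue_of_neg hq, hκq, inv_mul_cancel_right]
    · have hup := hcut.mem_up p hp hzero.ge
      filter_upwards [hcut.eventually_glue_eq_of_eq_zero hF hg ⟨hp.1, hup, hp.2⟩ hzero,
        hF p ⟨hup, hp.2⟩] with q hglue hFq
      rw [hglue, hFq]
    · filter_upwards [hκ p ⟨hp.1, Or.inr hp.2⟩ hpos.ne', hF p ⟨hcut.mem_up p hp hpos.le, hp.2⟩,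
        hcut.continuous.continuousAt.eventually_const_lt hpos] with q hκq hFq hq
      rw [glue_of_pos hpos, glue_of_pos hq, hκq, hFq]

theorem exists_isGluing (hcut : IsCut z V Ap Am)
    (hκ : ∀ p ∈ V ∩ (Ap ∪ Am), z p ≠ 0 → ∀ᶠ q in 𝓝 p, κ q = κ p)
    (hF : ∀ p ∈ Ap ∩ Am, ∀ᶠ q in 𝓝 p, F q = F p)
    (hjump : ∀ p ∈ V ∩ (Ap ∩ Am), z p = 0 →
      ∃ g, ∀ᶠ q in 𝓝 p, (0 < z q → κ q = g) ∧ (z q < 0 → κ q = g * F p)) :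
    ∃ c : E → G, IsGluing z V Ap Am κ F c fun p => c p * F p := by
  have hwall : ∀ p, ∃ g, p ∈ V ∩ (Ap ∩ Am) → z p = 0 →
      ∀ᶠ q in 𝓝 p, (0 < z q → κ q = g) ∧ (z q < 0 → κ q = g * F p) := by
    intro p
    by_cases h : p ∈ V ∩ (Ap ∩ Am) ∧ z p = 0
    · obtain ⟨g, hg⟩ := hjump p h.1 h.2
      exact ⟨g, fun _ _ => hg⟩
    · exact ⟨1, fun hp hz => absurd ⟨hp, hz⟩ h⟩
  choose g hg using hwall
  exact ⟨_, hcut.isGluing_glue hκ hF hg⟩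

end IsCut

theorem IsGluing.eq_of_isGluing {cp cm cp' cm' : E → G} (h : IsGluing z V Ap Am κ F cp cm)
    (h' : IsGluing z V Ap Am κ F cp' cm') (hcut : IsCut z V Ap Am) :
    (∀ p ∈ V ∩ Ap, cp p = cp' p) ∧ ∀ p ∈ V ∩ Am, cm p = cm' p := by
  have up : ∀ p ∈ V ∩ Ap, cp p = cp' p := by
    intro p hp
    rcases lt_trichotomy (z p) 0 with hneg | hzero | hpos
    · have hm := hcut.mem_down p hp hneg.le
      refine mul_right_cancel (b := F p) ?_
      rw [h.mul_eq p ⟨hp.1, hp.2, hm⟩, h'.mul_eq p ⟨hp.1, hp.2, hm⟩, h.down_eq p ⟨hp.1, hm⟩ hneg,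
        h'.down_eq p ⟨hp.1, hm⟩ hneg]
    · obtain ⟨q, hqpos, hq, hq', hqV⟩ := ((hcut.frequently_pos p hzero).and_eventually
        ((h.eventually_up p hp).and ((h'.eventually_up p hp).and
          ((hcut.isOpen_base.inter hcut.isOpen_up).mem_nhds hp)))).exists
      rw [← hq, ← hq', h.up_eq q hqV hqpos, h'.up_eq q hqV hqpos]
    · rw [h.up_eq p hp hpos, h'.up_eq p hp hpos]
  refine ⟨up, fun p hp => ?_⟩
  rcases lt_or_ge (z p) 0 with hneg | hnonneg
  · rw [h.down_eq p hp hneg, h'.down_eq p hp hneg]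
  · have hup := hcut.mem_up p hp hnonneg
    rw [← h.mul_eq p ⟨hp.1, hup, hp.2⟩, ← h'.mul_eq p ⟨hp.1, hup, hp.2⟩, up p ⟨hp.1, hup⟩]

theorem IsGluing.mul_eq_of_eventually {cp cm : E → G} (h : IsGluing z V Ap Am κ F cp cm)
    (hcut : IsCut z V Ap Am) {p : E} (hp : p ∈ V ∩ (Ap ∩ Am)) (hz : z p = 0) {g g' : G}
    (hκ : ∀ᶠ q in 𝓝 p, (0 < z q → κ q = g) ∧ (z q < 0 → κ q = g')) : g * F p = g' := by
  have hup : cp p = g := by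
    obtain ⟨q, hqpos, hq, hqV, hκq⟩ := ((hcut.frequently_pos p hz).and_eventually
      ((h.eventually_up p ⟨hp.1, hp.2.1⟩).and
        (((hcut.isOpen_base.inter hcut.isOpen_up).eventually_mem ⟨hp.1, hp.2.1⟩).and hκ))).exists
    rw [← hq, h.up_eq q hqV hqpos, hκq.1 hqpos]
  have hdown : cm p = g' := by
    obtain ⟨q, hqneg, hq, hqV, hκq⟩ := ((hcut.frequently_neg p hz).and_eventually
      ((h.eventually_down p ⟨hp.1, hp.2.2⟩).and
        (((hcut.isOpen_base.inter hcut.isOpen_down).eventually_mem ⟨hp.1, hp.2.2⟩).and hκ))).exists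
    rw [← hq, h.down_eq q hqV hqneg, hκq.2 hqneg]
  rw [← hup, ← hdown, h.mul_eq p hp]

theorem IsGluing.map {cp cm : E → G} {κ' F' : E → H} (h : IsGluing z V Ap Am κ F cp cm)
    (f : G →* H) (x : H) (hκ : ∀ p, κ' p = x * f (κ p)) (hF : ∀ p ∈ Ap ∩ Am, F' p = f (F p)) :
    IsGluing z V Ap Am κ' F' (fun p => x * f (cp p)) fun p => x * f (cm p) where
  eventually_up p hp := (h.eventually_up p hp).mono fun q hq => by rw [hq]
  eventually_down p hp := (h.eventually_down p hp).mono fun q hq => by rw [hq]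
  mul_eq p hp := by rw [← h.mul_eq p hp, hF p hp.2, map_mul, mul_assoc]
  up_eq p hp hz := by rw [h.up_eq p hp hz, hκ]
  down_eq p hp hz := by rw [h.down_eq p hp hz, hκ]

theorem IsCochain.mono {W : Set E} {cp cm : E → G} (h : IsCochain V Ap Am F cp cm) (hW : W ⊆ V) :
    IsCochain W Ap Am F cp cm where
  eventually_up p hp := h.eventually_up p ⟨hW hp.1, hp.2⟩
  eventually_down p hp := h.eventually_down p ⟨hW hp.1, hp.2⟩
  mul_eq p hp := h.mul_eq p ⟨hW hp.1, hp.2⟩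

theorem IsCochain.exists_eq_mul (hcut : IsCut z V Ap Am) {cp cm dp dm : E → G}
    (hc : IsCochain V Ap Am F cp cm) (hd : IsCochain V Ap Am F dp dm)
    (hS : IsPreconnected S) (hne : S.Nonempty) (hSV : S ⊆ V ∩ (Ap ∪ Am)) :
    ∃ x, (∀ p ∈ S ∩ Ap, dp p = x * cp p) ∧ ∀ p ∈ S ∩ Am, dm p = x * cm p := by
  classical
  let ratio : E → G := fun p => if p ∈ Ap then dp p * (cp p)⁻¹ else dm p * (cm p)⁻¹
  have ratio_up : ∀ p ∈ Ap, ratio p = dp p * (cp p)⁻¹ := fun p hp => if_pos hp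
  have ratio_down : ∀ p ∈ V ∩ Am, ratio p = dm p * (cm p)⁻¹ := by
    intro p hp
    by_cases hup : p ∈ Ap
    · rw [ratio_up p hup, ← hc.mul_eq p ⟨hp.1, hup, hp.2⟩, ← hd.mul_eq p ⟨hp.1, hup, hp.2⟩]
      group
    · exact if_neg hup
  have hratio : ∀ p ∈ S, ∀ᶠ q in 𝓝 p, ratio q = ratio p := by
    intro p hp
    obtain ⟨hpV, hup | hdown⟩ := hSV hp
    · filter_upwards [hc.eventually_up p ⟨hpV, hup⟩, hd.eventually_up p ⟨hpV, hup⟩,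
        hcut.isOpen_up.mem_nhds hup] with q hcq hdq hq
      rw [ratio_up p hup, ratio_up q hq, hcq, hdq]
    · filter_upwards [hc.eventually_down p ⟨hpV, hdown⟩, hd.eventually_down p ⟨hpV, hdown⟩,
        (hcut.isOpen_base.inter hcut.isOpen_down).mem_nhds ⟨hpV, hdown⟩] with q hcq hdq hq
      rw [ratio_down p ⟨hpV, hdown⟩, ratio_down q hq, hcq, hdq]
  obtain ⟨p₀, hp₀⟩ := hne
  refine ⟨ratio p₀, fun p hp => ?_, fun p hp => ?_⟩
  · rw [eq_of_isPreconnected hS hratio hp₀ hp.1, ratio_up p hp.2, inv_mul_cancel_right]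
  · rw [eq_of_isPreconnected hS hratio hp₀ hp.1, ratio_down p ⟨(hSV hp.1).1, hp.2⟩,
      inv_mul_cancel_right]

end Gluing

/-! ### The model twist region -/

open Real

/-- Euclidean three-space. -/
abbrev R3 : Type := ℝ × ℝ × ℝ

/-- The angle by which two strands making `a` half turns over `-1 ≤ u ≤ 1` have turned at `u`. -/
noncomputable def twistAngle (a : ℤ) (u : ℝ) : ℝ := a * π * max 0 (min 1 ((u + 1) / 2))

/-- The cross-sectional coordinate `y + iz`, turned back by the twist angle. -/
noncomputable def untwist (a : ℤ) (p : R3) : ℂ :=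
  (p.2.1 + p.2.2 * Complex.I) * Complex.exp (-twistAngle a p.1 * Complex.I)

/-- The closed cylinder whose boundary carries the two strands. -/
def twistCore : Set R3 := {p | |p.1| ≤ 1 ∧ p.2.1 ^ 2 + p.2.2 ^ 2 ≤ 1}

/-- The two strands in the model twist region. -/
def strands (a : ℤ) : Set R3 :=
  {p | |p.1| ≤ 1 ∧ p.2.1 ^ 2 + p.2.2 ^ 2 = 1 ∧ (untwist a p).im = 0}

/-- A fat cylinder from which the part of the ruled surface through the two strands outside the
cylinder of radius one is removed. -/
def twistBox (a : ℤ) : Set R3 :=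
  {p | |p.1| < 2 ∧ p.2.1 ^ 2 + p.2.2 ^ 2 < 4 ∧
    (1 ≤ p.2.1 ^ 2 + p.2.2 ^ 2 → (untwist a p).im ≠ 0)}

@[fun_prop] theorem continuous_twistAngle (a : ℤ) : Continuous (twistAngle a) := by
  unfold twistAngle; fun_prop

@[fun_prop] theorem continuous_untwist (a : ℤ) : Continuous (untwist a) := by
  unfold untwist; fun_prop

@[fun_prop] theorem continuous_untwist_im (a : ℤ) : Continuous fun p => (untwist a p).im :=
  Complex.continuous_im.comp (continuous_untwist a)

theorem twistAngle_of_le (a : ℤ) {u : ℝ} (hu : u ≤ -1) : twistAngle a u = 0 := by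
  rw [twistAngle, max_eq_left (min_le_of_right_le (by linarith)), mul_zero]

theorem twistAngle_of_ge (a : ℤ) {u : ℝ} (hu : 1 ≤ u) : twistAngle a u = a * π := by
  rw [twistAngle, min_eq_left (by linarith), max_eq_right zero_le_one, mul_one]

theorem twistAngle_of_abs_le (a : ℤ) {u : ℝ} (hu : |u| ≤ 1) :
    twistAngle a u = a * π * ((u + 1) / 2) := by
  rw [abs_le] at hu
  rw [twistAngle, min_eq_right (by linarith), max_eq_right (by linarith)]

theorem untwist_re (a : ℤ) (p : R3) :
    (untwist a p).re = p.2.1 * cos (twistAngle a p.1) + p.2.2 * sin (twistAngle a p.1) := by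
  simp [untwist, Complex.exp_re, Complex.exp_im]

theorem untwist_im (a : ℤ) (p : R3) :
    (untwist a p).im = p.2.2 * cos (twistAngle a p.1) - p.2.1 * sin (twistAngle a p.1) := by
  simp [untwist, Complex.exp_re, Complex.exp_im]
  ring

theorem norm_untwist_sq (a : ℤ) (p : R3) : ‖untwist a p‖ ^ 2 = p.2.1 ^ 2 + p.2.2 ^ 2 := by
  rw [untwist, norm_mul, ← Complex.ofReal_neg, Complex.norm_exp_ofReal_mul_I, mul_one,
    Complex.sq_norm, Complex.normSq_add_mul_I]

theorem untwist_im_of_le (a : ℤ) {p : R3} (hp : p.1 ≤ -1) : (untwist a p).im = p.2.2 := by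
  simp [untwist_im, twistAngle_of_le a hp]

theorem untwist_im_of_ge (a : ℤ) {p : R3} (hp : 1 ≤ p.1) :
    (untwist a p).im = if Even a then p.2.2 else -p.2.2 := by
  rw [untwist_im, twistAngle_of_ge a hp, sin_int_mul_pi, mul_zero, sub_zero, cos_int_mul_pi]
  split_ifs with h
  · rw [h.neg_one_zpow, mul_one]
  · rw [(Int.not_even_iff_odd.1 h).neg_one_zpow, mul_neg_one]

theorem untwist_im_eq_zero_iff (a : ℤ) {p : R3} (hp : 1 ≤ |p.1|) :
    (untwist a p).im = 0 ↔ p.2.2 = 0 := by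
  rcases le_abs.1 hp with h | h
  · rw [untwist_im_of_ge a h]
    split_ifs <;> simp
  · rw [untwist_im_of_le a (by linarith)]

theorem isOpen_twistBox (a : ℤ) : IsOpen (twistBox a) := by
  have hruled : IsClosed ({p : R3 | 1 ≤ p.2.1 ^ 2 + p.2.2 ^ 2} ∩ {p | (untwist a p).im = 0}) :=
    (isClosed_le (by fun_prop) (by fun_prop)).inter (isClosed_eq (by fun_prop) (by fun_prop))
  convert (isOpen_lt (f := fun p : R3 => |p.1|) (g := fun _ => 2) (by fun_prop) (by fun_prop)).inter
    ((isOpen_lt (f := fun p : R3 => p.2.1 ^ 2 + p.2.2 ^ 2) (g := fun _ => 4) (by fun_prop)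
      (by fun_prop)).inter hruled.isOpen_compl) using 1
  ext p
  simp [twistBox]

theorem axis_mem_twistBox (a : ℤ) {u : ℝ} (hu : |u| < 2) : ((u, 0, 0) : R3) ∈ twistBox a :=
  ⟨hu, by norm_num, fun h => absurd h (by norm_num)⟩

theorem smul_mem_twistBox {a : ℤ} {u y z c : ℝ} (hp : ((u, y, z) : R3) ∈ twistBox a)
    (hc : 0 ≤ c) (hc1 : c ≤ 1) : ((u, c * y, c * z) : R3) ∈ twistBox a := by
  obtain ⟨hu, hr, him⟩ := hp
  have hle : (c * y) ^ 2 + (c * z) ^ 2 ≤ y ^ 2 + z ^ 2 := by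
    rw [mul_pow, mul_pow, ← mul_add]
    exact mul_le_of_le_one_left (by positivity) (pow_le_one₀ hc hc1)
  refine ⟨hu, hle.trans_lt hr, fun h => ?_⟩
  have hc0 : c ≠ 0 := by
    rintro rfl
    norm_num at h
  have hscale : (untwist a (u, c * y, c * z)).im = c * (untwist a (u, y, z)).im := by
    simp only [untwist_im]
    ring
  rw [hscale]
  exact mul_ne_zero hc0 (him (h.trans hle))

theorem isSimplyConnected_twistBox (a : ℤ) : IsSimplyConnected (twistBox a) := by
  refine isSimplyConnected_of_segments (r := fun p => (p.1, 0, 0)) (by fun_prop)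
    (c := (0, 0, 0)) (axis_mem_twistBox a (by norm_num)) ?_ ?_
  · rintro ⟨u, y, z⟩ hp _ ⟨α, β, hα, hβ, hαβ, rfl⟩
    simp only [Prod.smul_mk, smul_eq_mul, mul_zero, Prod.mk_add_mk, add_zero, ← add_mul, hαβ,
      one_mul]
    exact smul_mem_twistBox hp hα (by linarith)
  · rintro ⟨u, y, z⟩ ⟨hu, -, -⟩ _ ⟨α, β, hα, hβ, hαβ, rfl⟩
    simp only [Prod.smul_mk, smul_eq_mul, mul_zero, Prod.mk_add_mk, add_zero]
    refine axis_mem_twistBox a ?_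
    rw [abs_mul, abs_of_nonneg hα]
    exact (mul_le_of_le_one_left (abs_nonneg u) (by linarith)).trans_lt hu

theorem abs_lt_one_of_mem_twistBox {a : ℤ} {p : R3} (hp : p ∈ twistBox a) (hu : 1 ≤ |p.1|)
    (hz : p.2.2 = 0) : |p.2.1| < 1 := by
  have him := (untwist_im_eq_zero_iff a hu).2 hz
  have hr : p.2.1 ^ 2 + p.2.2 ^ 2 < 1 := not_le.1 fun h => hp.2.2 h him
  rw [hz, zero_pow two_ne_zero, add_zero] at hr
  exact (sq_lt_one_iff_abs_lt_one _).1 hr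

theorem twistBox_diff_core_cases {a : ℤ} {p : R3} (hp : p ∈ twistBox a) (hc : p ∉ twistCore)
    (hz : p.2.2 = 0) :
    ((untwist a p).im ≠ 0 ∧ |p.1| < 1 ∧ 1 < |p.2.1| ∧ |p.2.1| < 2) ∨
      (p.1 < -1 ∧ -2 < p.1 ∧ |p.2.1| < 1) ∨ (1 < p.1 ∧ p.1 < 2 ∧ |p.2.1| < 1) := by
  have hcore : |p.1| ≤ 1 → 1 < |p.2.1| := by
    intro hu
    by_contra! hy
    refine hc ⟨hu, ?_⟩
    rw [hz, ← sq_abs]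
    nlinarith [abs_nonneg p.2.1]
  rcases lt_or_ge |p.1| 1 with hu | hu
  · have hy := hcore hu.le
    refine Or.inl ⟨hp.2.2 ?_, hu, hy, ?_⟩
    · rw [hz, ← sq_abs]
      nlinarith
    · have hr := hp.2.1
      rw [hz, ← sq_abs] at hr
      nlinarith
  · have hy := abs_lt_one_of_mem_twistBox hp hu hz
    have hu' : 1 < |p.1| := not_le.1 fun h => hy.not_gt (hcore h)
    obtain ⟨hlo, hhi⟩ := abs_lt.1 hp.1
    rcases lt_abs.1 hu' with h | h
    · exact Or.inr (Or.inr ⟨h, hhi, hy⟩)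
    · exact Or.inr (Or.inl ⟨by linarith, hlo, hy⟩)

theorem one_lt_abs_of_untwist_im_eq_zero {a : ℤ} {p : R3} (hp : p ∈ twistBox a)
    (hc : p ∉ twistCore) (him : (untwist a p).im = 0) :
    1 < |p.1| ∧ p.2.1 ^ 2 + p.2.2 ^ 2 < 1 := by
  have hr : p.2.1 ^ 2 + p.2.2 ^ 2 < 1 := not_le.1 fun h => hp.2.2 h him
  exact ⟨not_le.1 fun h => hc ⟨h, hr.le⟩, hr⟩

theorem untwist_im_ne_zero {a : ℤ} {p : R3} (hp : p ∈ twistBox a) (hc : p ∉ twistCore)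
    (hz : p.2.2 ≠ 0) : (untwist a p).im ≠ 0 := fun him =>
  hz ((untwist_im_eq_zero_iff a (one_lt_abs_of_untwist_im_eq_zero hp hc him).1.le).1 him)

theorem mem_strands_iff {a : ℤ} {p : R3} :
    p ∈ strands a ↔ ∃ u ∈ Icc (0 : ℝ) 1, ∃ σ : ℝ, (σ = 1 ∨ σ = -1) ∧
      p = (-1 + 2 * u, σ * cos (a * π * u), σ * sin (a * π * u)) := by
  constructor
  · rintro ⟨hu, hr, him⟩
    have hre := norm_untwist_sq a p
    have hone := sin_sq_add_cos_sq (twistAngle a p.1)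
    have hθ := twistAngle_of_abs_le a hu
    rw [Complex.sq_norm, Complex.normSq_apply, him, hr, mul_zero, add_zero] at hre
    rw [abs_le] at hu
    refine ⟨(p.1 + 1) / 2, ⟨by linarith, by linarith⟩, (untwist a p).re,
      mul_self_eq_one_iff.1 hre, ?_⟩
    rw [← hθ, untwist_re]
    rw [untwist_im] at him
    refine Prod.ext (by ring) (Prod.ext ?_ ?_)
    · linear_combination (-p.2.1) * hone - sin (twistAngle a p.1) * him
    · linear_combination (-p.2.2) * hone + cos (twistAngle a p.1) * him
  · rintro ⟨u, ⟨h0, h1⟩, σ, hσ, rfl⟩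
    have hσ2 : σ ^ 2 = 1 := by rcases hσ with rfl | rfl <;> norm_num
    have hu : |-1 + 2 * u| ≤ 1 := abs_le.2 ⟨by linarith, by linarith⟩
    refine ⟨hu, ?_, ?_⟩
    · linear_combination sin_sq_add_cos_sq (a * π * u) +
        (sin (a * π * u) ^ 2 + cos (a * π * u) ^ 2) * hσ2
    · rw [untwist_im, twistAngle_of_abs_le a hu, show (-1 + 2 * u + 1) / 2 = u by ring]
      ring

theorem notMem_twistBox_of_mem_strands {a : ℤ} {p : R3} (hp : p ∈ strands a) :
    p ∉ twistBox a :=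
  fun h => h.2.2 hp.2.1.ge hp.2.2

theorem mem_twistBox_of_mem_twistCore {a : ℤ} {p : R3} (hp : p ∈ twistCore)
    (hs : p ∉ strands a) : p ∈ twistBox a :=
  ⟨by linarith [hp.1], by linarith [hp.2], fun h h0 => hs ⟨hp.1, le_antisymm hp.2 h, h0⟩⟩

/-! ### Winding along the twist region -/

/-- The total angle made by a point of the twist region with the untwisted plane of the strands. -/
noncomputable def windAngle (a : ℤ) (p : R3) : ℝ :=
  Complex.arg (untwist a p) + twistAngle a p.1

/-- The number of half turns made by a point of the twist region. -/
noncomputable def halfTurns (a : ℤ) (p : R3) : ℤ := ⌊windAngle a p / π⌋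

theorem norm_untwist_mul_exp_windAngle (a : ℤ) (p : R3) :
    ‖untwist a p‖ * Complex.exp (windAngle a p * Complex.I) = p.2.1 + p.2.2 * Complex.I := by
  rw [windAngle, Complex.ofReal_add, add_mul, Complex.exp_add, ← mul_assoc,
    Complex.norm_mul_exp_arg_mul_I, untwist, mul_assoc, ← Complex.exp_add, neg_mul,
    neg_add_cancel, Complex.exp_zero, mul_one]

theorem eq_norm_untwist_mul_cos (a : ℤ) (p : R3) :
    p.2.1 = ‖untwist a p‖ * cos (windAngle a p) := by
  simpa [Complex.exp_ofReal_mul_I_re] using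
    (congrArg Complex.re (norm_untwist_mul_exp_windAngle a p)).symm

theorem eq_norm_untwist_mul_sin (a : ℤ) (p : R3) :
    p.2.2 = ‖untwist a p‖ * sin (windAngle a p) := by
  simpa [Complex.exp_ofReal_mul_I_im] using
    (congrArg Complex.im (norm_untwist_mul_exp_windAngle a p)).symm

theorem continuousAt_windAngle {a : ℤ} {p : R3} (hp : (untwist a p).im ≠ 0) :
    ContinuousAt (windAngle a) p :=
  ((Complex.continuousAt_arg (Or.inr hp)).comp (continuous_untwist a).continuousAt).add
    (by fun_prop)

theorem eventually_floor_eq {x : ℝ} (hx : ∀ m : ℤ, x ≠ m) : ∀ᶠ y in 𝓝 x, ⌊y⌋ = ⌊x⌋ := by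
  filter_upwards [Ioo_mem_nhds ((Int.floor_le x).lt_of_ne (hx _).symm)
    (Int.lt_floor_add_one x)] with y hy
  exact Int.floor_eq_iff.2 ⟨hy.1.le, hy.2⟩

theorem eventually_halfTurns_eq {a : ℤ} {p : R3} (hp : (untwist a p).im ≠ 0) (hz : p.2.2 ≠ 0) :
    ∀ᶠ q in 𝓝 p, halfTurns a q = halfTurns a p := by
  refine ((continuousAt_windAngle hp).div_const π).eventually (eventually_floor_eq fun m hm => ?_)
  apply hz
  rw [eq_norm_untwist_mul_sin a, (div_eq_iff pi_ne_zero).1 hm, sin_int_mul_pi, mul_zero]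

theorem neg_one_zpow_floor_mul_sin_nonneg (x : ℝ) : 0 ≤ (-1 : ℝ) ^ ⌊x / π⌋ * sin x := by
  rw [← sin_sub_int_mul_pi]
  have hlo := (le_div_iff₀ pi_pos).1 (Int.floor_le (x / π))
  have hhi := (div_lt_iff₀ pi_pos).1 (Int.lt_floor_add_one (x / π))
  exact sin_nonneg_of_nonneg_of_le_pi (by linarith) (by linarith)

theorem even_halfTurns_of_pos {a : ℤ} {p : R3} (hp : 0 < p.2.2) : Even (halfTurns a p) := by
  by_contra h
  have hsin := neg_one_zpow_floor_mul_sin_nonneg (windAngle a p)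
  rw [← halfTurns, (Int.not_even_iff_odd.1 h).neg_one_zpow, neg_one_mul] at hsin
  rw [eq_norm_untwist_mul_sin a] at hp
  exact hp.not_ge (mul_nonpos_of_nonneg_of_nonpos (norm_nonneg _) (by linarith))

theorem not_even_halfTurns_of_neg {a : ℤ} {p : R3} (hp : p.2.2 < 0) :
    ¬ Even (halfTurns a p) := by
  intro h
  have hsin := neg_one_zpow_floor_mul_sin_nonneg (windAngle a p)
  rw [← halfTurns, h.neg_one_zpow, one_mul] at hsin
  rw [eq_norm_untwist_mul_sin a] at hp
  exact hp.not_ge (mul_nonneg (norm_nonneg _) hsin)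

theorem exists_eventually_halfTurns_eq_or {a : ℤ} {p : R3} (hp : (untwist a p).im ≠ 0)
    (hz : p.2.2 = 0) :
    ∃ m : ℤ, (Even m ↔ 0 < p.2.1) ∧
      ∀ᶠ q in 𝓝 p, halfTurns a q = m ∨ halfTurns a q = m - 1 := by
  have hnorm : 0 < ‖untwist a p‖ := norm_pos_iff.2 fun h => hp (congrArg Complex.im h)
  obtain ⟨m, hm⟩ : ∃ m : ℤ, (m : ℝ) * π = windAngle a p := by
    rw [← sin_eq_zero_iff]
    have hsin := eq_norm_untwist_mul_sin a p
    rw [hz] at hsin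
    exact (mul_eq_zero.1 hsin.symm).resolve_left hnorm.ne'
  refine ⟨m, ?_, ?_⟩
  · rw [eq_norm_untwist_mul_cos a p, ← hm, cos_int_mul_pi, mul_pos_iff_of_pos_left hnorm]
    rcases Int.even_or_odd m with h | h
    · simp [h, h.neg_one_zpow]
    · simp [Int.not_even_iff_odd.2 h, h.neg_one_zpow]
  · have hdiv : windAngle a p / π = m := by rw [← hm, mul_div_cancel_right₀ _ pi_ne_zero]
    have hnear : Ioo ((m : ℝ) - 1) (m + 1) ∈ 𝓝 (windAngle a p / π) := by
      rw [hdiv]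
      exact Ioo_mem_nhds (by linarith) (by linarith)
    filter_upwards [(continuousAt_windAngle hp).div_const π hnear] with q hq
    have hlo : m - 1 ≤ halfTurns a q := Int.le_floor.2 (by push_cast; exact hq.1.le)
    have hhi : halfTurns a q < m + 1 := Int.floor_lt.2 (by push_cast; exact hq.2)
    omega

theorem halfTurns_of_twistAngle {a k : ℤ} {p : R3} (hk : twistAngle a p.1 = k * π)
    (hp : (untwist a p).im ≠ 0) :
    halfTurns a p = if 0 < (untwist a p).im then k else k - 1 := by
  rw [halfTurns, windAngle, hk, add_div, mul_div_cancel_right₀ _ pi_ne_zero, Int.floor_add_intCast,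
    add_comm]
  split_ifs with h
  · have hlo := Complex.arg_nonneg_iff.2 h.le
    have hhi := Complex.arg_lt_pi_iff.2 (Or.inr hp)
    rw [add_eq_left, Int.floor_eq_zero_iff]
    exact ⟨div_nonneg hlo pi_pos.le, (div_lt_one pi_pos).2 hhi⟩
  · have hlo := Complex.neg_pi_lt_arg (untwist a p)
    have hhi := Complex.arg_neg_iff.2 ((not_lt.1 h).lt_of_ne hp)
    have hfloor : ⌊Complex.arg (untwist a p) / π⌋ = -1 := by
      rw [Int.floor_eq_iff, le_div_iff₀ pi_pos, div_lt_iff₀ pi_pos]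
      push_cast
      constructor <;> linarith
    rw [hfloor, sub_eq_add_neg]

/-! ### The local system on a twist region -/

section Values

variable {G H : Type*} [Group G] [Group H]

/-- The value after `m` half turns around the core, if the two sides of the core have face
values `P` and `N`: every half turn crosses one of the two sides, alternatingly. -/
def turnValue (P N : G) (m : ℤ) : G := (N * P⁻¹) ^ (m / 2) * if Even m then 1 else N

theorem turnValue_zero (P N : G) : turnValue P N 0 = 1 := by
  simp [turnValue]

theorem turnValue_even (P N : G) (k : ℤ) : turnValue P N (2 * k) = (N * P⁻¹) ^ k := by
  rw [turnValue, if_pos (even_two_mul k), mul_one, Int.mul_ediv_cancel_left _ two_ne_zero]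

theorem turnValue_odd (P N : G) (k : ℤ) : turnValue P N (2 * k + 1) = (N * P⁻¹) ^ k * N := by
  rw [turnValue, if_neg (Int.not_even_iff_odd.2 (odd_two_mul_add_one k))]
  congr 2
  omega

theorem turnValue_sub_one_of_even (P N : G) {m : ℤ} (hm : Even m) :
    turnValue P N (m - 1) = turnValue P N m * P := by
  obtain ⟨k, rfl⟩ := even_iff_two_dvd.1 hm
  rw [turnValue_even, show 2 * k - 1 = 2 * (k - 1) + 1 by ring, turnValue_odd, zpow_sub_one]
  group

theorem turnValue_of_odd (P N : G) {m : ℤ} (hm : ¬ Even m) :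
    turnValue P N m = turnValue P N (m - 1) * N := by
  obtain ⟨k, rfl⟩ := Int.not_even_iff_odd.1 hm
  rw [turnValue_odd, show 2 * k + 1 - 1 = 2 * k by ring, turnValue_even]

theorem map_turnValue (f : G →* H) (P N : G) (m : ℤ) :
    f (turnValue P N m) = turnValue (f P) (f N) m := by
  unfold turnValue
  split_ifs <;> simp

/-- The transition value from the twist region to the upper (for positive height) or the
lower (for negative height) half-space; `P`, `N`, `L` are the values of the faces on the two sides
and on the left of the core. -/
noncomputable def boxValue (P N L : G) (a : ℤ) (p : R3) : G :=
  (if 0 < (untwist a p).im then 1 else L * P⁻¹) * turnValue P N (halfTurns a p)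

theorem map_boxValue (f : G →* H) (P N L : G) (a : ℤ) (p : R3) :
    f (boxValue P N L a p) = boxValue (f P) (f N) (f L) a p := by
  unfold boxValue
  rw [map_mul, map_turnValue]
  split_ifs <;> simp

theorem eventually_untwist_im_pos_iff {a : ℤ} {p : R3} (hp : (untwist a p).im ≠ 0) :
    ∀ᶠ q in 𝓝 p, (0 < (untwist a q).im ↔ 0 < (untwist a p).im) := by
  have hcont := (continuous_untwist_im a).continuousAt (x := p)
  rcases lt_or_gt_of_ne hp with h | h
  · filter_upwards [hcont.eventually_lt_const h] with q hq
    exact iff_of_false (not_lt.2 hq.le) (not_lt.2 h.le)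
  · filter_upwards [hcont.eventually_const_lt h] with q hq
    exact iff_of_true hq h

theorem eventually_boxValue_eq (P N L : G) {a : ℤ} {p : R3} (hp : (untwist a p).im ≠ 0)
    (hz : p.2.2 ≠ 0) : ∀ᶠ q in 𝓝 p, boxValue P N L a q = boxValue P N L a p := by
  filter_upwards [eventually_untwist_im_pos_iff hp, eventually_halfTurns_eq hp hz]
    with q hsign hturns
  simp only [boxValue, hsign, hturns]

theorem boxValue_jump_side (P N L : G) {a : ℤ} {p : R3} (hp : (untwist a p).im ≠ 0)
    (hz : p.2.2 = 0) : ∃ g, ∀ᶠ q in 𝓝 p, (0 < q.2.2 → boxValue P N L a q = g) ∧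
      (q.2.2 < 0 → boxValue P N L a q = g * if 0 < p.2.1 then P else N) := by
  obtain ⟨m, hm, hturns⟩ := exists_eventually_halfTurns_eq_or hp hz
  refine ⟨(if 0 < (untwist a p).im then 1 else L * P⁻¹) *
    turnValue P N (if Even m then m else m - 1), ?_⟩
  filter_upwards [eventually_untwist_im_pos_iff hp, hturns] with q hsign hq
  simp only [boxValue, hsign, ← hm]
  refine ⟨fun hpos => ?_, fun hneg => ?_⟩
  · have heven := even_halfTurns_of_pos (a := a) hpos
    rcases hq with hq | hq <;> rw [hq] at heven ⊢
    · rw [if_pos heven]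
    · rw [if_neg (Int.even_sub_one.1 heven)]
  · have hodd := not_even_halfTurns_of_neg (a := a) hneg
    rw [mul_assoc]
    rcases hq with hq | hq <;> rw [hq] at hodd ⊢
    · rw [if_neg hodd, if_neg hodd, turnValue_of_odd P N hodd]
    · have heven : Even m := not_not.1 fun h => hodd (Int.even_sub_one.2 h)
      rw [if_pos heven, if_pos heven, turnValue_sub_one_of_even P N heven]

theorem boxValue_of_twistAngle (P N L : G) {a k : ℤ} {p : R3} (hk : twistAngle a p.1 = k * π)
    (hp : (untwist a p).im ≠ 0) :
    boxValue P N L a p =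
      if 0 < (untwist a p).im then turnValue P N k else L * P⁻¹ * turnValue P N (k - 1) := by
  rw [boxValue, halfTurns_of_twistAngle hk hp]
  split_ifs <;> simp

theorem boxValue_left (P N L : G) {a : ℤ} {p : R3} (hp : p.1 ≤ -1) :
    (0 < p.2.2 → boxValue P N L a p = 1) ∧ (p.2.2 < 0 → boxValue P N L a p = L) := by
  have hangle : twistAngle a p.1 = (0 : ℤ) * π := by simp [twistAngle_of_le a hp]
  have him := untwist_im_of_le a hp
  refine ⟨fun h => ?_, fun h => ?_⟩
  · rw [boxValue_of_twistAngle P N L hangle (him ▸ h.ne'), him, if_pos h, turnValue_zero]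
  · rw [boxValue_of_twistAngle P N L hangle (him ▸ h.ne), him, if_neg h.not_gt,
      turnValue_sub_one_of_even P N Even.zero, turnValue_zero, one_mul, inv_mul_cancel_right]

theorem boxValue_right (P N L : G) {a : ℤ} {p : R3} (hp : 1 ≤ p.1) :
    (0 < p.2.2 → boxValue P N L a p =
      if Even a then turnValue P N a else L * P⁻¹ * turnValue P N (a - 1)) ∧
    (p.2.2 < 0 → boxValue P N L a p =
      if Even a then L * P⁻¹ * turnValue P N (a - 1) else turnValue P N a) := by
  have hvalue := boxValue_of_twistAngle P N L (p := p) (twistAngle_of_ge a hp)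
  rw [untwist_im_of_ge a hp] at hvalue
  by_cases ha : Even a
  · simp only [ha, if_true] at hvalue ⊢
    exact ⟨fun h => by rw [hvalue h.ne', if_pos h], fun h => by rw [hvalue h.ne, if_neg h.not_gt]⟩
  · simp only [ha, if_false] at hvalue ⊢
    exact ⟨fun h => by rw [hvalue (by linarith), if_neg (by linarith)],
      fun h => by rw [hvalue (by linarith), if_pos (by linarith)]⟩

/-- The relation between the values `P`, `N`, `L`, `R` of the faces on the two sides, on the left
and on the right of a twist region with `a` half turns: the jump of `boxValue` at the right end
is `R`. -/
def BoxRelation (P N L R : G) (a : ℤ) : Prop :=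
  if Even a then turnValue P N a * R = L * P⁻¹ * turnValue P N (a - 1)
  else L * P⁻¹ * turnValue P N (a - 1) * R = turnValue P N a

theorem boxRelation_iff {P N L R : G} {a : ℤ} :
    BoxRelation P N L R a ↔
      (if Even a then turnValue P N a else L * P⁻¹ * turnValue P N (a - 1)) * R =
        if Even a then L * P⁻¹ * turnValue P N (a - 1) else turnValue P N a := by
  unfold BoxRelation
  split_ifs <;> rfl

end Values

/-! ### The shell around the core -/

/-- Cylindrical coordinates `((x, radius), angle)` in which the strands are straight. -/
noncomputable def twistPolar (a : ℤ) (q : (ℝ × ℝ) × ℝ) : R3 :=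
  (q.1.1, q.1.2 * cos (q.2 + twistAngle a q.1.1), q.1.2 * sin (q.2 + twistAngle a q.1.1))

@[fun_prop] theorem continuous_twistPolar (a : ℤ) : Continuous (twistPolar a) := by
  unfold twistPolar; fun_prop

theorem twistPolar_sq (a : ℤ) (q : (ℝ × ℝ) × ℝ) :
    (twistPolar a q).2.1 ^ 2 + (twistPolar a q).2.2 ^ 2 = q.1.2 ^ 2 := by
  simp only [twistPolar]
  linear_combination q.1.2 ^ 2 * sin_sq_add_cos_sq (q.2 + twistAngle a q.1.1)

theorem untwist_twistPolar_im (a : ℤ) (q : (ℝ × ℝ) × ℝ) :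
    (untwist a (twistPolar a q)).im = q.1.2 * sin q.2 := by
  have hsub := sin_sub (q.2 + twistAngle a q.1.1) (twistAngle a q.1.1)
  rw [add_sub_cancel_right] at hsub
  rw [untwist_im, hsub]
  simp only [twistPolar]
  ring

theorem twistPolar_untwist (a : ℤ) (p : R3) :
    twistPolar a ((p.1, ‖untwist a p‖), Complex.arg (untwist a p)) = p :=
  Prod.ext rfl (Prod.ext (eq_norm_untwist_mul_cos a p).symm (eq_norm_untwist_mul_sin a p).symm)

/-- The horizontal slit on the right of the core. -/
def slit : Set R3 := {p | p.2.2 = 0 ∧ 1 ≤ p.1}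

/-- The fat cylinder without the core and without the slit on its right. -/
def slitShell (a : ℤ) : Set R3 := (twistBox a \ twistCore) \ slit

/-- The values of the coordinates `(x, radius)` on the part of the shell away from the axis. -/
def shellDomain : Set (ℝ × ℝ) :=
  {q | |q.1| < 2 ∧ 0 < q.2 ∧ q.2 < 2 ∧ (|q.1| ≤ 1 → 1 < q.2)}

/-- The part of the shell on the left of the core and within the unit cylinder. -/
def leftCylinder : Set R3 := {p | p.1 ∈ Ioo (-2 : ℝ) (-1) ∧ p.2.1 ^ 2 + p.2.2 ^ 2 < 1}

theorem isClosed_slit : IsClosed slit :=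
  (isClosed_eq (continuous_snd.comp continuous_snd) continuous_const).inter
    (isClosed_le continuous_const continuous_fst)

theorem isPreconnected_shellDomain : IsPreconnected shellDomain := by
  have hprod : ∀ x₁ x₂ r₁ r₂ : ℝ, IsPreconnected (Ioo x₁ x₂ ×ˢ Ioo r₁ r₂) :=
    fun _ _ _ _ => isPreconnected_Ioo.prod isPreconnected_Ioo
  have hunion : shellDomain =
      Ioo (-2) 2 ×ˢ Ioo 1 2 ∪ Ioo (-2) (-1) ×ˢ Ioo 0 2 ∪ Ioo 1 2 ×ˢ Ioo 0 2 := by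
    ext ⟨u, r⟩
    simp only [shellDomain, mem_union, mem_prod, mem_Ioo, mem_ofPred_eq, abs_lt, abs_le]
    grind
  rw [hunion]
  exact ((hprod _ _ _ _).union (-3 / 2, 3 / 2) (by norm_num) (by norm_num) (hprod _ _ _ _)).union
    (3 / 2, 3 / 2) (by norm_num) (by norm_num) (hprod _ _ _ _)

theorem isPreconnected_leftCylinder : IsPreconnected leftCylinder := by
  have himage : leftCylinder =
      (fun q : ℝ × ℂ => (q.1, q.2.re, q.2.im)) '' (Ioo (-2) (-1) ×ˢ Metric.ball 0 1) := by
    ext ⟨u, y, z⟩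
    simp only [leftCylinder, mem_ofPred_eq, mem_image, mem_prod, mem_ball_zero_iff, Prod.exists,
      Prod.mk.injEq, ← sq_lt_one_iff₀ (norm_nonneg (_ : ℂ)), Complex.sq_norm, Complex.normSq_apply]
    constructor
    · rintro ⟨hu, hr⟩
      exact ⟨u, ⟨y, z⟩, ⟨hu, by simpa only [sq] using hr⟩, rfl, rfl, rfl⟩
    · rintro ⟨_, _, ⟨hu, hr⟩, rfl, rfl, rfl⟩
      exact ⟨hu, by simpa only [sq] using hr⟩
  rw [himage]
  exact (isPreconnected_Ioo.prod (convex_ball _ _).isPreconnected).image _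
    (Continuous.continuousOn (by fun_prop))

theorem isPreconnected_image_twistPolar (a : ℤ) (α β : ℝ) :
    IsPreconnected (twistPolar a '' (shellDomain ×ˢ Ioo α β)) :=
  (isPreconnected_shellDomain.prod isPreconnected_Ioo).image _
    (continuous_twistPolar a).continuousOn

theorem image_twistPolar_subset_slitShell (a : ℤ) {α β : ℝ} (hsin : ∀ φ ∈ Ioo α β, sin φ ≠ 0) :
    twistPolar a '' (shellDomain ×ˢ Ioo α β) ⊆ slitShell a := by
  rintro _ ⟨⟨⟨u, r⟩, φ⟩, ⟨⟨hu, hr0, hr2, hr1⟩, hφ⟩, rfl⟩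
  dsimp only at hu hr0 hr2 hr1 hφ
  have hr := twistPolar_sq a ((u, r), φ)
  have him : (untwist a (twistPolar a ((u, r), φ))).im ≠ 0 := by
    rw [untwist_twistPolar_im]
    exact mul_ne_zero hr0.ne' (hsin φ hφ)
  refine ⟨⟨⟨hu, ?_, fun _ => him⟩, ?_⟩, ?_⟩
  · rw [hr]
    nlinarith
  · rintro ⟨hu1, hr1'⟩
    rw [hr] at hr1'
    nlinarith [hr1 hu1]
  · rintro ⟨hz, hu1⟩
    exact him ((untwist_im_eq_zero_iff a (hu1.trans (le_abs_self _))).2 hz)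

theorem leftCylinder_subset_slitShell (a : ℤ) : leftCylinder ⊆ slitShell a := by
  rintro p ⟨⟨hlo, hhi⟩, hr⟩
  refine ⟨⟨⟨abs_lt.2 ⟨hlo, by linarith⟩, by linarith, fun h => by linarith⟩, ?_⟩, ?_⟩
  · rintro ⟨hu, -⟩
    linarith [(abs_le.1 hu).1]
  · rintro ⟨-, hu⟩
    linarith

theorem slitShell_eq (a : ℤ) :
    slitShell a = twistPolar a '' (shellDomain ×ˢ Ioo 0 π) ∪ leftCylinder ∪
      twistPolar a '' (shellDomain ×ˢ Ioo (-π) 0) := by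
  apply Subset.antisymm
  · rintro p ⟨⟨hp, hc⟩, hslit⟩
    have hnorm := norm_untwist_sq a p
    rcases lt_trichotomy (untwist a p).im 0 with him | him | him
    case inr.inl =>
      obtain ⟨hu, hr⟩ := one_lt_abs_of_untwist_im_eq_zero hp hc him
      rcases lt_abs.1 hu with h | h
      · exact absurd ⟨(untwist_im_eq_zero_iff a hu.le).1 him, h.le⟩ hslit
      · exact Or.inl (Or.inr ⟨⟨(abs_lt.1 hp.1).1, by linarith⟩, hr⟩)
    all_goals
      have hpos : 0 < ‖untwist a p‖ := norm_pos_iff.2 fun h => him.ne (by simp [h])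
      have hdomain : (p.1, ‖untwist a p‖) ∈ shellDomain := by
        refine ⟨hp.1, hpos, by nlinarith [hp.2.1], fun hu => ?_⟩
        have hr : 1 < p.2.1 ^ 2 + p.2.2 ^ 2 := not_le.1 fun h => hc ⟨hu, h⟩
        dsimp only
        nlinarith
    · exact Or.inr ⟨_, ⟨hdomain, Complex.neg_pi_lt_arg _, Complex.arg_neg_iff.2 him⟩,
        twistPolar_untwist a p⟩
    · refine Or.inl (Or.inl ⟨_, ⟨hdomain, ?_, Complex.arg_lt_pi_iff.2 (Or.inr him.ne')⟩,
        twistPolar_untwist a p⟩)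
      exact (Complex.arg_nonneg_iff.2 him.le).lt_of_ne' fun h =>
        him.ne' (Complex.arg_eq_zero_iff.1 h).2
  · exact union_subset (union_subset
      (image_twistPolar_subset_slitShell a fun φ h => (sin_pos_of_mem_Ioo h).ne')
      (leftCylinder_subset_slitShell a))
      (image_twistPolar_subset_slitShell a fun φ h => (sin_neg_of_neg_of_neg_pi_lt h.2 h.1).ne)

theorem isPreconnected_slitShell (a : ℤ) : IsPreconnected (slitShell a) := by
  have hdomain : (-3 / 2, 1 / 2) ∈ shellDomain := by
    norm_num [shellDomain, abs_lt, abs_le]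
  have hleft : ∀ φ : ℝ, twistPolar a ((-3 / 2, 1 / 2), φ) ∈ leftCylinder := by
    intro φ
    refine ⟨by constructor <;> norm_num [twistPolar], ?_⟩
    rw [twistPolar_sq]
    norm_num
  have hup : twistPolar a ((-3 / 2, 1 / 2), π / 2) ∈ twistPolar a '' (shellDomain ×ˢ Ioo 0 π) :=
    mem_image_of_mem _ ⟨hdomain, half_pos pi_pos, half_lt_self pi_pos⟩
  have hdown : twistPolar a ((-3 / 2, 1 / 2), -(π / 2)) ∈
      twistPolar a '' (shellDomain ×ˢ Ioo (-π) 0) :=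
    mem_image_of_mem _ ⟨hdomain, neg_lt_neg (half_lt_self pi_pos), neg_neg_of_pos (half_pos pi_pos)⟩
  rw [slitShell_eq]
  exact ((isPreconnected_image_twistPolar a 0 π).union _ hup (hleft _)
    isPreconnected_leftCylinder).union _ (Or.inr (hleft _)) hdown
    (isPreconnected_image_twistPolar a (-π) 0)

/-! ### Cochains near a twist region -/

theorem tendsto_height (p : R3) : Tendsto (fun τ : ℝ => ((p.1, p.2.1, τ) : R3)) (𝓝 p.2.2) (𝓝 p) :=
  Continuous.tendsto (f := fun τ : ℝ => ((p.1, p.2.1, τ) : R3)) (by fun_prop) p.2.2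

/-- Two open sets, lying above and below, that together cover a fat cylinder except for its core. -/
structure IsBoxFrame (a : ℤ) (Ap Am : Set R3) : Prop where
  isOpen_up : IsOpen Ap
  isOpen_down : IsOpen Am
  up_core : ∀ p ∈ Ap, p ∉ twistCore
  down_core : ∀ p ∈ Am, p ∉ twistCore
  up_mem : ∀ p ∈ twistBox a, p ∉ twistCore → 0 ≤ p.2.2 → p ∈ Ap
  down_mem : ∀ p ∈ twistBox a, p ∉ twistCore → p.2.2 ≤ 0 → p ∈ Am

/-- A locally constant function with values `P`, `N`, `L`, `R` on the four faces that meet at a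
twist region. -/
structure IsFaceFunction {G : Type*} (Ap Am : Set R3) (F : R3 → G) (P N L R : G) : Prop where
  eventually_eq : ∀ p ∈ Ap ∩ Am, ∀ᶠ q in 𝓝 p, F q = F p
  pos : ∀ p : R3, |p.1| < 1 → 1 < p.2.1 → p.2.1 < 2 → p.2.2 = 0 → F p = P
  neg : ∀ p : R3, |p.1| < 1 → p.2.1 < -1 → -2 < p.2.1 → p.2.2 = 0 → F p = N
  left : ∀ p : R3, p.1 < -1 → -2 < p.1 → |p.2.1| < 1 → p.2.2 = 0 → F p = L
  right : ∀ p : R3, 1 < p.1 → p.1 < 2 → |p.2.1| < 1 → p.2.2 = 0 → F p = R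

namespace IsBoxFrame

variable {G : Type*} [Group G] {a : ℤ} {V Ap Am : Set R3} {F : R3 → G} {P N L R : G}

theorem isCut (hA : IsBoxFrame a Ap Am) (hV : IsOpen V) (hVa : V ⊆ twistBox a) :
    IsCut (fun p : R3 => p.2.2) V Ap Am where
  isOpen_base := hV
  isOpen_up := hA.isOpen_up
  isOpen_down := hA.isOpen_down
  continuous := by fun_prop
  frequently_pos p hp :=
    (hp ▸ tendsto_height p).frequently (p := fun q : R3 => 0 < q.2.2) (frequently_gt_nhds 0)
  frequently_neg p hp :=
    (hp ▸ tendsto_height p).frequently (p := fun q : R3 => q.2.2 < 0) (frequently_lt_nhds 0)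
  mem_up p hp hz := hA.up_mem p (hVa hp.1) (hA.down_core p hp.2) hz
  mem_down p hp hz := hA.down_mem p (hVa hp.1) (hA.up_core p hp.2) hz

theorem boxValue_jump (hF : IsFaceFunction Ap Am F P N L R) {p : R3} (hp : p ∈ twistBox a)
    (hc : p ∉ twistCore) (hz : p.2.2 = 0) (hrel : 1 ≤ p.1 → BoxRelation P N L R a) :
    ∃ g, ∀ᶠ q in 𝓝 p, (0 < q.2.2 → boxValue P N L a q = g) ∧
      (q.2.2 < 0 → boxValue P N L a q = g * F p) := by
  rcases twistBox_diff_core_cases hp hc hz with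
    ⟨him, hu, hy, hy2⟩ | ⟨hu, hu2, hy⟩ | ⟨hu, hu2, hy⟩
  · obtain ⟨g, hg⟩ := boxValue_jump_side P N L him hz
    refine ⟨g, ?_⟩
    rcases lt_abs.1 hy with h | h
    · rw [hF.pos p hu h (abs_lt.1 hy2).2 hz]
      rwa [if_pos (by linarith)] at hg
    · rw [hF.neg p hu (by linarith) (abs_lt.1 hy2).1 hz]
      rwa [if_neg (by linarith)] at hg
  · refine ⟨1, ?_⟩
    filter_upwards [continuousAt_fst.eventually_lt_const hu] with q hq
    rw [hF.left p hu hu2 hy hz, one_mul]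
    exact boxValue_left P N L hq.le
  · refine ⟨if Even a then turnValue P N a else L * P⁻¹ * turnValue P N (a - 1), ?_⟩
    filter_upwards [continuousAt_fst.eventually_const_lt hu] with q hq
    rw [hF.right p hu hu2 hy hz, boxRelation_iff.1 (hrel hu.le)]
    exact boxValue_right P N L hq.le

theorem exists_isGluing (hA : IsBoxFrame a Ap Am) (hF : IsFaceFunction Ap Am F P N L R)
    (hV : IsOpen V) (hVa : V ⊆ twistBox a)
    (hrel : ∀ p ∈ V, p.2.2 = 0 → 1 ≤ p.1 → BoxRelation P N L R a) :
    ∃ c, IsGluing (fun p : R3 => p.2.2) V Ap Am (boxValue P N L a) F c fun p => c p * F p := by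
  refine (hA.isCut hV hVa).exists_isGluing (fun p hp hz => ?_) hF.eventually_eq fun p hp hz =>
    boxValue_jump hF (hVa hp.1) (hA.up_core p hp.2.1) hz (hrel p hp.1 hz)
  exact eventually_boxValue_eq P N L
    (untwist_im_ne_zero (hVa hp.1) (hp.2.elim (hA.up_core p) (hA.down_core p)) hz) hz

theorem exists_isGluing_of_isCochain (hA : IsBoxFrame a Ap Am)
    (hF : IsFaceFunction Ap Am F P N L R) {dp dm : R3 → G}
    (hd : IsCochain (twistBox a) Ap Am F dp dm) :
    ∃ x, IsGluing (fun p : R3 => p.2.2) (twistBox a) Ap Am (fun p => x * boxValue P N L a p) F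
      dp dm := by
  -- away from the slit the model values glue without any relation
  have hV : IsOpen (twistBox a \ slit) := (isOpen_twistBox a).sdiff isClosed_slit
  obtain ⟨c, hc⟩ := hA.exists_isGluing hF hV sdiff_subset
    fun p hp hz hu => absurd ⟨hz, hu⟩ hp.2
  have hne : (slitShell a).Nonempty := by
    rw [slitShell_eq]
    exact ⟨(-3 / 2, 0, 0), Or.inl (Or.inr (by norm_num [leftCylinder]))⟩
  have hsub : slitShell a ⊆ (twistBox a \ slit) ∩ (Ap ∪ Am) := fun p hp =>
    ⟨⟨hp.1.1, hp.2⟩, (le_total 0 p.2.2).imp (hA.up_mem p hp.1.1 hp.1.2)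
      (hA.down_mem p hp.1.1 hp.1.2)⟩
  obtain ⟨x, hup, hdown⟩ := hc.exists_eq_mul (hA.isCut hV sdiff_subset) (hd.mono sdiff_subset)
    (isPreconnected_slitShell a) hne hsub
  have hshell : ∀ p ∈ twistBox a, p ∉ twistCore → p.2.2 ≠ 0 → p ∈ slitShell a :=
    fun p hp hcore hz => ⟨⟨hp, hcore⟩, fun h => hz h.1⟩
  refine ⟨x, hd, fun p hp hz => ?_, fun p hp hz => ?_⟩
  · have hS := hshell p hp.1 (hA.up_core p hp.2) hz.ne'
    rw [hup p ⟨hS, hp.2⟩, hc.up_eq p ⟨(hsub hS).1, hp.2⟩ hz]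
  · have hS := hshell p hp.1 (hA.down_core p hp.2) hz.ne
    rw [hdown p ⟨hS, hp.2⟩, hc.down_eq p ⟨(hsub hS).1, hp.2⟩ hz]

theorem boxRelation_of_isGluing (hA : IsBoxFrame a Ap Am) (hF : IsFaceFunction Ap Am F P N L R)
    {x : G} {dp dm : R3 → G}
    (hd : IsGluing (fun p : R3 => p.2.2) (twistBox a) Ap Am (fun p => x * boxValue P N L a p) F
      dp dm) : BoxRelation P N L R a := by
  let p : R3 := (3 / 2, 0, 0)
  have hp : p ∈ twistBox a := axis_mem_twistBox a (by norm_num [abs_lt])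
  have hcore : p ∉ twistCore := fun h => absurd h.1 (by norm_num [p, abs_le])
  have hvalues : ∀ᶠ q : R3 in 𝓝 p, 1 < q.1 :=
    continuousAt_fst.eventually_const_lt (by norm_num [p])
  have hmul := hd.mul_eq_of_eventually (hA.isCut (isOpen_twistBox a) subset_rfl)
    ⟨hp, hA.up_mem p hp hcore le_rfl, hA.down_mem p hp hcore le_rfl⟩ rfl
    (hvalues.mono fun q hq => (boxValue_right P N L (a := a) hq.le).imp
      (fun h hz => congrArg (x * ·) (h hz)) fun h hz => congrArg (x * ·) (h hz))
  rw [hF.right p (by norm_num [p]) (by norm_num [p]) (by norm_num [p]) rfl, mul_assoc] at hmul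
  exact boxRelation_iff.2 (mul_left_cancel hmul)

end IsBoxFrame

/-! ### The pieces of the complement -/

/-- The charts in which the horizontal (`false`) and the vertical (`true`) twist region of the
diagram are standard. -/
def boxChart : Bool → R3 ≃ₜ R3
  | false =>
    { toFun := fun p => (p.1 + 2, p.2.1, p.2.2)
      invFun := fun p => (p.1 - 2, p.2.1, p.2.2)
      left_inv := fun p => by simp
      right_inv := fun p => by simp
      continuous_toFun := by fun_prop
      continuous_invFun := by fun_prop }
  | true =>
    { toFun := fun p => (p.2.1, p.1 - 2, p.2.2)
      invFun := fun p => (p.2.1 + 2, p.1, p.2.2)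
      left_inv := fun p => by simp
      right_inv := fun p => by simp
      continuous_toFun := by fun_prop
      continuous_invFun := by fun_prop }

@[simp] theorem boxChart_false (p : R3) : boxChart false p = (p.1 + 2, p.2.1, p.2.2) := rfl

@[simp] theorem boxChart_true (p : R3) : boxChart true p = (p.2.1, p.1 - 2, p.2.2) := rfl

@[simp] theorem boxChart_symm_false (p : R3) :
    (boxChart false).symm p = (p.1 - 2, p.2.1, p.2.2) := rfl

@[simp] theorem boxChart_symm_true (p : R3) :
    (boxChart true).symm p = (p.2.1 + 2, p.1, p.2.2) := rfl

theorem horizontalTwists_eq (a : ℤ) : horizontalTwists a = boxChart false ⁻¹' strands a := by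
  ext ⟨x, y, z⟩
  simp only [horizontalTwists, mem_ofPred_eq, mem_preimage, boxChart_false, mem_strands_iff,
    Prod.mk.injEq]
  constructor <;> rintro ⟨u, hu, σ, hσ, hx, hyz⟩ <;> exact ⟨u, hu, σ, hσ, by linarith, hyz⟩

theorem verticalTwists_eq (b : ℤ) : verticalTwists b = boxChart true ⁻¹' strands b := by
  ext ⟨x, y, z⟩
  simp only [verticalTwists, mem_ofPred_eq, mem_preimage, boxChart_true, mem_strands_iff,
    Prod.mk.injEq]
  constructor
  · rintro ⟨u, hu, σ, hσ, hx, hy, hz⟩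
    exact ⟨u, hu, σ, hσ, hy, by linarith, hz⟩
  · rintro ⟨u, hu, σ, hσ, hy, hx, hz⟩
    exact ⟨u, hu, σ, hσ, by linarith, hy, hz⟩

/-- The core of a twist region together with everything below it. -/
def coreShadow : Set R3 :=
  {p | |p.1| ≤ 1 ∧ |p.2.1| ≤ 1 ∧ (p.2.2 ≤ 0 ∨ p.2.1 ^ 2 + p.2.2 ^ 2 ≤ 1)}

/-- The points above, on or below the connecting arcs. -/
def arcShadow : Set R3 :=
  {p | ((p.2.1 = 1 ∨ p.2.1 = -1) ∧ p.1 ∈ Icc (-1 : ℝ) 1) ∨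
    ((p.2.1 = 2 ∨ p.2.1 = -2) ∧ p.1 ∈ Icc (-3 : ℝ) 3) ∨
    ((p.1 = 3 ∨ p.1 = -3) ∧ |p.2.1| ∈ Icc (1 : ℝ) 2)}

/-- What the diagram hides from a viewer above it: the points on or below the connecting arcs and
the cores of the twist regions. A slab far below the diagram is added, so that the bounded faces
are bounded in the vertical direction too. -/
def hidden : Set R3 :=
  ({p | |p.1| ≤ 3 ∧ |p.2.1| ≤ 2 ∧ p.2.2 ≤ -2} ∪ (arcShadow ∩ {p | p.2.2 ≤ 0})) ∪
    (boxChart false ⁻¹' coreShadow ∪ boxChart true ⁻¹' coreShadow)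

/-- The reflection in the plane of projection. -/
def reflect : R3 ≃ₜ R3 :=
  (Homeomorph.refl ℝ).prodCongr ((Homeomorph.refl ℝ).prodCongr (Homeomorph.neg ℝ))

@[simp] theorem reflect_apply (p : R3) : reflect p = (p.1, p.2.1, -p.2.2) := rfl

theorem reflect_image (S : Set R3) : reflect '' S = reflect ⁻¹' S :=
  reflect.image_eq_preimage_symm S

/-- The part of the complement of the knot seen from above. -/
def upSet : Set R3 := hiddenᶜ

/-- The part of the complement of the knot seen from below. -/
def downSet : Set R3 := reflect ⁻¹' upSet

theorem isClosed_arcShadow : IsClosed arcShadow := by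
  have h_Icc {f : R3 → ℝ} (hf : Continuous f) (b c : ℝ) : IsClosed {p | f p ∈ Icc b c} :=
    isClosed_Icc.preimage hf
  have h_eq {f : R3 → ℝ} (hf : Continuous f) (b c : ℝ) : IsClosed {p | f p = b ∨ f p = c} :=
    (isClosed_eq hf continuous_const).union (isClosed_eq hf continuous_const)
  exact ((h_eq (by fun_prop) _ _).inter (h_Icc (by fun_prop) _ _)).union
    (((h_eq (by fun_prop) _ _).inter (h_Icc (by fun_prop) _ _)).union
      ((h_eq (by fun_prop) _ _).inter (h_Icc (f := fun p => |p.2.1|) (by fun_prop) _ _)))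

theorem isClosed_coreShadow : IsClosed coreShadow :=
  (isClosed_le (f := fun p : R3 => |p.1|) (by fun_prop) (by fun_prop)).inter
    ((isClosed_le (f := fun p : R3 => |p.2.1|) (by fun_prop) (by fun_prop)).inter
      ((isClosed_le (f := fun p : R3 => p.2.2) (by fun_prop) (by fun_prop)).union
        (isClosed_le (f := fun p : R3 => p.2.1 ^ 2 + p.2.2 ^ 2) (by fun_prop) (by fun_prop))))

theorem isClosed_hidden : IsClosed hidden := by
  have h_slab : IsClosed {p : R3 | |p.1| ≤ 3 ∧ |p.2.1| ≤ 2 ∧ p.2.2 ≤ -2} :=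
    (isClosed_le (f := fun p : R3 => |p.1|) (by fun_prop) (by fun_prop)).inter
      ((isClosed_le (f := fun p : R3 => |p.2.1|) (by fun_prop) (by fun_prop)).inter
        (isClosed_le (f := fun p : R3 => p.2.2) (by fun_prop) (by fun_prop)))
  exact (h_slab.union
    (isClosed_arcShadow.inter (isClosed_le (by fun_prop) (by fun_prop)))).union
      ((isClosed_coreShadow.preimage (boxChart false).continuous).union
        (isClosed_coreShadow.preimage (boxChart true).continuous))

theorem isOpen_upSet : IsOpen upSet := isClosed_hidden.isOpen_compl

theorem isOpen_downSet : IsOpen downSet := isOpen_upSet.preimage reflect.continuous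

theorem mem_hidden_iff {p : R3} : p ∈ hidden ↔
    (|p.1| ≤ 3 ∧ |p.2.1| ≤ 2 ∧ p.2.2 ≤ -2) ∨ (p ∈ arcShadow ∧ p.2.2 ≤ 0) ∨
      (|p.1 + 2| ≤ 1 ∧ |p.2.1| ≤ 1 ∧ (p.2.2 ≤ 0 ∨ p.2.1 ^ 2 + p.2.2 ^ 2 ≤ 1)) ∨
      (|p.2.1| ≤ 1 ∧ |p.1 - 2| ≤ 1 ∧ (p.2.2 ≤ 0 ∨ (p.1 - 2) ^ 2 + p.2.2 ^ 2 ≤ 1)) := by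
  simp only [hidden, coreShadow, mem_union, mem_ofPred_eq, mem_inter_iff, mem_preimage,
    boxChart_false, boxChart_true, or_assoc]

theorem coreShadow_of_le {p : R3} (hp : p ∈ coreShadow) {τ : ℝ} (hτ : τ ≤ p.2.2) :
    ((p.1, p.2.1, τ) : R3) ∈ coreShadow := by
  refine ⟨hp.1, hp.2.1, ?_⟩
  rcases le_or_gt τ 0 with h | h
  · exact Or.inl h
  · rcases hp.2.2 with h' | h'
    · exact Or.inl (hτ.trans h')
    · right
      simp only
      nlinarith

theorem mem_upSet_of_le {p : R3} (hp : p ∈ upSet) {τ : ℝ} (hτ : p.2.2 ≤ τ) :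
    ((p.1, p.2.1, τ) : R3) ∈ upSet := by
  rintro ((h | h) | (h | h))
  · exact hp (Or.inl (Or.inl ⟨h.1, h.2.1, hτ.trans h.2.2⟩))
  · exact hp (Or.inl (Or.inr ⟨h.1, hτ.trans h.2⟩))
  · exact hp (Or.inr (Or.inl (coreShadow_of_le h hτ)))
  · exact hp (Or.inr (Or.inr (coreShadow_of_le h hτ)))

theorem mem_upSet_of_one_lt {p : R3} (hp : 1 < p.2.2) : p ∈ upSet := by
  intro h
  rcases mem_hidden_iff.1 h with h | h | ⟨-, -, h | h⟩ | ⟨-, -, h | h⟩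
  · linarith [h.2.2]
  · linarith [h.2]
  · linarith
  · nlinarith [sq_nonneg p.2.1]
  · linarith
  · nlinarith [sq_nonneg (p.1 - 2)]

theorem isSimplyConnected_upSet : IsSimplyConnected upSet := by
  refine isSimplyConnected_of_segments (r := fun p => (p.1, p.2.1, 10)) (by fun_prop)
    (c := (0, 0, 10)) (mem_upSet_of_one_lt (by norm_num)) ?_ ?_
  · rintro p hp _ ⟨α, β, hα, hβ, hαβ, rfl⟩
    have h_vertical : α • p + β • ((p.1, p.2.1, 10) : R3) =
        (p.1, p.2.1, α * p.2.2 + β * 10) := by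
      ext <;> simp [← add_mul, hαβ]
    rw [h_vertical]
    rcases lt_or_ge 1 (α * p.2.2 + β * 10) with h | h
    · exact mem_upSet_of_one_lt h
    · refine mem_upSet_of_le hp ?_
      obtain rfl : β = 1 - α := by linarith
      rcases le_or_gt p.2.2 10 with h' | h' <;> nlinarith
  · rintro p - _ ⟨α, β, -, -, hαβ, rfl⟩
    refine mem_upSet_of_one_lt ?_
    simp [← add_mul, hαβ]

theorem isSimplyConnected_downSet : IsSimplyConnected downSet := by
  rw [downSet, ← reflect_image]
  exact (reflect.isEmbedding.isSimplyConnected_image).2 isSimplyConnected_upSet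

theorem mem_upSet_union_downSet_iff {p : R3} :
    p ∈ upSet ∪ downSet ↔ ((p.1, p.2.1, |p.2.2|) : R3) ∈ upSet := by
  constructor
  · rintro (h | h)
    · exact mem_upSet_of_le h (le_abs_self _)
    · exact mem_upSet_of_le (p := reflect p) h (neg_le_abs _)
  · intro h
    rcases abs_choice p.2.2 with hz | hz <;> rw [hz] at h
    · exact Or.inl h
    · exact Or.inr h

theorem mem_upSet_inter_downSet_iff {p : R3} :
    p ∈ upSet ∩ downSet ↔ ((p.1, p.2.1, -|p.2.2|) : R3) ∈ upSet := by
  constructor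
  · rintro ⟨hu, hd⟩
    rcases abs_choice p.2.2 with hz | hz <;> rw [hz]
    · exact hd
    · rwa [neg_neg]
  · exact fun h => ⟨mem_upSet_of_le h (neg_abs_le _),
      mem_upSet_of_le h (neg_le_neg (le_abs_self p.2.2))⟩

theorem notMem_upSet_union_downSet_iff {p : R3} :
    p ∉ upSet ∪ downSet ↔ p ∈ connectingArcs ∨ ∃ k, boxChart k p ∈ twistCore := by
  have h_core {x y : ℝ} : (|x| ≤ 1 ∧ |y| ≤ 1 ∧ (|p.2.2| ≤ 0 ∨ y ^ 2 + |p.2.2| ^ 2 ≤ 1)) ↔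
      (x, y, p.2.2) ∈ twistCore := by
    simp only [twistCore, mem_ofPred_eq, sq_abs, ← sq_le_one_iff_abs_le_one y]
    refine and_congr_right fun _ => ⟨?_, fun h => ⟨by nlinarith, Or.inr h⟩⟩
    rintro ⟨hy, hz | h⟩
    · simpa [abs_nonpos_iff.1 hz] using hy
    · exact h
  rw [mem_upSet_union_downSet_iff, upSet, notMem_compl_iff, mem_hidden_iff]
  simp only [h_core, Bool.exists_bool, boxChart_false, boxChart_true]
  refine (or_iff_right fun h => ?_).trans (or_congr_left ⟨?_, ?_⟩)
  · linarith [h.2.2, abs_nonneg p.2.2]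
  · exact fun h => ⟨abs_nonpos_iff.1 h.2, h.1⟩
  · exact fun h => ⟨h.2, (abs_eq_zero.2 h.1).le⟩

/-! ### The faces of the diagram -/

/-- The faces of the diagram: the unbounded one, the two between the outer and the inner connecting
arcs, and the one between the twist regions. -/
inductive Face
  | outer
  | top
  | bottom
  | middle

/-- The points of space above, on or below a face; over a bounded face, only those at height less
than `2`. -/
def faceSet : Face → Set R3
  | .outer => {p | 3 < |p.1| ∨ 2 < |p.2.1|}
  | .top => Ioo (-3) 3 ×ˢ Ioo 1 2 ×ˢ Ioo (-2) 2
  | .bottom => Ioo (-3) 3 ×ˢ Ioo (-2) (-1) ×ˢ Ioo (-2) 2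
  | .middle => Ioo (-1) 1 ×ˢ Ioo (-1) 1 ×ˢ Ioo (-2) 2

theorem isOpen_faceSet (f : Face) : IsOpen (faceSet f) := by
  cases f with
  | outer =>
    exact (isOpen_lt (f := fun _ : R3 => (3 : ℝ)) (by fun_prop) (by fun_prop)).union
      (isOpen_lt (f := fun _ : R3 => (2 : ℝ)) (by fun_prop) (by fun_prop))
  | _ => exact isOpen_Ioo.prod (isOpen_Ioo.prod isOpen_Ioo)

theorem faceSet_subset_upSet_inter_downSet (f : Face) : faceSet f ⊆ upSet ∩ downSet := by
  rintro ⟨x, y, z⟩ hp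
  rw [mem_upSet_inter_downSet_iff]
  intro h
  simp only [mem_hidden_iff, arcShadow, mem_ofPred_eq, mem_Icc, neg_nonpos, abs_nonneg, true_or,
    and_true] at h
  cases f <;> simp only [faceSet, mem_ofPred_eq, mem_prod, mem_Ioo] at hp <;> grind

theorem exists_mem_faceSet {p : R3} (hp : p ∈ upSet ∩ downSet) : ∃ f, p ∈ faceSet f := by
  obtain ⟨x, y, z⟩ := p
  by_cases ho : (x, y, z) ∈ faceSet .outer
  · exact ⟨_, ho⟩
  rw [mem_upSet_inter_downSet_iff] at hp
  simp only [upSet, mem_compl_iff, mem_hidden_iff, arcShadow, faceSet, mem_ofPred_eq, mem_Icc,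
    neg_nonpos, abs_nonneg, true_or, and_true, not_or] at hp ho
  obtain ⟨h_slab, ⟨h_inner, h_horizontal, h_vertical⟩, h_left, h_right⟩ := hp
  have hz : z ∈ Ioo (-2 : ℝ) 2 := by grind
  rcases lt_or_ge |y| 1 with hy | hy
  · exact ⟨.middle, by grind, abs_lt.1 hy, hz⟩
  have hx : x ∈ Ioo (-3 : ℝ) 3 := by grind
  rcases le_total 0 y with hy0 | hy0
  · exact ⟨.top, hx, by grind, hz⟩
  · exact ⟨.bottom, hx, by grind, hz⟩

open Classical in
/-- The face that contains a given point of both the upper and the lower part of the complement.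
All points outside the bounded faces are assigned to the outer one. -/
noncomputable def faceOf (p : R3) : Face :=
  if p ∈ faceSet .top then .top
  else if p ∈ faceSet .bottom then .bottom
  else if p ∈ faceSet .middle then .middle
  else .outer

theorem faceOf_eq {f : Face} {p : R3} (hp : p ∈ faceSet f) : faceOf p = f := by
  cases f <;> simp only [faceOf, faceSet, mem_ofPred_eq, mem_prod, mem_Ioo] at hp ⊢ <;> grind

theorem isPathConnected_box {I J K : Set ℝ} [hI : I.OrdConnected] [hJ : J.OrdConnected]
    [hK : K.OrdConnected] (h : (I ×ˢ J ×ˢ K).Nonempty) : IsPathConnected (I ×ˢ J ×ˢ K) :=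
  (hI.convex.prod (hJ.convex.prod hK.convex)).isPathConnected h

theorem isPathConnected_faceSet (f : Face) : IsPathConnected (faceSet f) := by
  cases f with
  | outer =>
    have h_sides : faceSet .outer = Ioi 3 ×ˢ univ ×ˢ univ ∪ univ ×ˢ Ioi 2 ×ˢ univ ∪
        Iio (-3) ×ˢ univ ×ˢ univ ∪ univ ×ˢ Iio (-2) ×ˢ univ := by
      ext ⟨x, y, z⟩
      simp only [faceSet, mem_ofPred_eq, mem_union, mem_prod, mem_Ioi, mem_Iio, mem_univ]
      grind
    rw [h_sides]
    refine (((isPathConnected_box ⟨(4, 0, 0), ?_⟩).union (isPathConnected_box ⟨(0, 4, 0), ?_⟩)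
      ⟨(4, 4, 0), ?_⟩).union (isPathConnected_box ⟨(-4, 0, 0), ?_⟩) ⟨(-4, 4, 0), ?_⟩).union
        (isPathConnected_box ⟨(0, -4, 0), ?_⟩) ⟨(-4, -4, 0), ?_⟩ <;> norm_num
  | top => exact isPathConnected_box ⟨(0, 3 / 2, 0), by norm_num⟩
  | bottom => exact isPathConnected_box ⟨(0, -(3 / 2), 0), by norm_num⟩
  | middle => exact isPathConnected_box ⟨(0, 0, 0), by norm_num⟩

/-! ### The neighbourhood of infinity -/

/-- The finite points of the neighbourhood of infinity. -/
def farSet : Set R3 := {p | 5 < ‖p‖}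

theorem mem_farSet {p : R3} : p ∈ farSet ↔ 5 < |p.1| ∨ 5 < |p.2.1| ∨ 5 < |p.2.2| := by
  simp [farSet, Prod.norm_def, Real.norm_eq_abs]

theorem isOpen_farSet : IsOpen farSet := isOpen_lt (by fun_prop) (by fun_prop)

theorem faceOf_of_mem_farSet {p : R3} (hp : p ∈ farSet) : faceOf p = .outer := by
  rw [mem_farSet] at hp
  simp only [faceOf, faceSet, mem_prod, mem_Ioo]
  grind

theorem mem_upSet_iff_of_mem_farSet {p : R3} (hp : p ∈ farSet) :
    p ∈ upSet ↔ 5 < p.2.2 ∨ p ∈ faceSet .outer := by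
  refine ⟨fun hu => or_iff_not_imp_left.2 fun hz => ?_, ?_⟩
  · by_contra ho
    rw [mem_farSet] at hp
    simp only [faceSet, mem_ofPred_eq] at ho
    exact hu (mem_hidden_iff.2 (Or.inl (by grind)))
  · rintro (h | h)
    · exact mem_upSet_of_one_lt (by linarith)
    · exact (faceSet_subset_upSet_inter_downSet _ h).1

theorem isPathConnected_upSet_inter_farSet : IsPathConnected (upSet ∩ farSet) := by
  have h_sides : upSet ∩ farSet = univ ×ˢ univ ×ˢ Ioi 5 ∪
      Ioi 5 ×ˢ univ ×ˢ univ ∪ Iio (-5) ×ˢ univ ×ˢ univ ∪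
      univ ×ˢ Ioi 5 ×ˢ univ ∪ univ ×ˢ Iio (-5) ×ˢ univ ∪
      Ioi 3 ×ˢ univ ×ˢ Iio (-5) ∪ Iio (-3) ×ˢ univ ×ˢ Iio (-5) ∪
      univ ×ˢ Ioi 2 ×ˢ Iio (-5) ∪ univ ×ˢ Iio (-2) ×ˢ Iio (-5) := by
    ext ⟨x, y, z⟩
    rw [mem_inter_iff, and_congr_left mem_upSet_iff_of_mem_farSet, mem_farSet]
    simp only [faceSet, mem_ofPred_eq, mem_union, mem_prod, mem_Ioi, mem_Iio, mem_univ, lt_abs,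
      true_and, and_true]
    constructor <;> grind
  rw [h_sides]
  refine ((((((((isPathConnected_box ⟨(0, 0, 6), ?_⟩).union
    (isPathConnected_box ⟨(6, 0, 0), ?_⟩) ⟨(6, 0, 6), ?_⟩).union
    (isPathConnected_box ⟨(-6, 0, 0), ?_⟩) ⟨(-6, 0, 6), ?_⟩).union
    (isPathConnected_box ⟨(0, 6, 0), ?_⟩) ⟨(0, 6, 6), ?_⟩).union
    (isPathConnected_box ⟨(0, -6, 0), ?_⟩) ⟨(0, -6, 6), ?_⟩).union
    (isPathConnected_box ⟨(6, 0, -6), ?_⟩) ⟨(6, 0, -6), ?_⟩).union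
    (isPathConnected_box ⟨(-6, 0, -6), ?_⟩) ⟨(-6, 0, -6), ?_⟩).union
    (isPathConnected_box ⟨(0, 6, -6), ?_⟩) ⟨(0, 6, -6), ?_⟩).union
    (isPathConnected_box ⟨(0, -6, -6), ?_⟩) ⟨(0, -6, -6), ?_⟩ <;> norm_num

theorem isPathConnected_downSet_inter_farSet : IsPathConnected (downSet ∩ farSet) := by
  have h_reflect : downSet ∩ farSet = reflect '' (upSet ∩ farSet) := by
    rw [reflect_image, preimage_inter, downSet]
    congr 1
    ext p
    simp [mem_farSet]
  rw [h_reflect]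
  exact isPathConnected_upSet_inter_farSet.image reflect.continuous

theorem farSet_subset_upSet_union_downSet : farSet ⊆ upSet ∪ downSet := by
  intro p hp
  have hp' : ((p.1, p.2.1, |p.2.2|) : R3) ∈ farSet := by simpa [mem_farSet] using hp
  rw [mem_upSet_union_downSet_iff, mem_upSet_iff_of_mem_farSet hp']
  rw [mem_farSet] at hp
  simp only [faceSet, mem_ofPred_eq]
  grind

/-! ### The twist regions inside the diagram -/

/-- Two disjoint slabs of space that separate the twist regions. -/
def strip : Bool → Set R3
  | false => {p | p.1 ∈ Ioo (-4) 0}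
  | true => {p | p.1 ∈ Ioo 0 4}

theorem eq_of_mem_strip {j k : Bool} {p : R3} (hj : p ∈ strip j) (hk : p ∈ strip k) : j = k := by
  cases j <;> cases k <;> simp only [strip, mem_ofPred_eq, mem_Ioo] at hj hk <;> grind

theorem mem_strip_of_sq_lt {k : Bool} {p : R3} (h : |(boxChart k p).1| < 2)
    (h' : (boxChart k p).2.1 ^ 2 + (boxChart k p).2.2 ^ 2 < 4) :
    p ∈ strip k ∧ |p.2.1| < 2 ∧ |p.2.2| < 2 := by
  have h_abs {y z : ℝ} (h : y ^ 2 + z ^ 2 < 4) : |y| < 2 ∧ |z| < 2 :=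
    ⟨abs_lt_of_sq_lt_sq (by nlinarith) (by norm_num),
      abs_lt_of_sq_lt_sq (by nlinarith) (by norm_num)⟩
  have h_disc := h_abs h'
  cases k <;> simp only [boxChart_false, boxChart_true] at h h_disc <;>
    simp only [strip, mem_ofPred_eq, mem_Ioo] <;> grind

theorem mem_strip_of_mem_twistBox {a : ℤ} {k : Bool} {p : R3} (hp : boxChart k p ∈ twistBox a) :
    p ∈ strip k ∧ |p.2.1| < 2 ∧ |p.2.2| < 2 :=
  mem_strip_of_sq_lt hp.1 hp.2.1

theorem mem_strip_of_mem_twistCore {k : Bool} {p : R3} (hp : boxChart k p ∈ twistCore) :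
    p ∈ strip k :=
  (mem_strip_of_sq_lt (by linarith [hp.1]) (by linarith [hp.2])).1

theorem notMem_farSet_of_mem_twistBox {a : ℤ} {k : Bool} {p : R3}
    (hp : boxChart k p ∈ twistBox a) : p ∉ farSet := by
  obtain ⟨hx, hy, hz⟩ := mem_strip_of_mem_twistBox hp
  rw [mem_farSet]
  cases k <;> simp only [strip, mem_ofPred_eq, mem_Ioo] at hx <;> grind

theorem notMem_connectingArcs_of_mem_twistBox {a : ℤ} {k : Bool} {p : R3}
    (hp : boxChart k p ∈ twistBox a) : p ∉ connectingArcs := by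
  rintro ⟨hz, h⟩
  obtain ⟨hx, hy, -⟩ := mem_strip_of_mem_twistBox hp
  simp only [mem_Icc] at h
  cases k
  · have h_end := abs_lt_one_of_mem_twistBox hp (hz := hz)
    simp only [boxChart_false] at h_end
    grind
  · have h_end := abs_lt_one_of_mem_twistBox hp (hz := hz)
    simp only [boxChart_true] at h_end
    grind

theorem mem_upSet_union_downSet_of_mem_twistBox {a : ℤ} {k : Bool} {p : R3}
    (hp : boxChart k p ∈ twistBox a) (hc : boxChart k p ∉ twistCore) : p ∈ upSet ∪ downSet := by
  by_contra h
  rcases notMem_upSet_union_downSet_iff.1 h with h | ⟨j, hj⟩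
  · exact notMem_connectingArcs_of_mem_twistBox hp h
  · obtain rfl := eq_of_mem_strip (mem_strip_of_mem_twistCore hj) (mem_strip_of_mem_twistBox hp).1
    exact hc hj

theorem notMem_upSet_union_downSet_of_mem_twistCore {k : Bool} {p : R3}
    (hp : boxChart k p ∈ twistCore) : p ∉ upSet ∪ downSet :=
  notMem_upSet_union_downSet_iff.2 (Or.inr ⟨k, hp⟩)

theorem boxChart_symm_height (k : Bool) (p : R3) : ((boxChart k).symm p).2.2 = p.2.2 := by
  cases k <;> rfl

theorem isBoxFrame (a : ℤ) (k : Bool) :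
    IsBoxFrame a ((boxChart k).symm ⁻¹' upSet) ((boxChart k).symm ⁻¹' downSet) where
  isOpen_up := isOpen_upSet.preimage (boxChart k).symm.continuous
  isOpen_down := isOpen_downSet.preimage (boxChart k).symm.continuous
  up_core p hp hc := notMem_upSet_union_downSet_of_mem_twistCore (k := k) (by simpa using hc)
    (Or.inl hp)
  down_core p hp hc := notMem_upSet_union_downSet_of_mem_twistCore (k := k) (by simpa using hc)
    (Or.inr hp)
  up_mem p hp hc hz := by
    have h := mem_upSet_union_downSet_of_mem_twistBox (a := a) (k := k) (p := (boxChart k).symm p)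
      (by simpa using hp) (by simpa using hc)
    rw [mem_upSet_union_downSet_iff, abs_of_nonneg (by rwa [boxChart_symm_height])] at h
    exact h
  down_mem p hp hc hz := by
    have h := mem_upSet_union_downSet_of_mem_twistBox (a := a) (k := k) (p := (boxChart k).symm p)
      (by simpa using hp) (by simpa using hc)
    rw [mem_upSet_union_downSet_iff, abs_of_nonpos (by rwa [boxChart_symm_height])] at h
    exact h

/-! ### The cover of the complement -/

/-- The names of the members of the open cover of the complement of the knot: what is seen from
above, what is seen from below, a neighbourhood of infinity, and the two twist regions. -/
inductive Piece
  | up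
  | down
  | outer
  | box (k : Bool)

/-- The finite points of a member of the open cover, for `a k` half twists in the region `k`. -/
def pieceSet (a : Bool → ℤ) : Piece → Set R3
  | .up => upSet
  | .down => downSet
  | .outer => farSet
  | .box k => boxChart k ⁻¹' twistBox (a k)

/-- The open cover of the complement of the knot. -/
def piece (a : Bool → ℤ) : Piece → Set S3
  | .outer => outside R3 5
  | i => (↑) '' pieceSet a i

theorem coe_mem_piece {a : Bool → ℤ} {i : Piece} {p : R3} :
    (p : S3) ∈ piece a i ↔ p ∈ pieceSet a i := by
  cases i <;> simp [piece, pieceSet, farSet]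

theorem infty_mem_piece {a : Bool → ℤ} {i : Piece} :
    (OnePoint.infty : S3) ∈ piece a i ↔ i = .outer := by
  cases i <;> simp [piece]

theorem isOpen_pieceSet (a : Bool → ℤ) (i : Piece) : IsOpen (pieceSet a i) := by
  cases i with
  | up => exact isOpen_upSet
  | down => exact isOpen_downSet
  | outer => exact isOpen_farSet
  | box k => exact (isOpen_twistBox _).preimage (boxChart k).continuous

theorem isOpen_piece (a : Bool → ℤ) (i : Piece) : IsOpen (piece a i) := by
  cases i with
  | outer => exact isOpen_outside 5
  | _ => exact OnePoint.isOpenEmbedding_coe.isOpenMap _ (isOpen_pieceSet a _)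

theorem isSimplyConnected_piece (a : Bool → ℤ) (i : Piece) : IsSimplyConnected (piece a i) := by
  have h_coe (S : Set R3) (hS : IsSimplyConnected S) : IsSimplyConnected ((↑) '' S : Set S3) :=
    (OnePoint.isOpenEmbedding_coe.isEmbedding.isSimplyConnected_image).2 hS
  cases i with
  | outer => exact isSimplyConnected_outside (by norm_num)
  | up => exact h_coe _ isSimplyConnected_upSet
  | down => exact h_coe _ isSimplyConnected_downSet
  | box k =>
    refine h_coe _ ?_
    rw [pieceSet, ← (boxChart k).isEmbedding.isSimplyConnected_image,
      image_preimage_eq _ (boxChart k).surjective]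
    exact isSimplyConnected_twistBox _

theorem coe_mem_conwayModel_iff {a : Bool → ℤ} {p : R3} :
    (p : S3) ∈ conwayModel (a false) (a true) ↔
      p ∈ connectingArcs ∨ ∃ k, boxChart k p ∈ strands (a k) := by
  rw [conwayModel, OnePoint.coe_injective.mem_set_image, horizontalTwists_eq, verticalTwists_eq,
    Bool.exists_bool, mem_union, or_comm]
  rfl

theorem coe_notMem_conwayModel_iff {a : Bool → ℤ} {p : R3} :
    (p : S3) ∉ conwayModel (a false) (a true) ↔ ∃ i, p ∈ pieceSet a i := by
  have h_core {k : Bool} (h : boxChart k p ∈ strands (a k)) : boxChart k p ∈ twistCore :=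
    ⟨h.1, h.2.1.le⟩
  rw [coe_mem_conwayModel_iff]
  constructor
  · intro h
    by_cases hp : p ∈ upSet ∪ downSet
    · rcases hp with hp | hp
      exacts [⟨.up, hp⟩, ⟨.down, hp⟩]
    · rcases notMem_upSet_union_downSet_iff.1 hp with hp | ⟨k, hk⟩
      · exact absurd (Or.inl hp) h
      · exact ⟨.box k, mem_twistBox_of_mem_twistCore hk fun hs => h (Or.inr ⟨k, hs⟩)⟩
  · rintro ⟨i, hi⟩ h
    have h_hidden : p ∉ upSet ∪ downSet :=
      notMem_upSet_union_downSet_iff.2 (h.imp_right fun ⟨k, hk⟩ => ⟨k, h_core hk⟩)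
    cases i with
    | up => exact h_hidden (Or.inl hi)
    | down => exact h_hidden (Or.inr hi)
    | outer => exact h_hidden (farSet_subset_upSet_union_downSet hi)
    | box k =>
      rcases h with h | ⟨j, hj⟩
      · exact notMem_connectingArcs_of_mem_twistBox hi h
      · obtain rfl := eq_of_mem_strip (mem_strip_of_mem_twistCore (h_core hj))
          (mem_strip_of_mem_twistBox hi).1
        exact notMem_twistBox_of_mem_strands hj hi

theorem compl_conwayModel (a : Bool → ℤ) :
    (conwayModel (a false) (a true))ᶜ = ⋃ i, piece a i := by
  ext x
  induction x using OnePoint.rec with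
  | infty => simp [conwayModel, infty_mem_piece]
  | coe p => simp only [mem_compl_iff, coe_notMem_conwayModel_iff, mem_iUnion, coe_mem_piece]

/-! ### Face values -/

/-- The face on the positive side of a twist region: above the horizontal one and to the right of
the vertical one, which `boxChart true` turns by a quarter. -/
def posFace : Bool → Face
  | false => .top
  | true => .outer

/-- The face on the side of a twist region opposite to `posFace`. -/
def negFace : Bool → Face
  | false => .bottom
  | true => .middle

/-- The face before a twist region: to the left of the horizontal one and below the vertical one. -/
def leftFace : Bool → Face
  | false => .outer
  | true => .bottom

/-- The face behind a twist region: to the right of the horizontal one and above the vertical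
one. -/
def rightFace : Bool → Face
  | false => .middle
  | true => .top

/-- The function of a twist region which labels the points by the values `v` of the faces that
contain them. -/
noncomputable def faceLabel {G : Type*} (v : Face → G) (k : Bool) (q : R3) : G :=
  v (faceOf ((boxChart k).symm q))

/-- Labels of the faces of the diagram that satisfy the relations of both twist regions, with
`a k` half twists in the region `k`. -/
structure IsFaceSystem {G : Type*} [Group G] (a : Bool → ℤ) (v : Face → G) : Prop where
  outer_eq : v .outer = 1
  boxRelation : ∀ k,
    BoxRelation (v (posFace k)) (v (negFace k)) (v (leftFace k)) (v (rightFace k)) (a k)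

/-- A cocycle on the cover of the complement in the normal form determined by the face labels `v`:
passing from above to below through a face contributes its label. -/
structure IsFaceCocycle {G : Type*} [Group G] (a : Bool → ℤ) (v : Face → G)
    (d : Piece → Piece → S3 → G) : Prop where
  isCocycle : IsCocycle (piece a) d
  up_down : ∀ p ∈ upSet ∩ downSet, d .up .down (p : R3) = v (faceOf p)
  up_outer : ∀ p ∈ upSet ∩ farSet, d .up .outer (p : R3) = 1
  down_outer : ∀ p ∈ downSet ∩ farSet, d .down .outer (p : R3) = 1
  isGluing : ∀ k, IsGluing (fun p : R3 => p.2.2) (twistBox (a k)) ((boxChart k).symm ⁻¹' upSet)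
    ((boxChart k).symm ⁻¹' downSet)
    (boxValue (v (posFace k)) (v (negFace k)) (v (leftFace k)) (a k)) (faceLabel v k)
    (fun q => d (.box k) .up ((boxChart k).symm q : R3))
    fun q => d (.box k) .down ((boxChart k).symm q : R3)

section Pieces

variable {G : Type*} {a : Bool → ℤ} {d : Piece → Piece → S3 → G}

theorem mem_pieceSet_box {k : Bool} {q : R3} :
    (boxChart k).symm q ∈ pieceSet a (.box k) ↔ q ∈ twistBox (a k) := by
  simp [pieceSet]

theorem IsCocycle.mul_coe [Group G] (hd : IsCocycle (piece a) d) {i j k : Piece} {p : R3}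
    (hi : p ∈ pieceSet a i) (hj : p ∈ pieceSet a j) (hk : p ∈ pieceSet a k) :
    d i j p * d j k p = d i k p :=
  hd i j k p (coe_mem_piece.2 hi) (coe_mem_piece.2 hj) (coe_mem_piece.2 hk)

theorem forall_mem_piece_inter_piece {Q : Piece → Piece → S3 → Prop}
    (refl : ∀ i, ∀ x ∈ piece a i, Q i i x)
    (symm : ∀ i j, ∀ x ∈ piece a i ∩ piece a j, Q i j x → Q j i x)
    (up_down : ∀ p ∈ upSet ∩ downSet, Q .up .down (p : R3))
    (up_outer : ∀ p ∈ upSet ∩ farSet, Q .up .outer (p : R3))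
    (down_outer : ∀ p ∈ downSet ∩ farSet, Q .down .outer (p : R3))
    (box_up : ∀ k, ∀ q ∈ twistBox (a k) ∩ (boxChart k).symm ⁻¹' upSet,
      Q (.box k) .up ((boxChart k).symm q : R3))
    (box_down : ∀ k, ∀ q ∈ twistBox (a k) ∩ (boxChart k).symm ⁻¹' downSet,
      Q (.box k) .down ((boxChart k).symm q : R3))
    (i j : Piece) : ∀ x ∈ piece a i ∩ piece a j, Q i j x := by
  rintro x ⟨hi, hj⟩
  induction x using OnePoint.rec with
  | infty =>
    obtain rfl := infty_mem_piece.1 hi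
    obtain rfl := infty_mem_piece.1 hj
    exact refl _ _ hi
  | coe p =>
    have h_box_up k (hp : p ∈ pieceSet a (.box k)) (hu : p ∈ upSet) : Q (.box k) .up (p : R3) := by
      simpa using box_up k (boxChart k p) ⟨hp, by simpa⟩
    have h_box_down k (hp : p ∈ pieceSet a (.box k)) (hu : p ∈ downSet) :
        Q (.box k) .down (p : R3) := by
      simpa using box_down k (boxChart k p) ⟨hp, by simpa⟩
    have hpi := coe_mem_piece.1 hi
    have hpj := coe_mem_piece.1 hj
    rcases i with _ | _ | _ | k <;> rcases j with _ | _ | _ | l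
    · exact refl _ _ hi
    · exact up_down _ ⟨hpi, hpj⟩
    · exact up_outer _ ⟨hpi, hpj⟩
    · exact symm _ _ _ ⟨hj, hi⟩ (h_box_up _ hpj hpi)
    · exact symm _ _ _ ⟨hj, hi⟩ (up_down _ ⟨hpj, hpi⟩)
    · exact refl _ _ hi
    · exact down_outer _ ⟨hpi, hpj⟩
    · exact symm _ _ _ ⟨hj, hi⟩ (h_box_down _ hpj hpi)
    · exact symm _ _ _ ⟨hj, hi⟩ (up_outer _ ⟨hpj, hpi⟩)
    · exact symm _ _ _ ⟨hj, hi⟩ (down_outer _ ⟨hpj, hpi⟩)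
    · exact refl _ _ hi
    · exact absurd hpi (notMem_farSet_of_mem_twistBox hpj)
    · exact h_box_up _ hpi hpj
    · exact h_box_down _ hpi hpj
    · exact absurd hpj (notMem_farSet_of_mem_twistBox hpi)
    · obtain rfl := eq_of_mem_strip (mem_strip_of_mem_twistBox hpi).1
        (mem_strip_of_mem_twistBox hpj).1
      exact refl _ _ hi

theorem IsFlatCocycle.eq_of_isPathConnected [Group G] (hd : IsFlatCocycle (piece a) d)
    {i j : Piece} {W : Set R3} (hW : IsPathConnected W) (hWij : W ⊆ pieceSet a i ∩ pieceSet a j)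
    {p q : R3} (hp : p ∈ W) (hq : q ∈ W) : d i j p = d i j q := by
  refine hd.eq_of_joinedIn i j _ _ (((hW.image OnePoint.continuous_coe).joinedIn p ⟨p, hp, rfl⟩ q
    ⟨q, hq, rfl⟩).mono ?_)
  rintro _ ⟨r, hr, rfl⟩
  exact ⟨coe_mem_piece.2 (hWij hr).1, coe_mem_piece.2 (hWij hr).2⟩

theorem IsFlatCocycle.eventually_eq [Group G] (hd : IsFlatCocycle (piece a) d) {i j : Piece}
    {p : R3} (hp : p ∈ pieceSet a i ∩ pieceSet a j) : ∀ᶠ q : R3 in 𝓝 p, d i j q = d i j p := by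
  obtain ⟨ε, hε, hball⟩ :=
    Metric.isOpen_iff.1 ((isOpen_pieceSet a i).inter (isOpen_pieceSet a j)) p hp
  filter_upwards [Metric.ball_mem_nhds p hε] with q hq
  exact hd.eq_of_isPathConnected ((convex_ball p ε).isPathConnected ⟨p, Metric.mem_ball_self hε⟩)
    hball hq (Metric.mem_ball_self hε)

theorem exists_mem_outer_inter_farSet : ∃ p ∈ faceSet .outer, p ∈ farSet :=
  ⟨(10, 0, 0), by norm_num [faceSet], by norm_num [mem_farSet]⟩

theorem nonempty_up_inter_piece (a : Bool → ℤ) (i : Piece) :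
    (piece a .up ∩ piece a i).Nonempty := by
  suffices h : ∃ p ∈ upSet, p ∈ pieceSet a i from
    let ⟨p, hu, hi⟩ := h
    ⟨p, coe_mem_piece.2 hu, coe_mem_piece.2 hi⟩
  obtain ⟨p, hp, h_far⟩ := exists_mem_outer_inter_farSet
  have h_up_down := faceSet_subset_upSet_inter_downSet _ hp
  cases i with
  | up => exact ⟨p, h_up_down.1, h_up_down.1⟩
  | down => exact ⟨p, h_up_down⟩
  | outer => exact ⟨p, h_up_down.1, h_far⟩
  | box k =>
    have h_axis : ((3 / 2, 0, 0) : R3) ∈ twistBox (a k) :=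
      axis_mem_twistBox _ (by norm_num [abs_lt])
    have h_core : ((3 / 2, 0, 0) : R3) ∉ twistCore := fun h =>
      absurd h.1 (by norm_num [abs_le])
    exact ⟨_, (isBoxFrame (a k) k).up_mem _ h_axis h_core le_rfl, mem_pieceSet_box.2 h_axis⟩

end Pieces

section FaceValues

variable {G H : Type*} {a : Bool → ℤ} {v : Face → G}

theorem eventually_faceOf_eq {p : R3} (hp : p ∈ upSet ∩ downSet) :
    ∀ᶠ q in 𝓝 p, faceOf q = faceOf p := by
  obtain ⟨f, hf⟩ := exists_mem_faceSet hp
  filter_upwards [(isOpen_faceSet f).mem_nhds hf] with q hq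
  rw [faceOf_eq hf, faceOf_eq hq]

theorem isFaceFunction_faceLabel (v : Face → G) (k : Bool) :
    IsFaceFunction ((boxChart k).symm ⁻¹' upSet) ((boxChart k).symm ⁻¹' downSet) (faceLabel v k)
      (v (posFace k)) (v (negFace k)) (v (leftFace k)) (v (rightFace k)) where
  eventually_eq p hp := ((boxChart k).symm.continuous.continuousAt.eventually
    (eventually_faceOf_eq hp)).mono fun _ => congrArg v
  pos p h_fst h_gt h_lt hz := by
    refine congrArg v (faceOf_eq ?_)
    cases k <;> simp [posFace, faceSet, hz] <;> grind
  neg p h_fst h_lt h_gt hz := by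
    refine congrArg v (faceOf_eq ?_)
    cases k <;> simp [negFace, faceSet, hz] <;> grind
  left p h_lt h_gt h_snd hz := by
    refine congrArg v (faceOf_eq ?_)
    cases k <;> simp [leftFace, faceSet, hz] <;> grind
  right p h_gt h_lt h_snd hz := by
    refine congrArg v (faceOf_eq ?_)
    cases k <;> simp [rightFace, faceSet, hz] <;> grind

variable [Group G] [Group H]

theorem exists_label_of_isFlatCocycle {d : Piece → Piece → S3 → G}
    (hd : IsFlatCocycle (piece a) d) {p₀ : R3} (hp₀ : p₀ ∈ faceSet .outer) :
    ∃ v : Face → G, v .outer = 1 ∧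
      ∀ p ∈ upSet ∩ downSet, d .up .down p * (d .up .down p₀)⁻¹ = v (faceOf p) := by
  choose base h_base using fun f => (isPathConnected_faceSet f).nonempty
  have h_const {f p q} (hp : p ∈ faceSet f) (hq : q ∈ faceSet f) : d .up .down p = d .up .down q :=
    hd.eq_of_isPathConnected (i := .up) (j := .down) (isPathConnected_faceSet f)
      (faceSet_subset_upSet_inter_downSet f) hp hq
  refine ⟨fun f => d .up .down (base f) * (d .up .down p₀)⁻¹, ?_, fun p hp => ?_⟩
  · simp only [h_const (h_base .outer) hp₀, mul_inv_cancel]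
  · obtain ⟨f, hf⟩ := exists_mem_faceSet hp
    rw [faceOf_eq hf, h_const hf (h_base f)]

theorem exists_isGluing_of_isFlatCocycle {d : Piece → Piece → S3 → G}
    (hd : IsFlatCocycle (piece a) d) {v : Face → G} {g : G}
    (hv : ∀ p ∈ upSet ∩ downSet, d .up .down (p : R3) * g = v (faceOf p)) (k : Bool) :
    ∃ x, IsGluing (fun p : R3 => p.2.2) (twistBox (a k)) ((boxChart k).symm ⁻¹' upSet)
      ((boxChart k).symm ⁻¹' downSet)
      (fun p => x * boxValue (v (posFace k)) (v (negFace k)) (v (leftFace k)) (a k) p)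
      (faceLabel v k) (fun q => d (.box k) .up ((boxChart k).symm q : R3))
      fun q => d (.box k) .down ((boxChart k).symm q : R3) * g := by
  refine (isBoxFrame (a k) k).exists_isGluing_of_isCochain (isFaceFunction_faceLabel v k)
    ⟨fun q hq => ?_, fun q hq => ?_, fun q hq => ?_⟩
  · exact (boxChart k).symm.continuous.continuousAt.eventually
      (hd.eventually_eq (i := .box k) (j := .up) ⟨mem_pieceSet_box.2 hq.1, hq.2⟩)
  · exact ((boxChart k).symm.continuous.continuousAt.eventually (hd.eventually_eq (i := .box k)
      (j := .down) ⟨mem_pieceSet_box.2 hq.1, hq.2⟩)).mono fun _ => congrArg (· * g)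
  · rw [faceLabel, ← hv _ hq.2, ← mul_assoc, hd.isCocycle.mul_coe (i := .box k) (j := .up)
      (k := .down) (mem_pieceSet_box.2 hq.1) hq.2.1 hq.2.2]

theorem IsFlatCocycle.exists_isFaceCocycle {d : Piece → Piece → S3 → G}
    (hd : IsFlatCocycle (piece a) d) :
    ∃ (h : Piece → G) (v : Face → G), IsFaceSystem a v ∧
      IsFaceCocycle a v fun i j x => (h i)⁻¹ * d i j x * h j := by
  obtain ⟨p₀, h_outer, h_far⟩ := exists_mem_outer_inter_farSet
  obtain ⟨h_up, h_down⟩ := faceSet_subset_upSet_inter_downSet _ h_outer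
  obtain ⟨v, hv_outer, hv⟩ := exists_label_of_isFlatCocycle hd h_outer
  choose x hx using exists_isGluing_of_isFlatCocycle hd hv
  let h : Piece → G
    | .up => 1
    | .down => (d .up .down p₀)⁻¹
    | .outer => (d .up .outer p₀)⁻¹
    | .box k => x k
  refine ⟨h, v, ⟨hv_outer, fun k => (isBoxFrame (a k) k).boxRelation_of_isGluing
    (isFaceFunction_faceLabel v k) (hx k)⟩, fun i j k y hi hj hk => ?_, fun p hp => ?_,
    fun p hp => ?_, fun p hp => ?_, fun k => ?_⟩
  · rw [← hd.isCocycle i j k y hi hj hk]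
    group
  · simpa [h] using hv p hp
  · have h_const := hd.eq_of_isPathConnected (i := .up) (j := .outer)
      isPathConnected_upSet_inter_farSet subset_rfl hp ⟨h_up, h_far⟩
    simp [h, h_const]
  · have h_const := hd.eq_of_isPathConnected (i := .down) (j := .outer)
      isPathConnected_downSet_inter_farSet subset_rfl hp ⟨h_down, h_far⟩
    have h_mul := hd.isCocycle.mul_coe (i := .up) (j := .down) (k := .outer) h_up h_down h_far
    simp [h, h_const, h_mul]
  · simpa [h, mul_assoc] using
      (hx k).map (MonoidHom.id G) (x k)⁻¹ (fun p => (inv_mul_cancel_left _ _).symm) fun _ _ => rfl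

theorem IsFaceSystem.exists_isFaceCocycle (hv : IsFaceSystem a v) : ∃ c, IsFaceCocycle a v c := by
  choose b hb using fun k => (isBoxFrame (a k) k).exists_isGluing (isFaceFunction_faceLabel v k)
    (isOpen_twistBox _) subset_rfl fun _ _ _ _ => hv.boxRelation k
  let frame : Piece → R3 → G
    | .up, _ => 1
    | .down, p => (v (faceOf p))⁻¹
    | .outer, _ => 1
    | .box k, p => b k (boxChart k p)
  refine ⟨fun i j x => x.elim 1 (frame i) * (x.elim 1 (frame j))⁻¹, fun i j k x _ _ _ => ?_,
    fun p _ => ?_, fun p _ => ?_, fun p hp => ?_, fun k => ?_⟩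
  · group
  · simp [frame]
  · simp [frame]
  · simp [frame, faceOf_of_mem_farSet hp.2, hv.outer_eq]
  · simpa [frame, faceLabel] using hb k

namespace IsFaceCocycle

variable {c : Piece → Piece → S3 → G} (hc : IsFaceCocycle a v c)

include hc

theorem isLocalSystem : IsLocalSystem (piece a) c := by
  have h_chart {Q : R3 → Prop} (k : Bool) {q : R3} (h : ∀ᶠ r in 𝓝 q, Q ((boxChart k).symm r)) :
      ∀ᶠ p in 𝓝 ((boxChart k).symm q), Q p := by
    rwa [← (boxChart k).symm.map_nhds_eq, eventually_map]
  refine ⟨isOpen_piece a, hc.isCocycle, forall_mem_piece_inter_piece ?_ ?_ ?_ ?_ ?_ ?_ ?_⟩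
  · intro i x hx
    filter_upwards [(isOpen_piece a i).mem_nhds hx] with y hy
    rw [hc.isCocycle.self hx, hc.isCocycle.self hy]
  · intro i j x hx h
    filter_upwards [h, (isOpen_piece a i).mem_nhds hx.1, (isOpen_piece a j).mem_nhds hx.2]
      with y hy hi hj
    rw [← hc.isCocycle.inv hi hj, ← hc.isCocycle.inv hx.1 hx.2, hy]
  all_goals simp only [OnePoint.nhds_coe_eq, eventually_map]
  · intro p hp
    filter_upwards [eventually_faceOf_eq hp, (isOpen_upSet.inter isOpen_downSet).mem_nhds hp]
      with q hq hq'
    rw [hc.up_down p hp, hc.up_down q hq', hq]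
  · intro p hp
    filter_upwards [(isOpen_upSet.inter isOpen_farSet).mem_nhds hp] with q hq
    rw [hc.up_outer p hp, hc.up_outer q hq]
  · intro p hp
    filter_upwards [(isOpen_downSet.inter isOpen_farSet).mem_nhds hp] with q hq
    rw [hc.down_outer p hp, hc.down_outer q hq]
  · exact fun k q hq => h_chart k ((hc.isGluing k).eventually_up q hq)
  · exact fun k q hq => h_chart k ((hc.isGluing k).eventually_down q hq)

theorem range_subset_holonomies (h_outer : v .outer = 1) :
    range v ⊆ holonomies (piece a) c .up := by
  have h_mem f {p} (hp : p ∈ faceSet f) : (p : S3) ∈ piece a .up ∩ piece a .down ∧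
      c .up .down p = v f := by
    have h_up_down := faceSet_subset_upSet_inter_downSet f hp
    exact ⟨⟨coe_mem_piece.2 h_up_down.1, coe_mem_piece.2 h_up_down.2⟩,
      by rw [hc.up_down p h_up_down, faceOf_eq hp]⟩
  rintro _ ⟨f, rfl⟩
  obtain ⟨p, hp⟩ := (isPathConnected_faceSet .outer).nonempty
  obtain ⟨q, hq⟩ := (isPathConnected_faceSet f).nonempty
  obtain ⟨hp_mem, hp_eq⟩ := h_mem _ hp
  obtain ⟨hq_mem, hq_eq⟩ := h_mem _ hq
  exact ⟨.down, _, hp_mem, _, hq_mem, by rw [hp_eq, hq_eq, h_outer, inv_one, mul_one]⟩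

theorem eq_map {d : Piece → Piece → S3 → H} {f : G →* H} (hd : IsFaceCocycle a (f ∘ v) d)
    (i j : Piece) : ∀ x ∈ piece a i ∩ piece a j, d i j x = f (c i j x) := by
  have h_map k := (hc.isGluing k).map f 1 (κ' := boxValue (f (v (posFace k)))
    (f (v (negFace k))) (f (v (leftFace k))) (a k)) (F' := faceLabel (f ∘ v) k)
    (fun p => by rw [one_mul, map_boxValue]) fun _ _ => rfl
  simp only [one_mul] at h_map
  have h_box k := (hd.isGluing k).eq_of_isGluing (h_map k)
    ((isBoxFrame (a k) k).isCut (isOpen_twistBox _) subset_rfl)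
  refine forall_mem_piece_inter_piece (Q := fun i j x => d i j x = f (c i j x))
    ?_ ?_ ?_ ?_ ?_ ?_ ?_ i j
  · intro i x hx
    rw [hc.isCocycle.self hx, hd.isCocycle.self hx, map_one]
  · intro i j x hx h
    rw [← hc.isCocycle.inv hx.1 hx.2, ← hd.isCocycle.inv hx.1 hx.2, h, map_inv]
  · intro p hp
    rw [hc.up_down p hp, hd.up_down p hp, Function.comp_apply]
  · intro p hp
    rw [hc.up_outer p hp, hd.up_outer p hp, map_one]
  · intro p hp
    rw [hc.down_outer p hp, hd.down_outer p hp, map_one]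
  · exact fun k => (h_box k).1
  · exact fun k => (h_box k).2

theorem isInducedFrom
    (huniv : ∀ v' : Face → H, IsFaceSystem a v' → ∃ f : G →* H, f ∘ v = v')
    {d : Piece → Piece → S3 → H} (hd : IsFlatCocycle (piece a) d) :
    IsInducedFrom (piece a) d c := by
  obtain ⟨h, v', hv', hd'⟩ := hd.exists_isFaceCocycle
  obtain ⟨f, rfl⟩ := huniv v' hv'
  refine ⟨f, h, fun i j x hx => ?_⟩
  rw [← hc.eq_map hd' i j x hx]
  group

end IsFaceCocycle

theorem nonempty_mulEquiv_of_isFaceSystem {G : Type} [Group G] {v : Face → G}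
    (hv : IsFaceSystem a v) (hgen : Subgroup.closure (range v) = ⊤)
    (huniv : ∀ (H : Type) [Group H] (v' : Face → H), IsFaceSystem a v' →
      ∃ f : G →* H, f ∘ v = v') (x : ↥((conwayModel (a false) (a true))ᶜ)) :
    Nonempty (FundamentalGroup ↥((conwayModel (a false) (a true))ᶜ) x ≃* G) := by
  obtain ⟨c, hc⟩ := hv.exists_isFaceCocycle
  have h_holonomies : Subgroup.closure (holonomies (piece a) c .up) = ⊤ :=
    top_le_iff.1 (hgen ▸ Subgroup.closure_mono (hc.range_subset_holonomies hv.outer_eq))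
  revert x
  rw [compl_conwayModel]
  exact nonempty_fundamentalGroup_iUnion_mulEquiv hc.isLocalSystem (isSimplyConnected_piece a)
    (nonempty_up_inter_piece a) h_holonomies fun H _ _ => hc.isInducedFrom (huniv H)

end FaceValues

/-! ### The presentation with two generators -/

section Presentation

variable {H : Type*} [Group H]

theorem boxRelation_two_mul {P N L R : H} {m : ℤ} :
    BoxRelation P N L R (2 * m) ↔ (N * P⁻¹) ^ m * R = L * P⁻¹ * ((N * P⁻¹) ^ m * P) := by
  rw [BoxRelation, if_pos (even_two_mul m), turnValue_sub_one_of_even _ _ (even_two_mul m),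
    turnValue_even]

theorem boxRelation_two_mul_add_one {P N L R : H} {m : ℤ} :
    BoxRelation P N L R (2 * m + 1) ↔ L * P⁻¹ * (N * P⁻¹) ^ m * R = (N * P⁻¹) ^ m * N := by
  rw [BoxRelation, if_neg (Int.not_even_iff_odd.2 (odd_two_mul_add_one m)), turnValue_odd,
    add_sub_cancel_right, turnValue_even]

/-- The numbers of half twists in the two regions of the diagram `C(2n, 3)`. -/
def twists (n : ℤ) : Bool → ℤ
  | false => 2 * n
  | true => 3

/-- The map on the generators with values `σ` at `s` and `τ` at `t`. -/
def genMap (σ τ : H) : Gen → H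
  | Gen.s => σ
  | Gen.t => τ

theorem lift_relator_eq_one_iff {σ τ : H} {n : ℤ} :
    FreeGroup.lift (genMap σ τ) (relator n) = 1 ↔
      σ * (τ * σ⁻¹ * τ * σ * τ⁻¹ * σ) ^ n = (τ * σ⁻¹ * τ * σ * τ⁻¹ * σ) ^ n * τ := by
  simp [relator, w, s, t, genMap, mul_inv_eq_iff_eq_mul]

/-- The face labels of the diagram `C(2n, 3)`, in terms of the images `σ` and `τ` of the two
generators. -/
def labels (σ τ : H) : Face → H
  | .outer => 1
  | .top => σ⁻¹
  | .bottom => σ⁻¹ * (τ * σ⁻¹ * τ * σ * τ⁻¹ * σ)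
  | .middle => σ⁻¹ * τ

theorem comp_labels {G : Type*} [Group G] (f : G →* H) (σ τ : G) :
    f ∘ labels σ τ = labels (f σ) (f τ) := by
  ext i
  cases i <;> simp [labels]

theorem closure_range_labels {σ τ : H} (h : Subgroup.closure {σ, τ} = ⊤) :
    Subgroup.closure (range (labels σ τ)) = ⊤ := by
  have h_label (f : Face) : labels σ τ f ∈ Subgroup.closure (range (labels σ τ)) :=
    Subgroup.subset_closure (mem_range_self f)
  have hσ : σ ∈ Subgroup.closure (range (labels σ τ)) := inv_mem_iff.1 (h_label .top)
  have hτ : τ ∈ Subgroup.closure (range (labels σ τ)) := by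
    simpa [labels] using mul_mem hσ (h_label .middle)
  rw [← top_le_iff, ← h, Subgroup.closure_le]
  exact pair_subset hσ hτ

theorem isFaceSystem_twists_iff {n : ℤ} {v : Face → H} : IsFaceSystem (twists n) v ↔
    v .outer = 1 ∧
      (v .bottom * (v .top)⁻¹) ^ n * v .middle =
        (v .top)⁻¹ * ((v .bottom * (v .top)⁻¹) ^ n * v .top) ∧
      v .bottom * v .middle * v .top = v .middle * v .middle := by
  have h_forall : IsFaceSystem (twists n) v ↔ v .outer = 1 ∧
      BoxRelation (v .top) (v .bottom) (v .outer) (v .middle) (2 * n) ∧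
      BoxRelation (v .outer) (v .middle) (v .bottom) (v .top) (2 * 1 + 1) :=
    ⟨fun h => ⟨h.outer_eq, h.boxRelation false, h.boxRelation true⟩,
      fun h => ⟨h.1, Bool.forall_bool.2 h.2⟩⟩
  rw [h_forall, boxRelation_two_mul, boxRelation_two_mul_add_one]
  refine and_congr_right fun h => ?_
  simp only [h, inv_one, one_mul, mul_one, zpow_one]

theorem isFaceSystem_labels_iff {n : ℤ} {σ τ : H} : IsFaceSystem (twists n) (labels σ τ) ↔
    FreeGroup.lift (genMap σ τ) (relator n) = 1 := by
  have h_vertical : labels σ τ .bottom * labels σ τ .middle * labels σ τ .top =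
      labels σ τ .middle * labels σ τ .middle := by
    simp only [labels]
    group
  have h_conj : labels σ τ .bottom * (labels σ τ .top)⁻¹ =
      σ⁻¹ * (τ * σ⁻¹ * τ * σ * τ⁻¹ * σ) * σ⁻¹⁻¹ := by
    simp only [labels, inv_inv]
  rw [isFaceSystem_twists_iff, lift_relator_eq_one_iff, h_conj, conj_zpow]
  simp only [h_vertical, and_true]
  simp only [labels, true_and]
  generalize (τ * σ⁻¹ * τ * σ * τ⁻¹ * σ) ^ n = W
  calc σ⁻¹ * W * σ⁻¹⁻¹ * (σ⁻¹ * τ) = σ⁻¹⁻¹ * (σ⁻¹ * W * σ⁻¹⁻¹ * σ⁻¹)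
      ↔ σ⁻¹ * (W * τ) = W := by simp [mul_assoc]
    _ ↔ σ * W = W * τ := by rw [inv_mul_eq_iff_eq_mul, eq_comm]

theorem IsFaceSystem.exists_eq_labels {n : ℤ} {v : Face → H} (hv : IsFaceSystem (twists n) v) :
    ∃ σ τ, v = labels σ τ := by
  obtain ⟨h_outer, -, h_vertical⟩ := isFaceSystem_twists_iff.1 hv
  refine ⟨(v .top)⁻¹, (v .top)⁻¹ * v .middle, funext fun f => ?_⟩
  cases f with
  | outer => exact h_outer
  | top => simp [labels]
  | middle => simp [labels]
  | bottom =>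
    rw [← eq_mul_inv_iff_mul_eq, ← eq_mul_inv_iff_mul_eq] at h_vertical
    rw [h_vertical]
    simp only [labels]
    group

end Presentation

theorem nonempty_mulEquiv_knotGroup (n : ℤ) (x : ↥((conwayModel (2 * n) 3)ᶜ)) :
    Nonempty (FundamentalGroup ↥((conwayModel (2 * n) 3)ᶜ) x ≃* knotGroup n) := by
  let σ : knotGroup n := PresentedGroup.of Gen.s
  let τ : knotGroup n := PresentedGroup.of Gen.t
  have h_generate : Subgroup.closure {σ, τ} = ⊤ := by
    rw [← PresentedGroup.closure_range_of {relator n}]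
    congr 1
    ext g
    constructor
    · rintro (rfl | rfl)
      exacts [⟨_, rfl⟩, ⟨_, rfl⟩]
    · rintro ⟨_ | _, rfl⟩
      exacts [Or.inl rfl, Or.inr rfl]
  have h_lift : FreeGroup.lift (genMap σ τ) = PresentedGroup.mk {relator n} := by
    ext g
    cases g <;> simp [genMap, σ, τ, PresentedGroup.of]
  have h_relator : FreeGroup.lift (genMap σ τ) (relator n) = 1 :=
    h_lift ▸ PresentedGroup.one_of_mem rfl
  refine nonempty_mulEquiv_of_isFaceSystem (a := twists n) (isFaceSystem_labels_iff.2 h_relator)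
    (closure_range_labels h_generate) (fun H _ v hv => ?_) x
  obtain ⟨σ', τ', rfl⟩ := hv.exists_eq_labels
  refine ⟨PresentedGroup.toGroup (f := genMap σ' τ') ?_, ?_⟩
  · rintro _ rfl
    exact isFaceSystem_labels_iff.1 hv
  · rw [comp_labels]
    simp [σ, τ, genMap]

/-! ### Reduced words from Schubert's normal form -/

section ReducedWords

theorem isReduced_of_isChain_map_fst {α : Type*} {L : List (α × Bool)}
    (h : (L.map Prod.fst).IsChain (· ≠ ·)) : FreeGroup.IsReduced L :=
  ((List.isChain_map _).1 h).imp fun _ _ hne heq => absurd heq hne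

theorem isChain_ne_append_reverse {α : Type*} {l : List α} {x y : α}
    (h : ([x] ++ l ++ [y]).IsChain (· ≠ ·)) :
    ([x] ++ l ++ [y] ++ l.reverse).IsChain (· ≠ ·) := by
  refine h.append_overlap ?_ (List.cons_ne_nil _ _)
  have h_reverse : ([y] ++ l.reverse).reverse.IsChain (· ≠ ·) :=
    h.infix ⟨[x], [], by simp⟩
  exact (List.isChain_reverse.1 h_reverse).imp fun _ _ => Ne.symm

theorem bridge_ne_succ (k : ℕ) : bridge k ≠ bridge (k + 1) := by
  by_cases h : Even k <;> simp [bridge, h, Nat.even_add_one]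

theorem map_fst_invRev {α : Type*} (L : List (α × Bool)) :
    (FreeGroup.invRev L).map Prod.fst = (L.map Prod.fst).reverse := by
  simp [FreeGroup.invRev]

theorem cons_map_fst_schubertWord_append {r : ℚ} (hr : Odd r.den) :
    [Gen.s] ++ (schubertWord r).map Prod.fst ++ [Gen.t] =
      (List.range (r.den + 1)).map bridge := by
  obtain ⟨m, hm⟩ := hr
  rw [schubertWord, hm, List.range_succ_eq_map, List.range_add (n := 2 * m) (m := 1)]
  simp [bridge, Function.comp_def]

theorem isChain_ne_map_fst_schubertWord {r : ℚ} (hr : Odd r.den) :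
    ([Gen.s] ++ (schubertWord r).map Prod.fst ++ [Gen.t] ++
      ((schubertWord r).map Prod.fst).reverse).IsChain (· ≠ ·) := by
  refine isChain_ne_append_reverse ?_
  rw [cons_map_fst_schubertWord_append hr, List.isChain_map, List.isChain_range]
  exact fun k _ => bridge_ne_succ k

theorem isReduced_cons_schubertWord {r : ℚ} (hr : Odd r.den) (b₁ b₂ : Bool) :
    FreeGroup.IsReduced ([(Gen.s, b₁)] ++ schubertWord r ++ [(Gen.t, b₂)] ++
      FreeGroup.invRev (schubertWord r)) := by
  refine isReduced_of_isChain_map_fst ?_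
  simpa only [List.map_append, List.map_singleton, map_fst_invRev] using
    isChain_ne_map_fst_schubertWord hr

theorem isReduced_schubertWord_append {r : ℚ} (hr : Odd r.den) (b₁ b₂ : Bool) :
    FreeGroup.IsReduced (schubertWord r ++ [(Gen.t, b₁)] ++
      FreeGroup.invRev (schubertWord r) ++ [(Gen.s, b₂)]) := by
  refine isReduced_of_isChain_map_fst (List.isChain_reverse.1 ?_)
  have h := (isChain_ne_map_fst_schubertWord hr).imp fun _ _ => Ne.symm
  simpa [map_fst_invRev] using h

end ReducedWords

section SchubertWord

theorem floor_mul_div_eq {a b i j : ℤ} (hb : 0 < b) (h_le : j * b ≤ i * a)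
    (h_lt : i * a < (j + 1) * b) : ⌊(i : ℚ) * ((a : ℚ) / b)⌋ = j := by
  have hb' : (0 : ℚ) < b := by exact_mod_cast hb
  rw [mul_div_assoc', Int.floor_eq_iff, le_div_iff₀ hb', div_lt_iff₀ hb']
  exact ⟨by exact_mod_cast h_le, by exact_mod_cast h_lt⟩

theorem floor_mul_div_of_eq_add_one {a b i : ℤ} (hab : 3 * a = 2 * b + 1) (hi : 0 < i)
    (hib : i < b) : ⌊(i : ℚ) * ((a : ℚ) / b)⌋ = 2 * i / 3 := by
  have h_prod : 3 * (i * a) = 2 * i * b + i := by linear_combination i * hab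
  have h_le : 3 * (2 * i / 3) ≤ 2 * i := by lia
  have h_lt : 2 * i + 1 ≤ 3 * (2 * i / 3 + 1) := by lia
  exact floor_mul_div_eq (hi.trans hib) (by nlinarith) (by nlinarith)

theorem floor_mul_div_of_add_one_eq {a b i : ℤ} (hab : 3 * a + 1 = 2 * b) (hi : 0 < i)
    (hib : i < b) : ⌊(i : ℚ) * ((a : ℚ) / b)⌋ = (2 * i - 1) / 3 := by
  have h_prod : 3 * (i * a) = 2 * i * b - i := by linear_combination i * hab
  have h_le : 3 * ((2 * i - 1) / 3) + 1 ≤ 2 * i := by lia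
  have h_lt : 2 * i ≤ 3 * ((2 * i - 1) / 3 + 1) := by lia
  exact floor_mul_div_eq (hi.trans hib) (by nlinarith) (by nlinarith)

/-- The `k`-th letter, counted from `0`, of the word read along an underpass whose `i`-th crossing
has height `F i` after rounding down. -/
def underpassLetter (F : ℤ → ℤ) (k : ℕ) : Gen × Bool :=
  (bridge (k + 1), pointsUp (F ((k + 1 : ℕ) : ℤ)))

theorem periodic_underpassLetter {F : ℤ → ℤ} (hF : ∀ i, F (i + 6) = F i + 4) :
    Function.Periodic (underpassLetter F) 6 := by
  intro k
  have h_bridge : bridge (k + 6 + 1) = bridge (k + 1) := by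
    simp only [bridge, show k + 6 + 1 = k + 1 + 6 by ring, Nat.even_add, show Even 6 by decide,
      iff_true]
  have h_floor : F ((k + 6 + 1 : ℕ) : ℤ) = F ((k + 1 : ℕ) : ℤ) + 4 := by
    rw [← hF]
    push_cast
    ring_nf
  simp only [underpassLetter, h_bridge, h_floor, pointsUp, Int.even_add,
    show Even (4 : ℤ) by decide, iff_true]

theorem schubertWord_div {a b : ℤ} (hab : IsCoprime a b) {F : ℤ → ℤ}
    (hF : ∀ i, 0 < i → i < b → ⌊(i : ℚ) * ((a : ℚ) / b)⌋ = F i) {N : ℕ} (hN : b = N + 1) :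
    schubertWord ((a : ℚ) / b) = (List.range N).map (underpassLetter F) := by
  have h_den : (((a : ℚ) / b).den : ℤ) = b :=
    Rat.den_div_eq_of_coprime (by lia) (Int.isCoprime_iff_nat_coprime.1 hab)
  rw [schubertWord, show ((a : ℚ) / b).den - 1 = N by lia]
  refine List.map_congr_left fun k hk => ?_
  rw [List.mem_range] at hk
  rw [underpassLetter, ← hF _ (by positivity) (by lia)]
  simp only [Int.cast_natCast]

theorem mk_map_range_mul {α : Type*} {f : ℕ → α × Bool} {c : ℕ} (hf : Function.Periodic f c)
    (m : ℕ) :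
    FreeGroup.mk ((List.range (c * m)).map f) = FreeGroup.mk ((List.range c).map f) ^ m := by
  induction m with
  | zero => simp [FreeGroup.one_eq_mk]
  | succ m ih =>
    have h_block : (f ∘ fun k => c * m + k) = f := by
      funext k
      simpa [add_comm, mul_comm] using hf.nsmul m k
    rw [Nat.mul_succ, List.range_add, List.map_append, ← FreeGroup.mul_mk, ih, pow_succ,
      List.map_map, h_block]

/-- The slope `r = (4n + 1) / (6n + 1)` of Schubert's normal form of the knot `C(2n, 3)`. -/
def schubertSlope (n : ℤ) : ℚ := (4 * (n : ℚ) + 1) / (6 * (n : ℚ) + 1)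

theorem odd_den_schubertSlope (n : ℤ) : Odd (schubertSlope n).den := by
  have h_dvd : ((schubertSlope n).den : ℤ) ∣ 6 * n + 1 := by
    have := Rat.den_dvd (4 * n + 1) (6 * n + 1)
    rwa [Rat.divInt_eq_div, Int.cast_add, Int.cast_add, Int.cast_mul, Int.cast_mul] at this
  rw [← Nat.not_even_iff_odd]
  intro h_even
  have h_two : (2 : ℤ) ∣ 6 * n + 1 := (Int.natCast_dvd_natCast.2 h_even.two_dvd).trans h_dvd
  lia

theorem schubertWord_schubertSlope_natCast (m : ℕ) :
    schubertWord (schubertSlope m) =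
      (List.range (6 * m)).map (underpassLetter fun i => 2 * i / 3) := by
  rw [← schubertWord_div (a := 4 * m + 1) (b := 6 * m + 1) ⟨3, -2, by ring⟩
    (fun i => floor_mul_div_of_eq_add_one (by ring)) (by simp), schubertSlope]
  push_cast
  rfl

theorem schubertWord_schubertSlope_neg_succ (m : ℕ) :
    schubertWord (schubertSlope (-(m + 1))) =
      (List.range (6 * m + 4)).map (underpassLetter fun i => (2 * i - 1) / 3) := by
  rw [← schubertWord_div (a := 4 * m + 3) (b := 6 * m + 5) ⟨-3, 2, by ring⟩
    (fun i => floor_mul_div_of_add_one_eq (by ring)) (by push_cast; ring), schubertSlope,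
    ← neg_div_neg_eq]
  push_cast
  ring_nf

theorem mk_schubertWord_of_pos {n : ℤ} (hn : 0 < n) :
    FreeGroup.mk (schubertWord (schubertSlope n)) = w n := by
  lift n to ℕ using hn.le
  rw [schubertWord_schubertSlope_natCast, w, zpow_natCast,
    mk_map_range_mul (periodic_underpassLetter fun i => by lia)]
  rfl

theorem mk_schubertWord_of_neg {n : ℤ} (hn : n < 0) :
    FreeGroup.mk (schubertWord (schubertSlope n)) = s * w n * t := by
  obtain ⟨m, rfl⟩ : ∃ m : ℕ, n = -((m : ℤ) + 1) := ⟨(-n - 1).toNat, by lia⟩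
  set f := underpassLetter fun i => (2 * i - 1) / 3
  have hf : Function.Periodic f 6 := periodic_underpassLetter fun i => by lia
  have h_tail : FreeGroup.mk ((List.range 2).map fun k => f (6 * m + 4 + k)) = t⁻¹ * s⁻¹ := by
    have h_letter (k : ℕ) : f (6 * m + 4 + k) = f (4 + k) := by
      simpa [add_comm, mul_comm, add_assoc] using hf.nsmul m (4 + k)
    simp only [h_letter]
    rfl
  -- Two more letters complete the word to `m + 1` full periods.
  have h_complete : FreeGroup.mk (schubertWord (schubertSlope (-(m + 1)))) * (t⁻¹ * s⁻¹) =
      FreeGroup.mk ((List.range (6 * (m + 1))).map f) := by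
    rw [schubertWord_schubertSlope_neg_succ, ← h_tail, FreeGroup.mul_mk,
      show 6 * (m + 1) = 6 * m + 4 + 2 by ring, List.range_add (n := 6 * m + 4),
      List.map_append, List.map_map]
    rfl
  have h_period : FreeGroup.mk ((List.range 6).map f) =
      s * (t * s⁻¹ * t * s * t⁻¹ * s)⁻¹ * s⁻¹ := by
    trans t * s⁻¹ * t⁻¹ * s * t⁻¹ * s⁻¹
    · rfl
    · group
  rw [mk_map_range_mul hf, h_period, conj_pow, inv_pow, ← eq_mul_inv_iff_mul_eq] at h_complete
  rw [h_complete, w, zpow_neg, ← Nat.cast_add_one, zpow_natCast, mul_inv_rev, inv_inv, inv_inv]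
  simp only [mul_assoc, inv_mul_cancel_left]

theorem toWord_eq_of_isReduced {α : Type*} [DecidableEq α] {g : FreeGroup α}
    {L : List (α × Bool)} (hg : g = FreeGroup.mk L) (hL : FreeGroup.IsReduced L) :
    g.toWord = L := by
  rw [hg, FreeGroup.toWord_mk, hL.reduce_eq]

theorem toWord_relator_of_pos {n : ℤ} (hn : 0 < n) :
    (relator n).toWord = [(Gen.s, true)] ++ schubertWord (schubertSlope n) ++ [(Gen.t, false)] ++
      FreeGroup.invRev (schubertWord (schubertSlope n)) := by
  refine toWord_eq_of_isReduced ?_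
    (isReduced_cons_schubertWord (odd_den_schubertSlope n) true false)
  simp only [← FreeGroup.mul_mk, ← FreeGroup.inv_mk, mk_schubertWord_of_pos hn]
  rfl

theorem toWord_relator_of_neg {n : ℤ} (hn : n < 0) :
    (relator n).toWord = schubertWord (schubertSlope n) ++ [(Gen.t, false)] ++
      FreeGroup.invRev (schubertWord (schubertSlope n)) ++ [(Gen.s, true)] := by
  refine toWord_eq_of_isReduced ?_
    (isReduced_schubertWord_append (odd_den_schubertSlope n) false true)
  simp only [← FreeGroup.mul_mk, ← FreeGroup.inv_mk, mk_schubertWord_of_neg hn]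
  change relator n = s * w n * t * t⁻¹ * (s * w n * t)⁻¹ * s
  rw [relator]
  group

end SchubertWord

end TwoBridge

open TwoBridge in
theorem proposition2p1 (n : ℤ) :
    -- the fundamental group, for every knot `K` with Conway's notation `C(2n, 3)`
    (∀ K : Set S3, HasConwayNotation (2 * n) 3 K →
      (∀ x : ↥(Kᶜ), Nonempty (FundamentalGroup ↥(Kᶜ) x ≃* knotGroup n)) ∧
      (∀ φ : Circle × ℂ → S3, IsTubularNeighbourhood φ K →
        ∀ x : ↥(exterior φ), Nonempty (FundamentalGroup ↥(exterior φ) x ≃* knotGroup n))) ∧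
    -- `n > 0`: the reduced relator is `s u t⁻¹ u⁻¹`, with `u` read from Schubert's normal form
    (0 < n → ∀ u : List (Gen × Bool),
      u = schubertWord ((4 * (n : ℚ) + 1) / (6 * (n : ℚ) + 1)) →
        (relator n).toWord = [(Gen.s, true)] ++ u ++ [(Gen.t, false)] ++ FreeGroup.invRev u) ∧
    -- `n < 0`: it is `u t⁻¹ u⁻¹ s`, that is `u t⁻¹ u⁻¹ = s⁻¹`, the inverse of both sides
    -- of `u t u⁻¹ = s`
    (n < 0 → ∀ u : List (Gen × Bool),
      u = schubertWord ((4 * (n : ℚ) + 1) / (6 * (n : ℚ) + 1)) →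
        (relator n).toWord = u ++ [(Gen.t, false)] ++ FreeGroup.invRev u ++ [(Gen.s, true)]) := by
  exact ⟨fun K hK => nonempty_fundamentalGroup_mulEquiv_of_ambientIsotopic hK
      (nonempty_mulEquiv_knotGroup n),
    fun hn _ hu => hu ▸ toWord_relator_of_pos hn, fun hn _ hu => hu ▸ toWord_relator_of_neg hn⟩
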